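/- Let $d\ge 1$ and let $\mathbb H_d$ be the Siegel space of symmetric $\tau\in \mathrm M_d(\mathbb C)$ with $\operatorname{Im}\tau$ positive definite. Let $M=\mathbb Z(1)\oplus\mathbb Z^{2d}\oplus\mathbb Z$, where $\mathbb Z(1)=2\pi i\,\mathbb Z$, with basis $2\pi i e_0,e_1,\dots,e_{2d+1}$ and weight filtration $W_{-3}=0$, $W_{-2}=\mathbb Z(1)$, $W_{-1}=\mathbb Z(1)\oplus\mathbb Z^{2d}$, $W_0=M$. Let $D$ be the set of filtrations $F$ of $M_{\mathbb C}$ such that $(M,W,F)$ is a mixed Hodge structure of type $\{(-1,-1),(-1,0),(0,-1),(0,0)\}$ and $\Psi(x,y)=2\pi i\,x^t\left(\begin{smallmatrix}0&-1\\1&0\end{smallmatrix}\right)y$ is a polarisation of $\mathrm{Gr}^W_{-1}M=\mathbb Z^{2d}$. The map sending $(\tau,u,v,w)\in\mathbb H_d\times \mathrm M_{1,d}(\mathbb C)\times \mathrm M_{d,1}(\mathbb C)\times\mathbb C$ to the element of $D$ whose $F^0$ is the column space in $M_{\mathbb C}=\bigoplus_{j=0}^{2d+1}\mathbb C e_j$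 of $$\begin{pmatrix}u&w\\ \tau&v\\ 1_d&0\\ 0&1\end{pmatrix}$$ is a bijection, by which $D$ is regarded as a complex manifold. The Heisenberg group $P^u(\mathbb Z)$, consisting of the automorphisms of $M$ whose matrix with respect to the above basis is $\left(\begin{smallmatrix}1&x&z\\0&1_{2d}&y\\0&0&1\end{smallmatrix}\right)$ with integral $x,y,z$, acts on $D$. For $\tau\in\mathbb H_d$ put $A_\tau=\mathrm M_{d,1}(\mathbb C)/(1_d\ \ {-\tau})\,\mathrm M_{2d,1}(\mathbb Z)$ and $B_\tau=\mathrm M_{1,d}(\mathbb C)/\mathrm M_{1,2d}(\mathbb Z(1))\left(\begin{smallmatrix}\tau\\1_d\end{smallmatrix}\right)$, and let $A\to\mathbb H_d$ and $B\to\mathbb H_d$ be the families formed by these, with the quotient complex structures from $\mathbb H_d\times\mathrm M_{d,1}(\mathbb C)$ and $\mathbb H_d\times\mathrm M_{1,d}(\mathbb C)$. **Proposition.** The quotient $P^u(\mathbb Z)\backslash D$ is the universal Poincaré torsor over $\mathbb H_d$. That is: $P^u(\mathbb Z)\backslash D$, $A$ and $B$ are complex manifolds (Hausdorff and second countable) with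 locally biholomorphic quotient maps, and, with the projection $[\tau,u,v,w]\mapsto([\tau,v],[\tau,u])$ and the action of $\mathbb C^\times=\mathbb C/\mathbb Z(1)$ in which $e^{c}$ sends $[\tau,u,v,w]$ to $[\tau,u,v,w+c]$, the quotient $P^u(\mathbb Z)\backslash D$ is a holomorphic $\mathbb C^\times$-torsor over $A\times_{\mathbb H_d}B$. It is a biextension of $A$ and $B$ by $\mathbb C^\times$ for the partial group laws $$[\tau,u,v,w]+_1[\tau,u,v',w']=[\tau,u,v+v',w+w'],\qquad [\tau,u,v,w]+_2[\tau,u',v,w']=[\tau,u+u',v,w+w'],$$ which make it a family over $B$ of extensions of $A$ by $\mathbb C^\times$ and a family over $A$ of extensions of $B$ by $\mathbb C^\times$, respectively. Over $B$ it is the universal extension of $A$ by $\mathbb C^\times$: for every complex manifold $T$, every holomorphic $f:T\to\mathbb H_d$ and every extension $E$ over $T$ of $f^*A$ by $\mathbb C^\times$ (as families of commutative complex Lie groups, $E$ being a locally trivial holomorphic $\mathbb C^\times$-torsor over $f^*A$), there is a unique holomorphic $g:T\to B$ over $\mathbb H_d$ such that $E$ is isomorphic, as an extension of $f^*A$ by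 $\mathbb C^\times$, to the pullback of $P^u(\mathbb Z)\backslash D$ by $g$, and the isomorphism is unique. In particular $B$ is the dual of $A$. Likewise, over $A$ it is the universal extension of $B$ by $\mathbb C^\times$. -/

import Mathlib

open scoped TensorProduct Manifold ContDiff

universe u

noncomputable section

namespace PoincareTorsor

/-! ### Mixed Hodge structures -/

section Hodge

/-- The complexification `M_ℂ = ℂ ⊗ M` of a `ℤ`-module. -/
abbrev Cplx (M : Type) [AddCommGroup M] : Type := ℂ ⊗[ℤ] M

/-- Complex conjugation `z ⊗ m ↦ conj z ⊗ m` on `M_ℂ`. -/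
def cconj (M : Type) [AddCommGroup M] : Cplx M →ₛₗ[starRingEnd ℂ] Cplx M where
  toFun := LinearMap.rTensor M (starRingEnd ℂ).toAddMonoidHom.toIntLinearMap
  map_add' := map_add _
  map_smul' c x := by
    induction x using TensorProduct.induction_on with
    | zero => simp
    | tmul z m => simp [TensorProduct.smul_tmul']
    | add x y hx hy => simp only [smul_add, map_add, hx, hy]

/-- For a filtration `F` on `H_ℂ`: the subspace `H^{p,q} = F^p ∩ conj (F^q)`. -/
def hodgePiece {H : Type} [AddCommGroup H] (F : ℤ → Submodule ℂ (Cplx H)) (p q : ℤ) :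
    Submodule ℂ (Cplx H) :=
  F p ⊓ (F q).comap (cconj H)

/-- `F` is the Hodge filtration of a Hodge structure of weight `n` on `H`:
`H_ℂ = ⨁_{p+q=n} H^{p,q}`. -/
def IsHodgeFiltration {H : Type} [AddCommGroup H] (n : ℤ) (F : ℤ → Submodule ℂ (Cplx H)) : Prop :=
  DirectSum.IsInternal (fun p : ℤ => hodgePiece F p (n - p))

variable {M : Type} [AddCommGroup M]

/-- The graded piece `Gr^W_n M = W_n M / W_{n-1} M`. -/
abbrev Gr (W : ℤ → Submodule ℤ M) (n : ℤ) : Type :=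
  ↥(W n) ⧸ (W (n - 1)).submoduleOf (W n)

/-- The filtration induced by `F` on `(Gr^W_n M)_ℂ`. -/
def grFiltration (W : ℤ → Submodule ℤ M) (F : ℤ → Submodule ℂ (Cplx M)) (n p : ℤ) :
    Submodule ℂ (Cplx (Gr W n)) :=
  ((F p).comap ((W n).subtype.baseChange ℂ)).map
    (((W (n - 1)).submoduleOf (W n)).mkQ.baseChange ℂ)

/-- `(M, W, F)` is a mixed Hodge structure. -/
structure IsMixedHodgeStructure (W : ℤ → Submodule ℤ M) (F : ℤ → Submodule ℂ (Cplx M)) :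
    Prop where
  finite : Module.Finite ℤ M
  weight_mono : Monotone W
  weight_bot : ∃ n, W n = Submodule.torsion ℤ M
  weight_top : ∃ n, W n = ⊤
  weight_torsionFree : ∀ n, Module.IsTorsionFree ℤ (M ⧸ W n)
  hodge_anti : Antitone F
  hodge_top : ∃ p, F p = ⊤
  hodge_bot : ∃ p, F p = ⊥
  graded : ∀ n, IsHodgeFiltration n (grFiltration W F n)

/-- `(M, W, F)` is of type `T ⊆ ℤ²`: the pieces `(Gr^W_{p+q} M)^{p,q}` with `(p,q) ∉ T` vanish. -/
def HasHodgeType (W : ℤ → Submodule ℤ M) (F : ℤ → Submodule ℂ (Cplx M)) (T : Set (ℤ × ℤ)) : Prop :=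
  ∀ p q : ℤ, (p, q) ∉ T → hodgePiece (grFiltration W F (p + q)) p q = ⊥

/-- The Tate lattice `ℤ(m) = (2πi)^m ℤ ⊆ ℂ`. -/
abbrev Tate (m : ℤ) : AddSubgroup ℂ :=
  AddSubgroup.zmultiples ((2 * (Real.pi : ℂ) * Complex.I) ^ m)

/-- The `ℂ`-bilinear extension `H_ℂ × H_ℂ → ℂ` of a bilinear map `H × H → ℤ(m) ⊆ ℂ`. -/
def pairingC {H : Type} [AddCommGroup H] {m : ℤ} (Ψ : H →ₗ[ℤ] H →ₗ[ℤ] Tate m) :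
    Cplx H →ₗ[ℂ] Cplx H →ₗ[ℂ] ℂ :=
  LinearMap.liftBaseChange ℂ
    (((LinearMap.liftBaseChangeEquiv ℂ).toLinearMap.restrictScalars ℤ) ∘ₗ
      (LinearMap.compRight ℤ (Tate m).subtype.toIntLinearMap) ∘ₗ Ψ)

/-- `Ψ : H ⊗ H → ℤ(-n)` is a polarisation of the Hodge structure of weight `n` on `H` with Hodge
filtration `F`: it is a morphism of Hodge structures, and for `p + q = n` the form
`(v, w) ↦ (-1)^p Ψ(v, conj w)` is a complex inner product on `H^{p,q}`. -/
structure IsPolarisation {H : Type} [AddCommGroup H] (n : ℤ) (F : ℤ → Submodule ℂ (Cplx H))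
    (Ψ : H →ₗ[ℤ] H →ₗ[ℤ] Tate (-n)) : Prop where
  morphism : ∀ p p' : ℤ, p + p' ≠ n → ∀ v ∈ hodgePiece F p (n - p),
    ∀ w ∈ hodgePiece F p' (n - p'), pairingC Ψ v w = 0
  hermitian : ∀ p : ℤ, ∀ v ∈ hodgePiece F p (n - p), ∀ w ∈ hodgePiece F p (n - p),
    (-1 : ℂ) ^ p * pairingC Ψ w (cconj H v) =
      starRingEnd ℂ ((-1 : ℂ) ^ p * pairingC Ψ v (cconj H w))
  pos : ∀ p : ℤ, ∀ v ∈ hodgePiece F p (n - p), v ≠ 0 →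
    0 < ((-1 : ℂ) ^ p * pairingC Ψ v (cconj H v)).re ∧
      ((-1 : ℂ) ^ p * pairingC Ψ v (cconj H v)).im = 0

end Hodge

/-! ### The period domain `D` and the Heisenberg group -/

section Domain

variable (d : ℕ)

/-- The lattice `ℤ^{2d}`; `Sum.inl j` and `Sum.inr j` stand for `e_j` and `e_{d+j}`. -/
abbrev Mid : Type := Fin d ⊕ Fin d → ℤ

/-- `M = ℤ(1) ⊕ ℤ^{2d} ⊕ ℤ`. -/
abbrev Lat : Type := Tate 1 × Mid d × ℤ

/-- The generator `2πi` of `ℤ(1)`. -/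
def tateGen : Tate 1 := ⟨2 * (Real.pi : ℂ) * Complex.I, by simp [Tate]⟩

/-- The weight filtration: `W_{-3} = 0`, `W_{-2} = ℤ(1)`, `W_{-1} = ℤ(1) ⊕ ℤ^{2d}`, `W_0 = M`. -/
def weight (n : ℤ) : Submodule ℤ (Lat d) where
  carrier := {m | (n < -2 → m.1 = 0) ∧ (n < -1 → m.2.1 = 0) ∧ (n < 0 → m.2.2 = 0)}
  zero_mem' := by simp
  add_mem' := by
    rintro a b ⟨h1, h2, h3⟩ ⟨k1, k2, k3⟩
    refine ⟨fun h => ?_, fun h => ?_, fun h => ?_⟩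
    · simp [h1 h, k1 h]
    · simp [h2 h, k2 h]
    · simp [h3 h, k3 h]
  smul_mem' := by
    rintro c a ⟨h1, h2, h3⟩
    refine ⟨fun h => ?_, fun h => ?_, fun h => ?_⟩
    · simp [h1 h]
    · simp [h2 h]
    · simp [h3 h]

/-- The identification `Gr^W_{-1} M → ℤ^{2d}` given by the standard basis. -/
def grMid : Gr (weight d) (-1) →ₗ[ℤ] Mid d :=
  Submodule.liftQ _
    ((LinearMap.fst ℤ (Mid d) ℤ) ∘ₗ (LinearMap.snd ℤ (Tate 1) (Mid d × ℤ)) ∘ₗ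
      (weight d (-1)).subtype)
    (by
      rintro ⟨m, hm⟩ h
      exact h.2.1 (by norm_num))

/-- `Ψ(x, y) = 2πi xᵗ (0 -1; 1 0) y` on `ℤ^{2d}`. -/
def stdPairing : Mid d →ₗ[ℤ] Mid d →ₗ[ℤ] Tate 1 :=
  LinearMap.mk₂ ℤ
    (fun x y => (∑ j, (x (Sum.inr j) * y (Sum.inl j) - x (Sum.inl j) * y (Sum.inr j))) • tateGen)
    (by intros; rw [← add_smul, ← Finset.sum_add_distrib]; congr 2; ext; simp; ring)
    (by intros; rw [smul_smul, Finset.mul_sum]; congr 2; ext; simp; ring)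
    (by intros; rw [← add_smul, ← Finset.sum_add_distrib]; congr 2; ext; simp; ring)
    (by intros; rw [smul_smul, Finset.mul_sum]; congr 2; ext; simp; ring)

/-- `Ψ` transported to `Gr^W_{-1} M`. -/
def grPairing : Gr (weight d) (-1) →ₗ[ℤ] Gr (weight d) (-1) →ₗ[ℤ] Tate (-(-1)) :=
  (stdPairing d).compl₁₂ (grMid d) (grMid d)

/-- `F` is a mixed Hodge structure on `(M, W)` of type `{(-1,-1), (-1,0), (0,-1), (0,0)}` for which
`Ψ` is a polarisation on `Gr^W_{-1} M`. -/
structure InD (F : ℤ → Submodule ℂ (Cplx (Lat d))) : Prop where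
  isMHS : IsMixedHodgeStructure (weight d) F
  hasType : HasHodgeType (weight d) F {(-1, -1), (-1, 0), (0, -1), (0, 0)}
  polarised : IsPolarisation (-1) (grFiltration (weight d) F (-1)) (grPairing d)

/-- The space `D`. -/
abbrev D : Type := {F : ℤ → Submodule ℂ (Cplx (Lat d)) // InD d F}

/-- The Heisenberg group `P^u(ℤ)`: the automorphisms of `M` whose matrix with respect to the basis
`2πi e₀, e₁, …, e_{2d+1}` is `(1 x z; 0 1 y; 0 0 1)`, with `x` a row, `y` a column, `z ∈ ℤ`. -/
def heisenberg : Subgroup (Lat d ≃ₗ[ℤ] Lat d) where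
  carrier := {g | ∃ (x y : Mid d) (z : ℤ), ∀ m : Lat d,
    g m = (m.1 + (∑ k, x k * m.2.1 k + z * m.2.2) • tateGen, m.2.1 + m.2.2 • y, m.2.2)}
  one_mem' := ⟨0, 0, 0, fun m => by simp⟩
  mul_mem' := by
    rintro g h ⟨x, y, z, hg⟩ ⟨x', y', z', hh⟩
    refine ⟨x + x', y + y', z + z' + ∑ k, x k * y' k, fun m => ?_⟩
    rw [LinearEquiv.mul_apply, hh, hg]
    ext1
    · simp only [add_assoc, ← add_smul]
      congr 2
      simp only [Pi.add_apply, Pi.smul_apply, smul_eq_mul, mul_add, add_mul,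
        Finset.sum_add_distrib, Finset.sum_mul]
      have : ∑ k, x k * (m.2.2 * y' k) = ∑ k, x k * y' k * m.2.2 :=
        Finset.sum_congr rfl fun _ _ => by ring
      rw [this]; ring
    · ext1
      · simp only [smul_add, add_assoc, add_comm (m.2.2 • y)]
      · rfl
  inv_mem' := by
    rintro g ⟨x, y, z, hg⟩
    refine ⟨-x, -y, -z + ∑ k, x k * y k, fun m => ?_⟩
    apply g.injective
    rw [show g (g⁻¹ m) = m from g.apply_symm_apply m, hg]
    ext1
    · simp only [add_assoc, ← add_smul]
      rw [left_eq_add]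
      convert zero_smul ℤ tateGen using 2
      simp only [Pi.add_apply, Pi.smul_apply, Pi.neg_apply, smul_eq_mul, mul_add, add_mul,
        Finset.sum_add_distrib, Finset.sum_mul, neg_mul, mul_neg, Finset.sum_neg_distrib]
      have : ∑ k, x k * (m.2.2 * y k) = ∑ k, x k * y k * m.2.2 :=
        Finset.sum_congr rfl fun _ _ => by ring
      rw [this]; ring
    · ext1
      · simp
      · rfl

/-- The action of automorphisms of `M` on filtrations of `M_ℂ`. -/
def moveFiltration (g : Lat d ≃ₗ[ℤ] Lat d) (F : ℤ → Submodule ℂ (Cplx (Lat d))) :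
    ℤ → Submodule ℂ (Cplx (Lat d)) :=
  fun p => (F p).map ((g : Lat d →ₗ[ℤ] Lat d).baseChange ℂ)

lemma moveFiltration_one (F : ℤ → Submodule ℂ (Cplx (Lat d))) : moveFiltration d 1 F = F := by
  funext p
  have h : (((1 : Lat d ≃ₗ[ℤ] Lat d) : Lat d →ₗ[ℤ] Lat d).baseChange ℂ) = LinearMap.id :=
    LinearMap.baseChange_id
  simp only [moveFiltration, h, Submodule.map_id]

lemma moveFiltration_mul (g h : Lat d ≃ₗ[ℤ] Lat d) (F : ℤ → Submodule ℂ (Cplx (Lat d))) :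
    moveFiltration d (g * h) F = moveFiltration d g (moveFiltration d h F) := by
  funext p
  have e : (((g * h : Lat d ≃ₗ[ℤ] Lat d) : Lat d →ₗ[ℤ] Lat d).baseChange ℂ) =
      ((g : Lat d →ₗ[ℤ] Lat d).baseChange ℂ) ∘ₗ ((h : Lat d →ₗ[ℤ] Lat d).baseChange ℂ) :=
    LinearMap.baseChange_comp _ _
  simp only [moveFiltration, e, Submodule.map_comp]

/-- The orbit relation of `P^u(ℤ)` on `D`. -/
def orbitSetoid : Setoid (D d) where
  r F F' := ∃ g ∈ heisenberg d, F'.1 = moveFiltration d g F.1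
  iseqv :=
    { refl := fun F => ⟨1, one_mem _, (moveFiltration_one d F.1).symm⟩
      symm := by
        rintro F F' ⟨g, hg, h⟩
        refine ⟨g⁻¹, inv_mem hg, ?_⟩
        rw [h, ← moveFiltration_mul, inv_mul_cancel, moveFiltration_one]
      trans := by
        rintro F F' F'' ⟨g, hg, h⟩ ⟨g', hg', h'⟩
        exact ⟨g' * g, mul_mem hg' hg, by rw [h', h, moveFiltration_mul]⟩ }

/-- The quotient `P^u(ℤ) \ D`. -/
def QuotD : Type := Quotient (orbitSetoid d)

/-- The quotient map `D → P^u(ℤ) \ D`. -/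
def toQuotD (F : D d) : QuotD d := Quotient.mk (orbitSetoid d) F

end Domain

/-! ### The Siegel space and the parametrisation of `D` -/

section Siegel

variable (d : ℕ)

/-- Symmetric complex `d × d` matrices. -/
def SymMat : Submodule ℂ (Fin d → Fin d → ℂ) where
  carrier := {τ | ∀ i j, τ i j = τ j i}
  zero_mem' := fun _ _ => rfl
  add_mem' := fun ha hb i j => by simp [ha i j, hb i j]
  smul_mem' := fun c a ha i j => by simp [ha i j]

lemma isOpen_siegel :
    IsOpen {τ : SymMat d | (Matrix.of fun i j => (τ.1 i j).im).PosDef} := by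
  have key : ∀ τ : SymMat d, (Matrix.of fun i j => (τ.1 i j).im).PosDef ↔
      ∀ x ∈ Metric.sphere (0 : Fin d → ℝ) 1, 0 < ∑ i, ∑ j, x i * (τ.1 i j).im * x j := by
    intro τ
    have hq : ∀ x : Fin d → ℝ, star x ⬝ᵥ (Matrix.of fun i j => (τ.1 i j).im).mulVec x =
        ∑ i, ∑ j, x i * (τ.1 i j).im * x j := by
      intro x
      simp [dotProduct, Matrix.mulVec, Finset.mul_sum, mul_assoc]
    rw [Matrix.posDef_iff_dotProduct_mulVec]
    constructor
    · rintro ⟨-, h⟩ x hx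
      have hx0 : x ≠ 0 := by
        rintro rfl
        simp at hx
      rw [← hq]
      exact h hx0
    · intro h
      refine ⟨?_, fun {x} hx => ?_⟩
      · ext i j
        simp [τ.2 i j]
      · rw [hq]
        have hn : 0 < ‖x‖ := norm_pos_iff.mpr hx
        have h1 := h (‖x‖⁻¹ • x) (by simp [norm_smul, hn.ne'])
        have h2 : ∑ i, ∑ j, (‖x‖⁻¹ • x) i * (τ.1 i j).im * (‖x‖⁻¹ • x) j =
            ‖x‖⁻¹ ^ 2 * ∑ i, ∑ j, x i * (τ.1 i j).im * x j := by
          simp only [Finset.mul_sum, Pi.smul_apply, smul_eq_mul]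
          refine Finset.sum_congr rfl fun i _ => Finset.sum_congr rfl fun j _ => ?_
          ring
        rw [h2] at h1
        exact pos_of_mul_pos_right h1 (by positivity)
  simp only [key]
  rw [isOpen_iff_eventually]
  intro τ hτ
  refine (isCompact_sphere (0 : Fin d → ℝ) 1).eventually_forall_of_forall_eventually fun x hx => ?_
  have hc : Continuous (fun z : SymMat d × (Fin d → ℝ) =>
      ∑ i, ∑ j, z.2 i * (z.1.1 i j).im * z.2 j) := by
    refine continuous_finsetSum _ fun i _ => continuous_finsetSum _ fun j _ => ?_
    have h1 : Continuous fun z : SymMat d × (Fin d → ℝ) => (z.1.1 i j).im :=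
      Complex.continuous_im.comp
        ((continuous_apply_apply i j).comp (continuous_subtype_val.comp continuous_fst))
    exact (((continuous_apply i).comp continuous_snd).mul h1).mul
      ((continuous_apply j).comp continuous_snd)
  exact hc.continuousAt.eventually (lt_mem_nhds (hτ x hx))

/-- The Siegel space `ℍ_d`: symmetric complex matrices with positive definite imaginary part. -/
def Siegel : TopologicalSpace.Opens (SymMat d) :=
  ⟨{τ : SymMat d | (Matrix.of fun i j => (τ.1 i j).im).PosDef}, isOpen_siegel d⟩

/-- The entry `τ_{ij}` of a point of `ℍ_d`. -/
abbrev ent {d : ℕ} (τ : Siegel d) (i j : Fin d) : ℂ := τ.1.1 i j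

/-- `ℍ_d × M_{1,d}(ℂ) × M_{d,1}(ℂ) × ℂ`, with points `(τ, u, v, w)`. -/
abbrev Coord : Type := Siegel d × (Fin d → ℂ) × (Fin d → ℂ) × ℂ

/-- The vector `a e₀ + ∑ bⱼ eⱼ + ∑ b'ⱼ e_{d+j} + c e_{2d+1}` of `M_ℂ`; here `e₀` is
`(2πi)⁻¹ ⊗ 2πi`, so that `2πi e₀` is the generator of `ℤ(1)`. -/
def vec (a : ℂ) (b b' : Fin d → ℂ) (c : ℂ) : Cplx (Lat d) :=
  (a * (2 * (Real.pi : ℂ) * Complex.I)⁻¹) ⊗ₜ[ℤ] ((tateGen, 0, 0) : Lat d)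
    + ∑ j, b j ⊗ₜ[ℤ] ((0, Pi.single (Sum.inl j) 1, 0) : Lat d)
    + ∑ j, b' j ⊗ₜ[ℤ] ((0, Pi.single (Sum.inr j) 1, 0) : Lat d)
    + c ⊗ₜ[ℤ] ((0, 0, 1) : Lat d)

/-- The column space in `M_ℂ` of the matrix with rows `(u w)`, `(τ v)`, `(1 0)`, `(0 1)`. -/
def colSpace (x : Coord d) : Submodule ℂ (Cplx (Lat d)) :=
  Submodule.span ℂ
    (Set.range (fun j : Fin d => vec d (x.2.1 j) (fun i => ent x.1 i j) (Pi.single j 1) 0) ∪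
      {vec d x.2.2.2 x.2.2.1 0 1})

/-- The lattice `(1 -τ) ℤ^{2d} ⊆ ℂ^d`; the abelian variety at `τ` is `A_τ = ℂ^d / (1 -τ) ℤ^{2d}`. -/
def latticeA (τ : Siegel d) : AddSubgroup (Fin d → ℂ) :=
  AddMonoidHom.range
    (⟨⟨fun m i => (m.1 i : ℂ) - ∑ j, ent τ i j * (m.2 j : ℂ), by ext; simp⟩, by
      intro m m'
      ext i
      simp [mul_add, Finset.sum_add_distrib]
      ring⟩ : (Fin d → ℤ) × (Fin d → ℤ) →+ (Fin d → ℂ))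

/-- The lattice `M_{1,2d}(ℤ(1)) (τ; 1) ⊆ M_{1,d}(ℂ)`, consisting of the rows `2πi (n₁ τ + n₂)`;
the dual abelian variety at `τ` is `B_τ = M_{1,d}(ℂ) / M_{1,2d}(ℤ(1)) (τ; 1)`. -/
def latticeB (τ : Siegel d) : AddSubgroup (Fin d → ℂ) :=
  AddMonoidHom.range
    (⟨⟨fun n j => 2 * (Real.pi : ℂ) * Complex.I * (∑ i, (n.1 i : ℂ) * ent τ i j + (n.2 j : ℂ)),
        by ext; simp⟩, by
      intro n n'
      ext i
      simp [add_mul, Finset.sum_add_distrib]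
      ring⟩ : (Fin d → ℤ) × (Fin d → ℤ) →+ (Fin d → ℂ))

end Siegel

/-! ### Complex structures on quotients -/

/-- The complex structure on `Y` is the one of the quotient of the complex manifold `X` by the
surjection `q : X → Y`: `Y` is a complex manifold (Hausdorff and second countable), and `q` is
locally biholomorphic. There is at most one such complex structure on `Y`. -/
structure IsComplexQuotient {EX HX X EY Y : Type*} [NormedAddCommGroup EX] [NormedSpace ℂ EX]
    [TopologicalSpace HX] (I : ModelWithCorners ℂ EX HX) [TopologicalSpace X] [ChartedSpace HX X]
    [NormedAddCommGroup EY] [NormedSpace ℂ EY] [TopologicalSpace Y] [ChartedSpace EY Y]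
    (q : X → Y) : Prop where
  isManifold : IsManifold 𝓘(ℂ, EY) ω Y
  t2 : T2Space Y
  secondCountable : SecondCountableTopology Y
  surjective : Function.Surjective q
  isLocalDiffeomorph : IsLocalDiffeomorph I 𝓘(ℂ, EY) ω q

/-! ### Extensions of families of complex tori by `ℂˣ` -/

section Extensions

/-- The total space of the family of quotients `V / Λ_s`, `s ∈ S`. -/
structure Total {S V : Type*} [AddCommGroup V] (Λ : S → AddSubgroup V) where
  /-- The point of the base. -/
  base : S
  /-- The point of the fibre. -/
  pt : V ⧸ Λ base

/-- The class of `v` in the fibre `V / Λ_s` of the total space. -/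
def Total.cls {S V : Type*} [AddCommGroup V] (Λ : S → AddSubgroup V) (s : S) (v : V) : Total Λ :=
  ⟨s, QuotientAddGroup.mk v⟩

open Classical in
/-- Fibrewise addition; only meaningful for two points of the same fibre of `π`. -/
def fibAdd {E T : Type*} (π : E → T) [∀ t, AddCommGroup ↥(π ⁻¹' {t})] (e e' : E) : E :=
  if h : π e' = π e then ((⟨e, rfl⟩ : ↥(π ⁻¹' {π e})) + ⟨e', h⟩).1 else e

open Classical in
/-- Fibrewise subtraction; only meaningful for two points of the same fibre of `π`. -/
def fibSub {E T : Type*} (π : E → T) [∀ t, AddCommGroup ↥(π ⁻¹' {t})] (e e' : E) : E :=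
  if h : π e' = π e then ((⟨e, rfl⟩ : ↥(π ⁻¹' {π e})) - ⟨e', h⟩).1 else e

variable {ET : Type*} [NormedAddCommGroup ET] [NormedSpace ℂ ET]
  {T : Type*} [TopologicalSpace T] [ChartedSpace ET T]
  {V : Type*} [NormedAddCommGroup V] [NormedSpace ℂ V]
  {EE : Type*} [NormedAddCommGroup EE] [NormedSpace ℂ EE]

/-- A structure, on the complex manifold `E`, of extension over `T` of the family of complex tori
`V / Λ_t` by `ℂˣ`, in the category of families of commutative complex Lie groups over `T`:
each fibre `E_t` is an extension `0 → ℂˣ → E_t → V / Λ_t → 0`; locally on the family of tori, `E` has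
holomorphic sections that trivialise it as a holomorphic principal `ℂˣ`-bundle; and the group law
is holomorphic on `E ×_T E`, which is tested on maps from open subsets of the spaces `ℂⁿ`. -/
structure TorusExtension (ET T EE E : Type*) [NormedAddCommGroup ET] [NormedSpace ℂ ET]
    [TopologicalSpace T] [ChartedSpace ET T] [NormedAddCommGroup EE] [NormedSpace ℂ EE]
    [TopologicalSpace E] [ChartedSpace EE E] {V : Type*} [NormedAddCommGroup V] [NormedSpace ℂ V]
    (Λ : T → AddSubgroup V) where
  /-- The projection to the base. -/
  π : E → T
  /-- The group structures on the fibres. -/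
  [grp : ∀ t, AddCommGroup ↥(π ⁻¹' {t})]
  /-- The inclusion of `ℂˣ` in the fibres. -/
  inc : ∀ t, Additive ℂˣ →+ ↥(π ⁻¹' {t})
  /-- The projection of the fibres to the tori. -/
  proj : ∀ t, ↥(π ⁻¹' {t}) →+ V ⧸ Λ t
  inc_injective : ∀ t, Function.Injective (inc t)
  exact : ∀ t, Function.Exact (inc t) (proj t)
  proj_surjective : ∀ t, Function.Surjective (proj t)
  locallyTrivial : ∀ (t₀ : T) (v₀ : V), ∃ (N : Set (T × V)) (s : ∀ p : T × V, ↥(π ⁻¹' {p.1})),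
    IsOpen N ∧ (t₀, v₀) ∈ N ∧
    (∀ p ∈ N, proj p.1 (s p) = QuotientAddGroup.mk p.2) ∧
    IsLocalDiffeomorphOn ((𝓘(ℂ, ET).prod 𝓘(ℂ, V)).prod 𝓘(ℂ, ℂ)) 𝓘(ℂ, EE) ω
      (fun q : (T × V) × ℂˣ => (inc q.1.1 (Additive.ofMul q.2) + s q.1 : ↥(π ⁻¹' {q.1.1})).1)
      (N ×ˢ Set.univ)
  holomorphic_sub : ∀ (n : ℕ) (U : Set (Fin n → ℂ)) (a b : (Fin n → ℂ) → E), IsOpen U →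
    ContMDiffOn 𝓘(ℂ, Fin n → ℂ) 𝓘(ℂ, EE) ω a U → ContMDiffOn 𝓘(ℂ, Fin n → ℂ) 𝓘(ℂ, EE) ω b U →
    (∀ x ∈ U, π (b x) = π (a x)) →
    ContMDiffOn 𝓘(ℂ, Fin n → ℂ) 𝓘(ℂ, EE) ω (fun x => fibSub π (a x) (b x)) U

attribute [instance] TorusExtension.grp

namespace TorusExtension

variable {E : Type*} [TopologicalSpace E] [ChartedSpace EE E] {Λ : T → AddSubgroup V}

/-- The action of `ℂˣ` on the total space of an extension. -/
def act (X : TorusExtension ET T EE E Λ) (z : ℂˣ) (e : E) : E :=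
  (X.inc (X.π e) (Additive.ofMul z) + (⟨e, rfl⟩ : ↥(X.π ⁻¹' {X.π e}))).1

/-- The point of `V / Λ_{β (π e)}` below the point `e` of an extension of the pullback of the
family `V / Λ_s` by `β`, as a point of the total space of this family. -/
def torusPoint {S : Type*} {Λ : S → AddSubgroup V} {β : T → S}
    (X : TorusExtension ET T EE E (fun t => Λ (β t))) (e : E) : Total Λ :=
  ⟨β (X.π e), X.proj (X.π e) ⟨e, rfl⟩⟩

end TorusExtension

variable {S : Type*} {Λ : S → AddSubgroup V}
  {EB : Type*} [NormedAddCommGroup EB] [NormedSpace ℂ EB]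
  {B : Type*} [TopologicalSpace B] [ChartedSpace EB B]
  {EP : Type*} [NormedAddCommGroup EP] [NormedSpace ℂ EP]
  {P : Type*} [TopologicalSpace P] [ChartedSpace EP P]
  {E : Type*} [TopologicalSpace E] [ChartedSpace EE E]

/-- For `f : T → S`, `β : B → S` and `g : T → B` with `β ∘ g = f`: an isomorphism from an extension
`Y` over `T` to the pullback by `g` of an extension `X` over `B`, inducing the identity on `ℂˣ` and on
the tori `V / Λ_{f t} = V / Λ_{β (g t)}`. -/
structure PullbackIso {f : T → S} {β : B → S}
    (Y : TorusExtension ET T EE E (fun t => Λ (f t)))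
    (X : TorusExtension EB B EP P (fun b => Λ (β b))) (g : T → B) where
  /-- The isomorphism on fibres. -/
  iso : ∀ t, ↥(Y.π ⁻¹' {t}) ≃+ ↥(X.π ⁻¹' {g t})
  iso_inc : ∀ t z, iso t (Y.inc t z) = X.inc (g t) z
  iso_proj : ∀ t e (v : V), Y.proj t e = QuotientAddGroup.mk v →
    X.proj (g t) (iso t e) = QuotientAddGroup.mk v
  holomorphic : ContMDiff 𝓘(ℂ, EE) 𝓘(ℂ, EP) ω (fun e : E => (iso (Y.π e) ⟨e, rfl⟩).1)

variable [TopologicalSpace S]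

/-- The extension `X` over `β : B → S` of the pullback to `B` of the family of tori `V / Λ_s`, `s ∈ S`,
is the universal one: for every complex manifold `T`, every holomorphic `f : T → S`, and every
extension `Y` over `T` of the pullback of the family by `f`, there is a unique holomorphic `g : T → B`
over `S` such that `Y` is isomorphic to the pullback of `X`; and the isomorphism is unique. -/
def IsUniversalExtension (ES : Type*) [NormedAddCommGroup ES] [NormedSpace ℂ ES]
    [ChartedSpace ES S] (β : B → S) (X : TorusExtension EB B EP P (fun b => Λ (β b))) : Prop :=
  ∀ (ET T EE E : Type u) [NormedAddCommGroup ET] [NormedSpace ℂ ET] [FiniteDimensional ℂ ET]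
    [TopologicalSpace T] [ChartedSpace ET T] [IsManifold 𝓘(ℂ, ET) ω T]
    [NormedAddCommGroup EE] [NormedSpace ℂ EE] [FiniteDimensional ℂ EE]
    [TopologicalSpace E] [ChartedSpace EE E] [IsManifold 𝓘(ℂ, EE) ω E]
    (f : T → S), ContMDiff 𝓘(ℂ, ET) 𝓘(ℂ, ES) ω f →
    ∀ Y : TorusExtension ET T EE E (fun t => Λ (f t)),
      (∃! g : T → B, ContMDiff 𝓘(ℂ, ET) 𝓘(ℂ, EB) ω g ∧ (∀ t, β (g t) = f t) ∧
        Nonempty (PullbackIso Y X g)) ∧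
      ∀ g : T → B, (∀ t, β (g t) = f t) → Subsingleton (PullbackIso Y X g)

/-- Let `V / Λ_s` and `V' / Λ'_s` be two families of complex tori over `S`, with total spaces `A` and
`B`. The data of this structure make `P` a Poincaré torsor on `A ×_S B`: a biextension of `A` and `B`
by `ℂˣ` which is, over `B`, the universal extension of `A` by `ℂˣ` (so that `B` is the dual of `A`),
and, over `A`, the universal extension of `B` by `ℂˣ`. -/
structure IsPoincareTorsor (ES : Type*) [NormedAddCommGroup ES] [NormedSpace ℂ ES]
    [ChartedSpace ES S] {V' : Type*} [NormedAddCommGroup V'] [NormedSpace ℂ V']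
    (Λ : S → AddSubgroup V) (Λ' : S → AddSubgroup V')
    [TopologicalSpace (Total Λ)] [ChartedSpace (ES × V) (Total Λ)]
    [TopologicalSpace (Total Λ')] [ChartedSpace (ES × V') (Total Λ')]
    (X : TorusExtension (ES × V') (Total Λ') EP P (fun b => Λ b.base))
    (X' : TorusExtension (ES × V) (Total Λ) EP P (fun a => Λ' a.base)) : Prop where
  base : ∀ e, X'.π e = X.torusPoint (Λ := Λ) (β := Total.base) e
  base' : ∀ e, X.π e = X'.torusPoint (Λ := Λ') (β := Total.base) e
  act_eq : ∀ z e, X.act z e = X'.act z e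
  interchange : ∀ p q r s : P, X.π p = X.π q → X.π r = X.π s → X'.π p = X'.π r → X'.π q = X'.π s →
    fibAdd X'.π (fibAdd X.π p q) (fibAdd X.π r s) = fibAdd X.π (fibAdd X'.π p r) (fibAdd X'.π q s)
  universal : IsUniversalExtension.{u} (Λ := Λ) ES Total.base X
  universal' : IsUniversalExtension.{u} (Λ := Λ') ES Total.base X'

end Extensions

end PoincareTorsor

end

/-! Everything is read in the coordinates $(\tau,u,v,w)$. There the Heisenberg group acts by
`moveCoord`: $u$ and $v$ move by points of two lattices, and $w$ by pairings of integral vectors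
with $u$ and $v$ and by a multiple of $2\pi i$.

Period domain. The allowed Hodge types force $F^{-1}$ to be everything and $F^1$ to be zero
(`InD.top`, `InD.bot`). On $\mathrm{Gr}_{-1}$, positivity and a dimension count make $F^0$ the graph
of a matrix $\tau$; isotropy and positivity for the polarisation say that $\tau$ is symmetric with
positive imaginary part (`InD.exists_period`). Since $F^0$ is zero on $\mathrm{Gr}_{-2}$ and
everything on $\mathrm{Gr}_0$, it is spanned by normalised columns as in the theorem
(`InD.exists_eq_stdFil`). Applying a Heisenberg matrix to the columns and normalising again gives
`moveCoord` (`baseChange_colVec`).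

Manifolds. The norms of lattice points are bounded below uniformly for $\tau$ near a given point
(`exists_le_norm_latPt`). Hence the actions are free and properly discontinuous, and
`exists_isComplexQuotient` provides the charts.

Universality. Let $Y$ be an extension of $V/\Lambda_t$ by $\mathbb C^\times$. The failure of a local
section to be additive is a $\mathbb C^\times$-valued cocycle, analytic in parameters, and
`exists_local_trivialisation_of_cocycle` integrates it. The resulting local homomorphisms extend to
$V$ by division by integers, so the pullback of $Y$ to $V$ splits, holomorphically in $t$
(`TorusExtension.exists_local_splitting`), and $Y_t$ is described by a character of $\Lambda_t$. Two
splittings differ by the exponential of a linear form. This freedom is used to make the character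
trivial on the half $\kappa\mathbb Z^d$ of the lattice; on the other half it has the values
$\exp(\kappa u_j)$ (`IsAdapted`, `exists_local_adapted`). The linear forms that remain are integral
on $\kappa\mathbb Z^d$ up to $2\pi i$, and they move $u$ by the dual lattice
(`IsAdapted.exists_eq`). So $Y_t$ determines the point $[\tau,u]$ of the dual torus, and the fibre
of the Poincaré torsor over $[\tau,u]$ has the same character. This gives existence and uniqueness
of the classifying map. The isomorphism is unique because the splitting adapted to a given $u$ is.

Symmetry. All this is done for lattices of scale $\kappa$ and $2\pi i/\kappa$. Exchanging $u$ and
$v$ exchanges the two scales (`PoincareChart.swap`), so that the second universal property is an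
instance of the first. -/

noncomputable section
namespace PoincareTorsor
open Filter Topology

/-! ### Analytic cocycles with parameters -/

section Analytic

set_option linter.unusedSectionVars false

variable {P : Type*} [NormedAddCommGroup P] [NormedSpace ℂ P]

/-- The linear map `(p, x) ↦ (p, r x)`. -/
def scaleSnd (P : Type*) [NormedAddCommGroup P] [NormedSpace ℂ P] (r : ℝ) :
    P × ℂ →L[ℂ] P × ℂ :=
  ContinuousLinearMap.inl ℂ P ℂ ∘L ContinuousLinearMap.fst ℂ P ℂ +
    (r : ℂ) • (ContinuousLinearMap.inr ℂ P ℂ ∘L ContinuousLinearMap.snd ℂ P ℂ)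

lemma scaleSnd_apply (r : ℝ) (z : P × ℂ) : scaleSnd P r z = (z.1, r * z.2) := by
  simp [scaleSnd]

lemma norm_scaleSnd_le {r : ℝ} (h0 : 0 ≤ r) (h1 : r ≤ 1) : ‖scaleSnd P r‖ ≤ 1 := by
  refine ContinuousLinearMap.opNorm_le_bound _ zero_le_one fun z => ?_
  rw [scaleSnd_apply, one_mul, Prod.norm_def, Prod.norm_def]
  refine max_le_max le_rfl ?_
  rw [norm_mul, Complex.norm_real, Real.norm_of_nonneg h0]
  exact mul_le_of_le_one_left (norm_nonneg _) h1

lemma continuous_scaleSnd : Continuous (scaleSnd P) := by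
  exact continuous_const.add (Complex.continuous_ofReal.smul continuous_const)

/-- The power series of `f` may be integrated term by term: scaling the second variable by `r ≤ 1`
does not increase the norms of the coefficients, so the integrated series converges on the same
ball. -/
lemma analyticAt_integral_scaleSnd {f : P × ℂ → ℂ} {p₀ : P} (hf : AnalyticAt ℂ f (p₀, 0)) :
    AnalyticAt ℂ (fun z : P × ℂ => ∫ r in (0 : ℝ)..1, f (z.1, r * z.2)) (p₀, 0) := by
  obtain ⟨p, ρ, hp⟩ := hf
  let G : ∀ n : ℕ, ℝ → ((P × ℂ) [×n]→L[ℂ] ℂ) := fun n r =>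
    (p n).compContinuousLinearMap fun _ => scaleSnd P r
  have hG : ∀ n, Continuous (G n) := by
    intro n
    have := (ContinuousMultilinearMap.compContinuousLinearMapContinuousMultilinear ℂ
      (fun _ : Fin n => P × ℂ) (fun _ : Fin n => P × ℂ) ℂ).cont
    have h2 : Continuous fun r : ℝ => (fun _ : Fin n => scaleSnd P r) :=
      continuous_pi fun _ => continuous_scaleSnd
    exact (ContinuousLinearMap.apply ℂ _ (p n)).continuous.comp (this.comp h2)
  have hGn : ∀ n, ∀ r ∈ Set.Icc (0 : ℝ) 1, ‖G n r‖ ≤ ‖p n‖ := by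
    intro n r hr
    refine (ContinuousMultilinearMap.norm_compContinuousLinearMap_le _ _).trans ?_
    refine mul_le_of_le_one_right (norm_nonneg _) ?_
    exact Finset.prod_le_one (fun _ _ => norm_nonneg _) fun _ _ => norm_scaleSnd_le hr.1 hr.2
  let q : FormalMultilinearSeries ℂ (P × ℂ) ℂ := fun n => ∫ r in (0 : ℝ)..1, G n r
  have hq : ∀ n, ‖q n‖ ≤ ‖p n‖ := by
    intro n
    have := intervalIntegral.norm_integral_le_of_norm_le_const (a := (0 : ℝ)) (b := 1)
      (C := ‖p n‖) (f := G n) fun r hr => hGn n r (by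
        rw [Set.uIoc_of_le zero_le_one] at hr; exact ⟨hr.1.le, hr.2⟩)
    simpa using this
  refine ⟨q, ρ, ⟨hp.r_le.trans ?_, hp.r_pos, fun {y} hy => ?_⟩⟩
  · refine ENNReal.le_of_forall_nnreal_lt fun r hr => ?_
    obtain ⟨C, hC⟩ := p.norm_mul_pow_le_of_lt_radius hr
    refine q.le_radius_of_bound C fun n => ?_
    exact (mul_le_mul_of_nonneg_right (hq n) (by positivity)).trans (hC.2 n)
  · have hint : ∀ n, (q n fun _ => y) = ∫ r in (0 : ℝ)..1, (p n fun _ => scaleSnd P r y) := by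
      intro n
      have hi : IntervalIntegrable (G n) MeasureTheory.volume 0 1 :=
        (hG n).intervalIntegrable _ _
      simp only [q]
      rw [intervalIntegral.integral_of_le zero_le_one, intervalIntegral.integral_of_le zero_le_one,
        ContinuousMultilinearMap.integral_apply hi.1]
      rfl
    simp only [hint]
    have hyr : ∀ r ∈ Set.Icc (0 : ℝ) 1, ‖scaleSnd P r y‖ ≤ ‖y‖ := fun r hr => by
      simpa using (scaleSnd P r).le_of_opNorm_le (norm_scaleSnd_le hr.1 hr.2) y
    refine intervalIntegral.hasSum_integral_of_dominated_convergence
      (fun n _ => ‖p n‖ * ‖y‖ ^ n) (fun n => ?_) (fun n => ?_) ?_ ?_ ?_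
    · refine Continuous.aestronglyMeasurable ?_
      exact (p n).cont.comp (continuous_pi fun _ =>
        (continuous_scaleSnd.clm_apply continuous_const))
    · refine Eventually.of_forall fun r hr => ?_
      rw [Set.uIoc_of_le zero_le_one] at hr
      refine ((p n).le_opNorm _).trans ?_
      gcongr
      simp only [Finset.prod_const, Finset.card_univ, Fintype.card_fin]
      gcongr
      exact hyr r ⟨hr.1.le, hr.2⟩
    · refine Eventually.of_forall fun r _ => ?_
      have : (‖y‖₊ : ENNReal) < p.radius := by
        refine lt_of_lt_of_le ?_ hp.r_le
        simpa [enorm_eq_nnnorm] using hy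
      simpa using p.summable_norm_mul_pow this
    · exact intervalIntegrable_const
    · refine Eventually.of_forall fun r hr => ?_
      rw [Set.uIoc_of_le zero_le_one] at hr
      have h1 : scaleSnd P r y ∈ Metric.eball (0 : P × ℂ) ρ := by
        have := hyr r ⟨hr.1.le, hr.2⟩
        simp only [Metric.mem_eball, edist_zero_right] at hy ⊢
        refine lt_of_le_of_lt ?_ hy
        rw [enorm_le_iff_norm_le]; exact this
      have := hp.hasSum h1
      simpa [scaleSnd_apply] using this

/-- The primitive of `f` in the second variable that vanishes at `0`. -/
def primSnd (f : P × ℂ → ℂ) (z : P × ℂ) : ℂ := z.2 * ∫ r in (0 : ℝ)..1, f (z.1, r * z.2)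

lemma primSnd_zero (f : P × ℂ → ℂ) (p : P) : primSnd f (p, 0) = 0 := by simp [primSnd]

lemma analyticAt_primSnd {f : P × ℂ → ℂ} {p₀ : P} (hf : AnalyticAt ℂ f (p₀, 0)) :
    AnalyticAt ℂ (primSnd f) (p₀, 0) :=
  analyticAt_snd.mul (analyticAt_integral_scaleSnd hf)

/-- On a disc a holomorphic function has a primitive `g`; the fundamental theorem of calculus on the
segment from `0` to `y` identifies `primSnd` with `g - g 0`. -/
lemma hasDerivAt_primSnd {f : P × ℂ → ℂ} {p : P} {δ : ℝ}
    (hf : ∀ x ∈ Metric.ball (0 : ℂ) δ, DifferentiableAt ℂ (fun x => f (p, x)) x) {x : ℂ}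
    (hx : x ∈ Metric.ball (0 : ℂ) δ) :
    HasDerivAt (fun x => primSnd f (p, x)) (f (p, x)) x := by
  have hd : DifferentiableOn ℂ (fun x => f (p, x)) (Metric.ball 0 δ) := fun x hx =>
    (hf x hx).differentiableWithinAt
  obtain ⟨g, hg⟩ := hd.isExactOn_ball
  have key : ∀ y ∈ Metric.ball (0 : ℂ) δ, primSnd f (p, y) = g y - g 0 := by
    intro y hy
    have hmem : ∀ r ∈ Set.uIcc (0 : ℝ) 1, (r : ℂ) * y ∈ Metric.ball (0 : ℂ) δ := by
      intro r hr
      rw [Set.uIcc_of_le zero_le_one] at hr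
      simp only [Metric.mem_ball, dist_zero_right] at hy ⊢
      rw [norm_mul, Complex.norm_real, Real.norm_of_nonneg hr.1]
      exact (mul_le_of_le_one_left (norm_nonneg _) hr.2).trans_lt hy
    have h1 : ∀ r ∈ Set.uIcc (0 : ℝ) 1,
        HasDerivAt (fun r : ℝ => g (r * y)) (y * f (p, r * y)) r := by
      intro r hr
      have h2 := hg _ (hmem r hr)
      have h3 : HasDerivAt (fun r : ℝ => (r : ℂ) * y) y r := by
        simpa using (Complex.ofRealCLM.hasDerivAt (x := r)).mul_const y
      have := h2.comp r h3
      simpa [mul_comm, Function.comp_def] using this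
    have h4 := intervalIntegral.integral_eq_sub_of_hasDerivAt h1 (by
      refine ContinuousOn.intervalIntegrable fun r hr => ?_
      refine ContinuousAt.continuousWithinAt (continuousAt_const.mul ?_)
      exact ContinuousAt.comp (f := fun r : ℝ => (r : ℂ) * y) (g := fun x => f (p, x))
        (hf _ (hmem r hr)).continuousAt (by fun_prop))
    rw [intervalIntegral.integral_const_mul] at h4
    simpa [primSnd] using h4
  have := (hg x hx).sub_const (g 0)
  refine this.congr_of_eventuallyEq ?_
  filter_upwards [Metric.isOpen_ball.mem_nhds hx] with y hy using key y hy

/-- A local analytic `2`-cocycle on `ℂ` with values in `ℂˣ`, depending on parameters, is a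
coboundary. -/
theorem exists_local_trivialisation_of_cocycle {c : P × ℂ × ℂ → ℂ} {p₀ : P}
    (hc : AnalyticAt ℂ c (p₀, 0, 0))
    (h1 : ∀ᶠ q : P × ℂ in 𝓝 (p₀, 0), c (q.1, q.2, 0) = 1)
    (hcoc : ∀ᶠ q : P × ℂ × ℂ × ℂ in 𝓝 (p₀, 0, 0, 0),
      c (q.1, q.2.1, q.2.2.1) * c (q.1, q.2.1 + q.2.2.1, q.2.2.2) =
        c (q.1, q.2.2.1, q.2.2.2) * c (q.1, q.2.1, q.2.2.1 + q.2.2.2)) :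
    ∃ h : P × ℂ → ℂ, AnalyticAt ℂ h (p₀, 0) ∧
      ∀ᶠ q : P × ℂ × ℂ in 𝓝 (p₀, 0, 0),
        c q * Complex.exp (h (q.1, q.2.1) + h (q.1, q.2.2) - h (q.1, q.2.1 + q.2.2)) = 1 := by
  -- Since `c (x, 0) = 1`, this is the logarithmic derivative of the cocycle in its last variable at
  -- `0`. Its primitive is the cochain sought.
  set η : P × ℂ → ℂ := fun z => fderiv ℂ c (z.1, z.2, 0) (0, 0, 1) with hη
  have hηa : AnalyticAt ℂ η (p₀, 0) := by
    have h2 : AnalyticAt ℂ (fun z : P × ℂ => (z.1, z.2, (0 : ℂ))) (p₀, 0) :=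
      analyticAt_fst.prod (analyticAt_snd.prod analyticAt_const)
    have h3 : AnalyticAt ℂ (fun z : P × ℂ => fderiv ℂ c (z.1, z.2, 0)) (p₀, 0) :=
      AnalyticAt.fun_comp (g := fderiv ℂ c) (f := fun z : P × ℂ => (z.1, z.2, (0 : ℂ))) hc.fderiv h2
    exact ((ContinuousLinearMap.apply ℂ ℂ ((0, 0, 1) : P × ℂ × ℂ)).analyticAt _).comp h3
  refine ⟨primSnd η, analyticAt_primSnd hηa, ?_⟩
  have e1 : ∀ᶠ q : P × ℂ × ℂ in 𝓝 (p₀, 0, 0), AnalyticAt ℂ c q := hc.eventually_analyticAt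
  have e2 : ∀ᶠ q : P × ℂ in 𝓝 (p₀, 0), AnalyticAt ℂ η q := hηa.eventually_analyticAt
  obtain ⟨ε₁, hε₁, H1⟩ := Metric.eventually_nhds_iff_ball.1 h1
  obtain ⟨ε₂, hε₂, H2⟩ := Metric.eventually_nhds_iff_ball.1 hcoc
  obtain ⟨ε₃, hε₃, H3⟩ := Metric.eventually_nhds_iff_ball.1 e1
  obtain ⟨ε₄, hε₄, H4⟩ := Metric.eventually_nhds_iff_ball.1 e2
  obtain ⟨ε, hε, hε1, hε2, hε3, hε4⟩ : ∃ ε > 0, ε ≤ ε₁ ∧ ε ≤ ε₂ ∧ ε ≤ ε₃ ∧ ε ≤ ε₄ :=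
    ⟨min (min ε₁ ε₂) (min ε₃ ε₄), by positivity,
      (min_le_left _ _).trans (min_le_left _ _), (min_le_left _ _).trans (min_le_right _ _),
      (min_le_right _ _).trans (min_le_left _ _), (min_le_right _ _).trans (min_le_right _ _)⟩
  have B2 : ∀ {p : P} {x : ℂ} {r : ℝ}, (p, x) ∈ Metric.ball (p₀, (0 : ℂ)) r ↔
      dist p p₀ < r ∧ ‖x‖ < r := by
    intro p x r; simp [Prod.dist_eq]
  have B3 : ∀ {p : P} {x y : ℂ} {r : ℝ}, (p, x, y) ∈ Metric.ball (p₀, (0 : ℂ), (0 : ℂ)) r ↔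
      dist p p₀ < r ∧ ‖x‖ < r ∧ ‖y‖ < r := by
    intro p x y r; simp [Prod.dist_eq]
  have B4 : ∀ {p : P} {x y z : ℂ} {r : ℝ},
      (p, x, y, z) ∈ Metric.ball (p₀, (0 : ℂ), (0 : ℂ), (0 : ℂ)) r ↔
      dist p p₀ < r ∧ ‖x‖ < r ∧ ‖y‖ < r ∧ ‖z‖ < r := by
    intro p x y z r; simp [Prod.dist_eq]
  -- Half the radius, so that `x + y` stays in the ball where all hypotheses are available.
  refine Metric.eventually_nhds_iff_ball.2 ⟨ε / 2, by positivity, ?_⟩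
  rintro ⟨p, x, y⟩ hq
  rw [B3] at hq
  obtain ⟨hp, hx, hy⟩ := hq
  have hpε : dist p p₀ < ε := by linarith
  have hderiv : ∀ {x y : ℂ}, ‖x‖ < ε → ‖y‖ < ε →
      HasDerivAt (fun y => c (p, x, y)) (fderiv ℂ c (p, x, y) (0, 0, 1)) y := by
    intro x y hx hy
    have hd := (H3 (p, x, y) (B3.2 ⟨by linarith, by linarith, by linarith⟩)).differentiableAt
    have hl : HasDerivAt (fun y : ℂ => (p, x, y)) (0, 0, 1) y :=
      (hasDerivAt_const y p).prodMk ((hasDerivAt_const y x).prodMk (hasDerivAt_id y))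
    exact hd.hasFDerivAt.comp_hasDerivAt y hl
  have hdh : ∀ {x : ℂ}, ‖x‖ < ε → HasDerivAt (fun x => primSnd η (p, x)) (η (p, x)) x := by
    intro x hx
    refine hasDerivAt_primSnd (δ := ε) (fun x' hx' => ?_) (by simpa using hx)
    have := (H4 (p, x') (B2.2 ⟨by linarith, by simp at hx'; linarith⟩)).differentiableAt
    exact DifferentiableAt.comp (f := fun x : ℂ => (p, x)) x' this (by fun_prop)
  have hone : ∀ {x : ℂ}, ‖x‖ < ε → c (p, x, 0) = 1 := fun {x} hx =>
    H1 (p, x) (B2.2 ⟨by linarith, by linarith⟩)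
  -- Differentiating the cocycle identity in its third variable at `0` expresses the logarithmic
  -- derivative of `y ↦ c (x, y)` as a difference of values of `η`.
  have key : ∀ y ∈ Metric.ball (0 : ℂ) (ε / 2),
      fderiv ℂ c (p, x, y) (0, 0, 1) = c (p, x, y) * (η (p, x + y) - η (p, y)) := by
    intro y hy
    have hy : ‖y‖ < ε / 2 := by simpa using hy
    have hxy : ‖x + y‖ < ε := (norm_add_le _ _).trans_lt (by linarith)
    have hL : HasDerivAt (fun z => c (p, x, y) * c (p, x + y, z)) (c (p, x, y) * η (p, x + y)) 0 :=
      (hderiv hxy (by simpa using hε)).const_mul _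
    have hR : HasDerivAt (fun z => c (p, y, z) * c (p, x, y + z))
        (η (p, y) * c (p, x, y + 0) + c (p, y, 0) * fderiv ℂ c (p, x, y) (0, 0, 1)) 0 := by
      refine (hderiv (by linarith) (by simpa using hε)).mul ?_
      have h0 : HasDerivAt (fun y => c (p, x, y)) (fderiv ℂ c (p, x, y) (0, 0, 1)) (y + 0) := by
        rw [add_zero]; exact hderiv (by linarith) (by linarith)
      exact h0.comp_const_add y 0
    have heq : (fun z => c (p, x, y) * c (p, x + y, z)) =ᶠ[𝓝 0]
        fun z => c (p, y, z) * c (p, x, y + z) := by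
      filter_upwards [Metric.ball_mem_nhds (0 : ℂ) hε] with z hz
      have hz : ‖z‖ < ε := by simpa using hz
      exact H2 (p, x, y, z) (B4.2 ⟨by linarith, by linarith, by linarith, by linarith⟩)
    have := hL.unique (hR.congr_of_eventuallyEq heq)
    rw [add_zero, hone (by linarith)] at this
    linear_combination -this
  -- Hence the product is constant in `y`, and at `y = 0` it equals `1`.
  have hK : ∀ y ∈ Metric.ball (0 : ℂ) (ε / 2), HasDerivAt (fun y => c (p, x, y) *
      Complex.exp (primSnd η (p, x) + primSnd η (p, y) - primSnd η (p, x + y))) 0 y := by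
    intro y hy
    have hy' : ‖y‖ < ε / 2 := by simpa using hy
    have hxy : ‖x + y‖ < ε := (norm_add_le _ _).trans_lt (by linarith)
    have d1 := hderiv (x := x) (y := y) (by linarith) (by linarith)
    have d2 : HasDerivAt (fun y => primSnd η (p, x) + primSnd η (p, y) - primSnd η (p, x + y))
        (η (p, y) - η (p, x + y)) y :=
      ((hdh (by linarith)).const_add _).sub ((hdh hxy).comp_const_add x y)
    have := d1.mul d2.cexp
    refine this.congr_deriv ?_
    rw [key y hy]; ring
  have hconst := Metric.isOpen_ball.is_const_of_deriv_eq_zero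
    (convex_ball (0 : ℂ) (ε / 2)).isPreconnected
    (fun y hy => (hK y hy).differentiableAt.differentiableWithinAt)
    (fun y hy => (hK y hy).deriv) (x := y) (y := 0) (by simpa using hy) (by simpa using hε)
  simp only at hconst ⊢
  rw [hconst, hone (by linarith), primSnd_zero]
  simp

end Analytic
end PoincareTorsor
end

noncomputable section
namespace PoincareTorsor
open Filter Topology

/-! ### Locally biholomorphic maps and local logarithms -/

section LocalDiffeo

variable {E₁ : Type*} [NormedAddCommGroup E₁] [NormedSpace ℂ E₁]
  {H₁ : Type*} [TopologicalSpace H₁] {I : ModelWithCorners ℂ E₁ H₁}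
  {M : Type*} [TopologicalSpace M] [ChartedSpace H₁ M]
  {E₂ : Type*} [NormedAddCommGroup E₂] [NormedSpace ℂ E₂]
  {H₂ : Type*} [TopologicalSpace H₂] {J : ModelWithCorners ℂ E₂ H₂}
  {N : Type*} [TopologicalSpace N] [ChartedSpace H₂ N]

/-- A holomorphic map with a holomorphic germ of an inverse is locally biholomorphic. -/
lemma isLocalDiffeomorphAt_of_inverse [IsManifold I ω M] [IsManifold J ω N]
    {f : M → N} {g : N → M} {x : M} {y : N} (hfx : f x = y)
    (hf : ContMDiffAt I J ω f x) (hg : ContMDiffAt J I ω g y)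
    (hgf : ∀ᶠ a in 𝓝 x, g (f a) = a) (hfg : ∀ᶠ b in 𝓝 y, f (g b) = b) :
    IsLocalDiffeomorphAt I J ω f x := by
  subst hfx
  have hgx : g (f x) = x := hgf.self_of_nhds
  obtain ⟨U, hU, hfU⟩ := (contMDiffAt_iff_contMDiffOn_nhds (by decide)).1 hf
  obtain ⟨V, hV, hgV⟩ := (contMDiffAt_iff_contMDiffOn_nhds (by decide)).1 hg
  obtain ⟨U', hU', hU'o, hxU'⟩ := mem_nhds_iff.1 (inter_mem hU hgf)
  obtain ⟨V', hV', hV'o, hyV'⟩ := mem_nhds_iff.1 (inter_mem hV hfg)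
  have hfU' : ContMDiffOn I J ω f U' := hfU.mono fun a ha => (hU' ha).1
  have hgV' : ContMDiffOn J I ω g V' := hgV.mono fun a ha => (hV' ha).1
  -- Each neighbourhood is cut down by the preimage of the other, so that `f` and `g` map them to
  -- one another.
  refine ⟨⟨⟨f, g, U' ∩ f ⁻¹' V', V' ∩ g ⁻¹' U', ?_, ?_, ?_, ?_⟩, ?_, ?_, ?_, ?_⟩, ?_, ?_⟩
  · rintro a ⟨ha, hb⟩
    refine ⟨hb, ?_⟩
    have : g (f a) = a := (hU' ha).2
    simpa [this] using ha
  · rintro b ⟨hb, ha⟩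
    refine ⟨ha, ?_⟩
    have : f (g b) = b := (hV' hb).2
    simpa [this] using hb
  · rintro a ⟨ha, -⟩
    exact (hU' ha).2
  · rintro b ⟨hb, -⟩
    exact (hV' hb).2
  · exact hfU'.continuousOn.isOpen_inter_preimage hU'o hV'o
  · exact hgV'.continuousOn.isOpen_inter_preimage hV'o hU'o
  · exact hfU'.mono Set.inter_subset_left
  · exact hgV'.mono Set.inter_subset_left
  · exact ⟨hxU', hyV'⟩
  · exact fun a _ => rfl

/-- The germ of the inverse of a locally biholomorphic map. -/
lemma IsLocalDiffeomorphAt.exists_inverse {f : M → N} {x : M}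
    (h : IsLocalDiffeomorphAt I J ω f x) :
    ∃ g : N → M, ContMDiffAt J I ω g (f x) ∧ g (f x) = x ∧
      (∀ᶠ a in 𝓝 x, g (f a) = a) ∧ ∀ᶠ b in 𝓝 (f x), f (g b) = b :=
  ⟨h.localInverse, h.localInverse_contMDiffAt,
    h.localInverse_left_inv h.localInverse_mem_target, h.localInverse_eventuallyEq_left,
    h.localInverse_eventuallyEq_right⟩

/-- Holomorphic functions with values in `ℂˣ`. -/
lemma contMDiffAt_units_of_coe {f : M → ℂˣ} {x : M}
    (h : ContMDiffAt I 𝓘(ℂ, ℂ) ω (fun a => (f a : ℂ)) x) : ContMDiffAt I 𝓘(ℂ, ℂ) ω f x := by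
  rw [contMDiffAt_iff_target]
  exact ⟨(Units.isOpenEmbedding_val (R := ℂ)).isInducing.continuousAt_iff.2 h.continuousAt, h⟩

lemma contMDiffAt_units_coe {f : M → ℂˣ} {x : M}
    (h : ContMDiffAt I 𝓘(ℂ, ℂ) ω f x) : ContMDiffAt I 𝓘(ℂ, ℂ) ω (fun a => (f a : ℂ)) x :=
  ContMDiffAt.comp x (Units.contMDiff_val _) h

/-- Local holomorphic logarithms. -/
lemma exists_local_log {f : M → ℂˣ} {x : M} {w : ℂ} (hw : Complex.exp w = f x)
    (h : ContMDiffAt I 𝓘(ℂ, ℂ) ω f x) :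
    ∃ l : M → ℂ, ContMDiffAt I 𝓘(ℂ, ℂ) ω l x ∧ l x = w ∧ ∀ᶠ a in 𝓝 x, Complex.exp (l a) = f a := by
  -- The quotient `f a / f x` is near `1`, where the principal logarithm is analytic.
  refine ⟨fun a => Complex.log (f a / f x) + w, ?_, ?_, ?_⟩
  · have h1 : ContDiffAt ℂ ω (fun z : ℂ => Complex.log (z / f x) + w) (f x) := by
      refine ContDiffAt.add ?_ contDiffAt_const
      refine ContDiffAt.comp _ (Complex.contDiffAt_log ?_) (contDiffAt_id.div_const _)
      simp
    exact ContMDiffAt.comp (g := fun z : ℂ => Complex.log (z / f x) + w) x h1.contMDiffAt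
      (contMDiffAt_units_coe h)
  · simp
  · refine Eventually.of_forall fun a => ?_
    rw [Complex.exp_add, Complex.exp_log (by simp), hw]
    simp

end LocalDiffeo
end PoincareTorsor
end

noncomputable section
namespace PoincareTorsor
open Filter Topology

/-! ### Holomorphic operations on extensions -/

section ExtensionTheory

set_option linter.unusedSectionVars false

variable {ET : Type*} [NormedAddCommGroup ET] [NormedSpace ℂ ET]
  {T : Type*} [TopologicalSpace T] [ChartedSpace ET T]
  {V : Type*} [NormedAddCommGroup V] [NormedSpace ℂ V]
  {EE : Type*} [NormedAddCommGroup EE] [NormedSpace ℂ EE]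
  {E : Type*} [TopologicalSpace E] [ChartedSpace EE E] {Λ : T → AddSubgroup V}
  {EM : Type*} [NormedAddCommGroup EM] [NormedSpace ℂ EM] [FiniteDimensional ℂ EM]
  {HM : Type*} [TopologicalSpace HM] {I : ModelWithCorners ℂ EM HM} [I.Boundaryless]
  {M : Type*} [TopologicalSpace M] [ChartedSpace HM M] [IsManifold I ω M]

lemma fibSub_val {E T : Type*} (π : E → T) [∀ t, AddCommGroup ↥(π ⁻¹' {t})] {t : T}
    (a b : ↥(π ⁻¹' {t})) : fibSub π a.1 b.1 = (a - b).1 := by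
  obtain ⟨a, rfl⟩ := a
  obtain ⟨b, hb⟩ := b
  exact dif_pos hb

lemma fibAdd_val {E T : Type*} (π : E → T) [∀ t, AddCommGroup ↥(π ⁻¹' {t})] {t : T}
    (a b : ↥(π ⁻¹' {t})) : fibAdd π a.1 b.1 = (a + b).1 := by
  obtain ⟨a, rfl⟩ := a
  obtain ⟨b, hb⟩ := b
  exact dif_pos hb

namespace TorusExtension

variable (Y : TorusExtension ET T EE E Λ)

/-- Fibrewise subtraction of holomorphic maps from a complex manifold is holomorphic. -/
lemma contMDiffAt_sub [IsManifold 𝓘(ℂ, EE) ω E] {t : M → T} {a b : ∀ x, ↥(Y.π ⁻¹' {t x})} {x₀ : M}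
    (ha : ContMDiffAt I 𝓘(ℂ, EE) ω (fun x => (a x).1) x₀)
    (hb : ContMDiffAt I 𝓘(ℂ, EE) ω (fun x => (b x).1) x₀) :
    ContMDiffAt I 𝓘(ℂ, EE) ω (fun x => (a x - b x).1) x₀ := by
  obtain ⟨U, hU, haU⟩ := (contMDiffAt_iff_contMDiffOn_nhds (by decide)).1 ha
  obtain ⟨U', hU', hbU⟩ := (contMDiffAt_iff_contMDiffOn_nhds (by decide)).1 hb
  obtain ⟨W, hW, hWo, hxW⟩ := mem_nhds_iff.1 (inter_mem hU hU')
  let e : EM ≃L[ℂ] (Fin (Module.finrank ℂ EM) → ℂ) :=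
    ContinuousLinearEquiv.ofFinrankEq (by simp)
  -- `holomorphic_sub` speaks only of maps from open subsets of `ℂⁿ`, so the maps are read in a
  -- chart of `M` followed by a linear isomorphism.
  let ψ := extChartAt I x₀
  let r : (Fin (Module.finrank ℂ EM) → ℂ) → M := fun y => ψ.symm (e.symm y)
  let D₀ : Set EM := ψ.target ∩ ψ.symm ⁻¹' W
  have hD : IsOpen D₀ :=
    (continuousOn_extChartAt_symm x₀).isOpen_inter_preimage (isOpen_extChartAt_target x₀) hWo
  let D' : Set (Fin (Module.finrank ℂ EM) → ℂ) := e.symm ⁻¹' D₀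
  have hD' : IsOpen D' := hD.preimage e.symm.continuous
  have hr : ContMDiffOn 𝓘(ℂ, Fin (Module.finrank ℂ EM) → ℂ) I ω r D' := by
    refine ContMDiffOn.comp (t := ψ.target) (contMDiffOn_extChartAt_symm x₀)
      (e.symm.contDiff.contMDiff.contMDiffOn) fun y hy => hy.1
  have hrW : Set.MapsTo r D' W := fun y hy => hy.2
  have key := Y.holomorphic_sub _ D' (fun y => (a (r y)).1) (fun y => (b (r y)).1) hD'
    (ContMDiffOn.comp (g := fun x => (a x).1) (haU.mono fun z hz => (hW hz).1) hr hrW)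
    (ContMDiffOn.comp (g := fun x => (b x).1) (hbU.mono fun z hz => (hW hz).2) hr hrW)
    fun y _ => (b (r y)).2.trans (a (r y)).2.symm
  simp only [fibSub_val] at key
  have hx₀ : e (ψ x₀) ∈ D' := by
    have h1 : ψ.symm (ψ x₀) = x₀ := extChartAt_to_inv x₀
    refine ⟨?_, ?_⟩
    · rw [e.symm_apply_apply]; exact mem_extChartAt_target x₀
    · simpa [h1] using hxW
  have h2 : ContMDiffAt I 𝓘(ℂ, Fin (Module.finrank ℂ EM) → ℂ) ω (fun x => e (ψ x)) x₀ :=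
    ContMDiffAt.comp x₀ e.contDiff.contMDiff.contMDiffAt contMDiffAt_extChartAt
  have h3 := ContMDiffAt.comp (g := fun y => (a (r y) - b (r y)).1) x₀
    (key.contMDiffAt (hD'.mem_nhds hx₀)) h2
  refine h3.congr_of_eventuallyEq ?_
  filter_upwards [extChartAt_source_mem_nhds (I := I) x₀] with x hx
  have : r (e (ψ x)) = x := by simp [r, ψ.left_inv hx]
  simp only [Function.comp_apply]
  rw [this]

/-- Near a point of the total space, the extension is described by a holomorphic section `s`
over the family of tori and holomorphic coordinates `g`. -/
lemma exists_chart [IsManifold 𝓘(ℂ, EE) ω E] (t₀ : T) (v₀ : V) :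
    ∃ s : ∀ p : T × V, ↥(Y.π ⁻¹' {p.1}),
      ContMDiffAt (𝓘(ℂ, ET).prod 𝓘(ℂ, V)) 𝓘(ℂ, EE) ω (fun p => (s p).1) (t₀, v₀) ∧
      (∀ᶠ p in 𝓝 (t₀, v₀), Y.proj p.1 (s p) = QuotientAddGroup.mk p.2) ∧
      ∀ e₀ : ↥(Y.π ⁻¹' {t₀}), Y.proj t₀ e₀ = QuotientAddGroup.mk v₀ →
        ∃ g : E → (T × V) × ℂˣ,
          ContMDiffAt 𝓘(ℂ, EE) ((𝓘(ℂ, ET).prod 𝓘(ℂ, V)).prod 𝓘(ℂ, ℂ)) ω g e₀.1 ∧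
          (g e₀.1).1 = (t₀, v₀) ∧
          ∀ᶠ e in 𝓝 e₀.1, e = (Y.inc (g e).1.1 (Additive.ofMul (g e).2) + s (g e).1).1 ∧
            Y.proj (g e).1.1 (s (g e).1) = QuotientAddGroup.mk (g e).1.2 := by
  obtain ⟨N, s, hN, hmem, hs, hΦ⟩ := Y.locallyTrivial t₀ v₀
  set Φ := fun q : (T × V) × ℂˣ =>
    (Y.inc q.1.1 (Additive.ofMul q.2) + s q.1 : ↥(Y.π ⁻¹' {q.1.1})).1 with hΦdef
  have hΦ1 : ∀ z, IsLocalDiffeomorphAt ((𝓘(ℂ, ET).prod 𝓘(ℂ, V)).prod 𝓘(ℂ, ℂ)) 𝓘(ℂ, EE) ω Φ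
      ((t₀, v₀), z) := fun z => hΦ ⟨((t₀, v₀), z), hmem, trivial⟩
  refine ⟨s, ?_, ?_, fun e₀ h₀ => ?_⟩
  · have h1 : ContMDiffAt (𝓘(ℂ, ET).prod 𝓘(ℂ, V)) ((𝓘(ℂ, ET).prod 𝓘(ℂ, V)).prod 𝓘(ℂ, ℂ)) ω
        (fun p : T × V => (p, (1 : ℂˣ))) (t₀, v₀) := contMDiffAt_id.prodMk contMDiffAt_const
    refine (ContMDiffAt.comp (t₀, v₀) (hΦ1 1).contMDiffAt h1).congr_of_eventuallyEq ?_
    refine Eventually.of_forall fun p => ?_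
    simp [hΦdef]
  · filter_upwards [hN.mem_nhds hmem] with p hp using hs p hp
  -- The two points lie over the same point of the torus, so they differ by an element of `ℂˣ`.
  obtain ⟨z, hz⟩ : e₀ - s (t₀, v₀) ∈ Set.range (Y.inc t₀) := by
    rw [← (Y.exact t₀) (e₀ - s (t₀, v₀)), map_sub, h₀, hs _ hmem, sub_self]
  have hΦe : Φ ((t₀, v₀), z.toMul) = e₀.1 := by
    have : Y.inc t₀ z + s (t₀, v₀) = e₀ := by rw [hz]; abel
    exact congrArg Subtype.val this
  have hloc := hΦ1 z.toMul
  obtain ⟨g, hg, hg0, -, hΦg⟩ := IsLocalDiffeomorphAt.exists_inverse hloc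
  rw [hΦe] at hg hg0 hΦg
  have hgN : ∀ᶠ e in 𝓝 e₀.1, (g e).1 ∈ N := by
    have : Tendsto (fun e => (g e).1) (𝓝 e₀.1) (𝓝 (t₀, v₀)) := by
      have := (continuous_fst.continuousAt.comp hg.continuousAt).tendsto
      simpa only [Function.comp_def, hg0] using this
    exact this (hN.mem_nhds hmem)
  refine ⟨g, hg, by rw [hg0], ?_⟩
  filter_upwards [hΦg, hgN] with e he heN
  exact ⟨he.symm, hs _ heN⟩

/-- In the coordinates of `exists_chart` the projection is a component of `g`. -/
lemma contMDiff_π [IsManifold 𝓘(ℂ, EE) ω E] : ContMDiff 𝓘(ℂ, EE) 𝓘(ℂ, ET) ω Y.π := by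
  intro e
  obtain ⟨v, hv⟩ := QuotientAddGroup.mk_surjective (Y.proj (Y.π e) ⟨e, rfl⟩)
  obtain ⟨s, -, -, h⟩ := Y.exists_chart (Y.π e) v
  obtain ⟨g, hg, -, h⟩ := h ⟨e, rfl⟩ hv.symm
  refine (contMDiffAt_fst.comp e (contMDiffAt_fst.comp e hg)).congr_of_eventuallyEq ?_
  filter_upwards [h] with e' he'
  conv_lhs => rw [he'.1]
  exact (Y.inc (g e').1.1 (Additive.ofMul (g e').2) + s (g e').1).2

lemma contMDiffAt_base [IsManifold 𝓘(ℂ, EE) ω E] {t : M → T} {a : ∀ x, ↥(Y.π ⁻¹' {t x})} {x₀ : M}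
    (ha : ContMDiffAt I 𝓘(ℂ, EE) ω (fun x => (a x).1) x₀) : ContMDiffAt I 𝓘(ℂ, ET) ω t x₀ := by
  refine (ContMDiffAt.comp x₀ Y.contMDiff_π.contMDiffAt ha).congr_of_eventuallyEq ?_
  exact Eventually.of_forall fun x => (a x).2.symm

/-- Subtraction is the only operation assumed to be holomorphic. The zero section is a local section
minus itself; negation and addition follow. -/
lemma contMDiffAt_zero [IsManifold 𝓘(ℂ, EE) ω E] {t : M → T} {x₀ : M}
    (ht : ContMDiffAt I 𝓘(ℂ, ET) ω t x₀) :
    ContMDiffAt I 𝓘(ℂ, EE) ω (fun x => (0 : ↥(Y.π ⁻¹' {t x})).1) x₀ := by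
  obtain ⟨s, hs, -, -⟩ := Y.exists_chart (t x₀) 0
  have h1 : ContMDiffAt I 𝓘(ℂ, EE) ω (fun x => (s (t x, 0)).1) x₀ :=
    ContMDiffAt.comp (g := fun p => (s p).1) (f := fun x => (t x, (0 : V))) x₀ hs
      (ht.prodMk contMDiffAt_const)
  have := Y.contMDiffAt_sub (a := fun x => s (t x, 0)) (b := fun x => s (t x, 0)) h1 h1
  simpa only [sub_self] using this

variable {Y}

lemma contMDiffAt_neg [IsManifold 𝓘(ℂ, EE) ω E] {t : M → T} {a : ∀ x, ↥(Y.π ⁻¹' {t x})} {x₀ : M}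
    (ha : ContMDiffAt I 𝓘(ℂ, EE) ω (fun x => (a x).1) x₀) :
    ContMDiffAt I 𝓘(ℂ, EE) ω (fun x => (-a x).1) x₀ := by
  have := Y.contMDiffAt_sub (a := fun x => 0) (b := a)
    (Y.contMDiffAt_zero (Y.contMDiffAt_base ha)) ha
  simpa only [zero_sub] using this

lemma contMDiffAt_add [IsManifold 𝓘(ℂ, EE) ω E] {t : M → T} {a b : ∀ x, ↥(Y.π ⁻¹' {t x})} {x₀ : M}
    (ha : ContMDiffAt I 𝓘(ℂ, EE) ω (fun x => (a x).1) x₀)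
    (hb : ContMDiffAt I 𝓘(ℂ, EE) ω (fun x => (b x).1) x₀) :
    ContMDiffAt I 𝓘(ℂ, EE) ω (fun x => (a x + b x).1) x₀ := by
  have := Y.contMDiffAt_sub (a := a) (b := fun x => -b x) ha (contMDiffAt_neg hb)
  simpa only [sub_neg_eq_add] using this

lemma contMDiffAt_sum [IsManifold 𝓘(ℂ, EE) ω E] {ι : Type*} (S : Finset ι) {t : M → T}
    {a : ι → ∀ x, ↥(Y.π ⁻¹' {t x})} {x₀ : M} (ht : ContMDiffAt I 𝓘(ℂ, ET) ω t x₀)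
    (ha : ∀ i ∈ S, ContMDiffAt I 𝓘(ℂ, EE) ω (fun x => (a i x).1) x₀) :
    ContMDiffAt I 𝓘(ℂ, EE) ω (fun x => (∑ i ∈ S, a i x).1) x₀ := by
  classical
  induction S using Finset.induction_on with
  | empty => simpa only [Finset.sum_empty] using Y.contMDiffAt_zero ht
  | insert i S hi ih =>
    simp only [Finset.sum_insert hi]
    exact contMDiffAt_add (ha i (by simp)) (ih fun j hj => ha j (by simp [hj]))

lemma contMDiffAt_nsmul [IsManifold 𝓘(ℂ, EE) ω E] (n : ℕ) {t : M → T} {a : ∀ x, ↥(Y.π ⁻¹' {t x})}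
    {x₀ : M} (ha : ContMDiffAt I 𝓘(ℂ, EE) ω (fun x => (a x).1) x₀) :
    ContMDiffAt I 𝓘(ℂ, EE) ω (fun x => (n • a x).1) x₀ := by
  have := contMDiffAt_sum (Y := Y) (Finset.range n) (a := fun _ => a) (Y.contMDiffAt_base ha)
    fun _ _ => ha
  simpa only [Finset.sum_const, Finset.card_range] using this

/-- If a map to `ℂˣ` is holomorphic as a section of the extension, then it is holomorphic. -/
lemma contMDiffAt_of_inc [IsManifold 𝓘(ℂ, EE) ω E]
    (hΛ : ∀ t₀, ∀ᶠ p in 𝓝 (t₀, (0 : V)), p.2 ∈ Λ p.1 → p.2 = 0) {t : M → T} {a : M → ℂˣ} {x₀ : M}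
    (ha : ContMDiffAt I 𝓘(ℂ, EE) ω (fun x => (Y.inc (t x) (Additive.ofMul (a x))).1) x₀) :
    ContMDiffAt I 𝓘(ℂ, ℂ) ω a x₀ := by
  obtain ⟨s, -, -, h⟩ := Y.exists_chart (t x₀) 0
  -- The chart coordinates of `inc (a x)` have their component `v` in the lattice and near `0`, so
  -- `v = 0` by `hΛ`. This determines `a` up to the term `s (t x, 0)`, which lies over `0` but need
  -- not vanish.
  have key : ∀ a : M → ℂˣ,
      ContMDiffAt I 𝓘(ℂ, EE) ω (fun x => (Y.inc (t x) (Additive.ofMul (a x))).1) x₀ →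
      ∃ z : M → ℂˣ, ContMDiffAt I 𝓘(ℂ, ℂ) ω z x₀ ∧ ∀ᶠ x in 𝓝 x₀,
        Y.inc (t x) (Additive.ofMul (a x)) = Y.inc (t x) (Additive.ofMul (z x)) + s (t x, 0) := by
    intro a ha
    obtain ⟨g, hg, hg0, he⟩ := h (Y.inc (t x₀) (Additive.ofMul (a x₀)))
      (by rw [(Y.exact (t x₀)).apply_apply_eq_zero]; rfl)
    have hga := ContMDiffAt.comp (f := fun x => (Y.inc (t x) (Additive.ofMul (a x))).1) x₀ hg ha
    refine ⟨_, contMDiffAt_snd.comp x₀ hga, ?_⟩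
    have h1 := ha.continuousAt.eventually he
    have h2 : Tendsto (fun x => (g (Y.inc (t x) (Additive.ofMul (a x))).1).1) (𝓝 x₀)
        (𝓝 (t x₀, 0)) := by
      have := (continuous_fst.continuousAt.comp hga.continuousAt).tendsto
      simpa only [Function.comp_def, hg0] using this
    filter_upwards [h1, h2.eventually (hΛ (t x₀))] with x hx hx0
    simp only [Function.comp_apply]
    revert hx hx0
    generalize g (Y.inc (t x) (Additive.ofMul (a x))).1 = q
    obtain ⟨⟨t', v⟩, z⟩ := q
    rintro ⟨hx, hx'⟩ hx0
    obtain rfl : t' = t x := by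
      have h3 := (Y.inc (t x) (Additive.ofMul (a x))).2
      rw [hx] at h3
      exact (Y.inc t' (Additive.ofMul z) + s (t', v)).2.symm.trans h3
    have hx2 := Subtype.ext hx
    have h4 := congrArg (Y.proj (t x)) hx2
    simp only [map_add, (Y.exact (t x)).apply_apply_eq_zero, zero_add, hx'] at h4
    obtain rfl := hx0 ((QuotientAddGroup.eq_zero_iff v).1 h4.symm)
    exact hx2
  obtain ⟨z, hz, hza⟩ := key a ha
  -- The constant function `1` expresses that term holomorphically as well, and `a` is the quotient
  -- of `z` and `z'`.
  obtain ⟨z', hz', hza'⟩ := key 1 (by simpa using Y.contMDiffAt_zero (Y.contMDiffAt_base ha))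
  refine (hz.mul hz'.inv).congr_of_eventuallyEq ?_
  filter_upwards [hza, hza'] with x hx hx'
  apply Additive.ofMul.injective
  apply Y.inc_injective (t x)
  rw [hx]
  simp only [Pi.one_apply, ofMul_one, map_zero] at hx'
  simp only [Pi.mul_apply, ofMul_mul, ofMul_inv, map_add, map_neg]
  rw [add_right_inj]
  exact (neg_eq_of_add_eq_zero_right hx'.symm).symm

/-- The trivialisation gives the holomorphy of `inc a + s`; the section `s` is removed by
subtracting the case `a = 1`. -/
lemma contMDiffAt_inc [IsManifold 𝓘(ℂ, EE) ω E] {t : M → T} {a : M → ℂˣ} {x₀ : M}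
    (ht : ContMDiffAt I 𝓘(ℂ, ET) ω t x₀) (ha : ContMDiffAt I 𝓘(ℂ, ℂ) ω a x₀) :
    ContMDiffAt I 𝓘(ℂ, EE) ω (fun x => (Y.inc (t x) (Additive.ofMul (a x))).1) x₀ := by
  obtain ⟨N, s, hN, hmem, hs, hΦ⟩ := Y.locallyTrivial (t x₀) 0
  have h1 : ∀ a : M → ℂˣ, ContMDiffAt I 𝓘(ℂ, ℂ) ω a x₀ → ContMDiffAt I 𝓘(ℂ, EE) ω
      (fun x => (Y.inc (t x) (Additive.ofMul (a x)) + s (t x, 0)).1) x₀ := fun a ha =>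
    ContMDiffAt.comp (f := fun x => ((t x, (0 : V)), a x)) x₀
      (hΦ ⟨((t x₀, 0), a x₀), hmem, trivial⟩).contMDiffAt
      ((ht.prodMk contMDiffAt_const).prodMk ha)
  have h2 := Y.contMDiffAt_sub (a := fun x => Y.inc (t x) (Additive.ofMul (a x)) + s (t x, 0))
    (b := fun x => Y.inc (t x) (Additive.ofMul 1) + s (t x, 0)) (h1 a ha) (h1 1 contMDiffAt_const)
  simpa using h2

end TorusExtension

end ExtensionTheory
end PoincareTorsor
end

noncomputable section
namespace PoincareTorsor
open Filter Topology

/-! ### Exponentials, and homomorphisms from local homomorphisms -/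

/-- The exponential `ℂ → ℂˣ`. -/
def expU (c : ℂ) : ℂˣ := Units.mk0 (Complex.exp c) (Complex.exp_ne_zero c)

lemma coe_expU (c : ℂ) : (expU c : ℂ) = Complex.exp c := rfl

lemma expU_add (a b : ℂ) : expU (a + b) = expU a * expU b := Units.ext (Complex.exp_add a b)

lemma expU_zero : expU 0 = 1 := Units.ext Complex.exp_zero

lemma expU_neg (a : ℂ) : expU (-a) = (expU a)⁻¹ := by
  rw [eq_inv_iff_mul_eq_one, ← expU_add, neg_add_cancel, expU_zero]

lemma expU_surjective : Function.Surjective expU := fun z =>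
  ⟨Complex.log z, Units.ext (Complex.exp_log z.ne_zero)⟩

lemma expU_eq_one_iff {a : ℂ} : expU a = 1 ↔ ∃ n : ℤ, a = n * (2 * Real.pi * Complex.I) := by
  rw [← Complex.exp_eq_one_iff, ← Units.val_eq_one, coe_expU]

/-- The functional equation gives `F' = F'(0) F`, so `F x * exp (-(x F'(0)))` has derivative zero.
-/
lemma eq_exp_of_hom {F : ℂ → ℂ} (hF : Differentiable ℂ F) (h0 : F 0 = 1)
    (hadd : ∀ x y, F (x + y) = F x * F y) (x : ℂ) : F x = Complex.exp (x * deriv F 0) := by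
  have hd : ∀ x, HasDerivAt F (F x * deriv F 0) x := by
    intro x
    have h1 : HasDerivAt (fun y => F (x + y)) (deriv F x) 0 := by
      have := (hF (x + 0)).hasDerivAt
      simpa using this.comp_const_add x 0
    have h2 : HasDerivAt (fun y => F x * F y) (F x * deriv F 0) 0 :=
      (hF 0).hasDerivAt.const_mul _
    simp only [hadd] at h1
    rw [← h1.unique h2]
    exact (hF x).hasDerivAt
  have hG : ∀ x, HasDerivAt (fun x => F x * Complex.exp (-(x * deriv F 0))) 0 x := by
    intro x
    have h3 : HasDerivAt (fun x => -(x * deriv F 0)) (-deriv F 0) x := by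
      have := ((hasDerivAt_id x).mul_const (deriv F 0)).neg
      rwa [one_mul] at this
    exact ((hd x).mul h3.cexp).congr_deriv (by ring)
  have := is_const_of_deriv_eq_zero (fun x => (hG x).differentiableAt)
    (fun x => (hG x).deriv) x 0
  simp only [h0, zero_mul, neg_zero, Complex.exp_zero, one_mul, Complex.exp_neg] at this
  exact (mul_inv_eq_one₀ (Complex.exp_ne_zero _)).1 this

/-- Put `φ v = n • f (v / n)` with `n` so large that `v / n` lies in the ball. Two choices `n` and
`m` are compared through `n * m`. -/
lemma exists_hom_of_local_hom {V G : Type*} [NormedAddCommGroup V] [NormedSpace ℂ V]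
    [AddCommGroup G] {f : V → G} {ε : ℝ} (hε : 0 < ε)
    (h : ∀ v w, ‖v‖ < ε → ‖w‖ < ε → ‖v + w‖ < ε → f (v + w) = f v + f w) :
    ∃ φ : V →+ G, ∀ (v : V) (n : ℕ), ‖v‖ < n * ε → φ v = n • f ((n : ℂ)⁻¹ • v) := by
  have h0 : f 0 = 0 := by
    have := h 0 0 (by simpa) (by simpa) (by simpa)
    simpa using this
  have hmul : ∀ (v : V) (k : ℕ), ‖(k : ℂ) • v‖ < ε → f ((k : ℂ) • v) = k • f v := by
    intro v k
    induction k with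
    | zero => intro _; simp [h0]
    | succ k ih =>
      intro hk
      have hk' : ((k + 1 : ℕ) : ℝ) * ‖v‖ < ε := by
        rwa [norm_smul, Complex.norm_natCast] at hk
      have h1 : ‖(k : ℂ) • v‖ < ε := by
        refine lt_of_le_of_lt ?_ hk'
        rw [norm_smul, Complex.norm_natCast]
        push_cast; nlinarith [norm_nonneg v]
      have h2 : ‖v‖ < ε := by
        refine lt_of_le_of_lt ?_ hk'
        push_cast; nlinarith [norm_nonneg v, (Nat.cast_nonneg k : (0 : ℝ) ≤ k)]
      have h3 : ((k + 1 : ℕ) : ℂ) • v = (k : ℂ) • v + v := by push_cast; rw [add_smul, one_smul]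
      rw [h3] at hk ⊢
      rw [h _ _ h1 h2 hk, ih h1, succ_nsmul]
  have hpos : ∀ {v : V} {n : ℕ}, ‖v‖ < n * ε → (n : ℂ) ≠ 0 := by
    rintro v n hn hn0
    have : n = 0 := by exact_mod_cast hn0
    subst this
    have := norm_nonneg v
    simp at hn
    linarith
  have hnorm : ∀ {v : V} {n : ℕ}, ‖v‖ < n * ε → ‖(n : ℂ)⁻¹ • v‖ < ε := by
    intro v n hn
    have := hpos hn
    rw [norm_smul, norm_inv, Complex.norm_natCast, inv_mul_lt_iff₀]
    · exact hn
    · have : n ≠ 0 := by exact_mod_cast this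
      positivity
  have hmulti : ∀ {v : V} {n m : ℕ}, ‖v‖ < n * ε → m ≠ 0 →
      n • f ((n : ℂ)⁻¹ • v) = (n * m) • f (((n * m : ℕ) : ℂ)⁻¹ • v) := by
    intro v n m hn hm
    have hm' : (m : ℂ) ≠ 0 := by exact_mod_cast hm
    have e : (n : ℂ)⁻¹ • v = (m : ℂ) • ((n * m : ℕ) : ℂ)⁻¹ • v := by
      rw [smul_smul]; congr 1
      have := hpos hn
      push_cast; field_simp
    have hn' := hnorm hn
    rw [e] at hn' ⊢
    rw [hmul _ _ hn', mul_smul]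
  have hindep : ∀ {v : V} {n m : ℕ}, ‖v‖ < n * ε → ‖v‖ < m * ε →
      n • f ((n : ℂ)⁻¹ • v) = m • f ((m : ℂ)⁻¹ • v) := by
    intro v n m hn hm
    rw [hmulti hn (m := m) (by exact_mod_cast hpos hm),
      hmulti hm (m := n) (by exact_mod_cast hpos hn), mul_comm]
  have hex : ∀ r : ℝ, ∃ n : ℕ, r < n * ε := fun r => by
    obtain ⟨n, hn⟩ := exists_nat_gt (r / ε)
    exact ⟨n, (div_lt_iff₀ hε).1 hn⟩
  choose N hN using hex
  refine ⟨AddMonoidHom.mk' (fun v => N ‖v‖ • f ((N ‖v‖ : ℂ)⁻¹ • v)) fun v w => ?_,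
    fun v n hn => hindep (hN _) hn⟩
  obtain ⟨n, hn⟩ : ∃ n : ℕ, ‖v‖ + ‖w‖ < n * ε := ⟨_, hN _⟩
  have hv : ‖v‖ < n * ε := by linarith [norm_nonneg w]
  have hw : ‖w‖ < n * ε := by linarith [norm_nonneg v]
  have hvw : ‖v + w‖ < n * ε := (norm_add_le _ _).trans_lt hn
  rw [hindep (hN ‖v + w‖) hvw, hindep (hN ‖v‖) hv, hindep (hN ‖w‖) hw, smul_add, ← smul_add n]
  rw [h _ _ (hnorm hv) (hnorm hw) (by rw [← smul_add]; exact hnorm hvw)]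

/-! ### Holomorphic splittings of extensions -/

section Splittings

variable {ET : Type*} [NormedAddCommGroup ET] [NormedSpace ℂ ET]
  {T : Type*} [TopologicalSpace T] [ChartedSpace ET T]
  {V : Type*} [NormedAddCommGroup V] [NormedSpace ℂ V]
  {EE : Type*} [NormedAddCommGroup EE] [NormedSpace ℂ EE]
  {E : Type*} [TopologicalSpace E] [ChartedSpace EE E] {Λ : T → AddSubgroup V}

namespace TorusExtension

/-- A holomorphic splitting of the pullback to `V` of a fibre of an extension of `V / Λ_t`. -/
structure IsSplitting (Y : TorusExtension ET T EE E Λ) {t : T} (φ : V →+ ↥(Y.π ⁻¹' {t})) :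
    Prop where
  proj : ∀ v, Y.proj t (φ v) = QuotientAddGroup.mk v
  holomorphic : ∀ v, ContMDiff 𝓘(ℂ, ℂ) 𝓘(ℂ, EE) ω fun x : ℂ => (φ (x • v)).1

variable {Y : TorusExtension ET T EE E Λ}

lemma exists_inc_eq {t : T} {e : ↥(Y.π ⁻¹' {t})} (h : Y.proj t e = 0) :
    ∃ z : ℂˣ, Y.inc t (Additive.ofMul z) = e :=
  (Y.exact t e).1 h

lemma proj_inc (t : T) (z : Additive ℂˣ) : Y.proj t (Y.inc t z) = 0 :=
  (Y.exact t).apply_apply_eq_zero z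

/-- Two holomorphic splittings differ by the exponential of a linear form. -/
lemma IsSplitting.exists_linear [IsManifold 𝓘(ℂ, EE) ω E]
    (hΛ : ∀ t₀, ∀ᶠ p in 𝓝 (t₀, (0 : V)), p.2 ∈ Λ p.1 → p.2 = 0) {t : T}
    {φ φ' : V →+ ↥(Y.π ⁻¹' {t})} (h : Y.IsSplitting φ) (h' : Y.IsSplitting φ') :
    ∃ L : V →ₗ[ℂ] ℂ, ∀ v, φ' v = φ v + Y.inc t (Additive.ofMul (expU (L v))) := by
  have h1 : ∀ v, ∃ z : ℂˣ, Y.inc t (Additive.ofMul z) = φ' v - φ v := fun v =>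
    exists_inc_eq (by rw [map_sub, h.proj, h'.proj, sub_self])
  choose δ hδ using h1
  have hadd : ∀ v w, δ (v + w) = δ v * δ w := by
    intro v w
    apply Additive.ofMul.injective
    apply Y.inc_injective t
    rw [ofMul_mul, map_add, hδ, hδ, hδ, map_add, map_add]; abel
  have hzero : δ 0 = 1 := by
    simp [← mul_eq_left (a := δ 0), ← hadd]
  have hdiff : ∀ v, Differentiable ℂ fun x : ℂ => (δ (x • v) : ℂ) := by
    intro v x
    have h2 : ContMDiffAt 𝓘(ℂ, ℂ) 𝓘(ℂ, EE) ω
        (fun x : ℂ => (Y.inc t (Additive.ofMul (δ (x • v)))).1) x := by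
      simp only [hδ]
      exact Y.contMDiffAt_sub (a := fun x : ℂ => φ' (x • v)) (b := fun x : ℂ => φ (x • v))
        (h'.holomorphic v).contMDiffAt (h.holomorphic v).contMDiffAt
    have h3 := contMDiffAt_units_coe (contMDiffAt_of_inc (t := fun _ : ℂ => t) hΛ h2)
    exact (contMDiffAt_iff_contDiffAt.1 h3).differentiableAt (by decide)
  -- On each complex line the difference of the splittings is a holomorphic character, hence an
  -- exponential.
  have hexp : ∀ v x, (δ (x • v) : ℂ) = Complex.exp (x * deriv (fun x : ℂ => (δ (x • v) : ℂ)) 0) :=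
    fun v x => eq_exp_of_hom (hdiff v) (by simp [hzero])
      (fun x y => by rw [add_smul, hadd]; rfl) x
  -- The exponent on a line is recovered as a derivative at `0`; its uniqueness is what gives
  -- linearity in `v`.
  have hL0 : ∀ v c, (∀ x : ℂ, (δ (x • v) : ℂ) = Complex.exp (x * c)) →
      deriv (fun x : ℂ => (δ (x • v) : ℂ)) 0 = c := by
    intro v c hc
    simp only [hc]
    have : HasDerivAt (fun x : ℂ => Complex.exp (x * c)) (Complex.exp (0 * c) * (1 * c)) 0 :=
      ((hasDerivAt_id (0 : ℂ)).mul_const c).cexp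
    rw [this.deriv]; simp
  refine ⟨⟨⟨fun v => deriv (fun x : ℂ => (δ (x • v) : ℂ)) 0, fun v w => ?_⟩, fun a v => ?_⟩,
    fun v => ?_⟩
  · refine hL0 _ _ fun x => ?_
    rw [smul_add, hadd, Units.val_mul, hexp v, hexp w, ← Complex.exp_add, mul_add]
  · refine hL0 _ _ fun x => ?_
    rw [smul_smul, hexp v, RingHom.id_apply, smul_eq_mul, mul_assoc]
  · have : expU (deriv (fun x : ℂ => (δ (x • v) : ℂ)) 0) = δ v := by
      apply Units.ext
      have := hexp v 1
      rw [one_smul, one_mul] at this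
      rw [coe_expU, this]
    change _ = _ + Y.inc t (Additive.ofMul (expU (deriv (fun x : ℂ => (δ (x • v) : ℂ)) 0)))
    rw [this, hδ]; abel

/-- A holomorphic family of splittings restricts to splittings of the fibres. -/
lemma isSplitting_of_contMDiffAt {φ : ∀ t, V →+ ↥(Y.π ⁻¹' {t})} {t : T}
    (hp : ∀ v, Y.proj t (φ t v) = QuotientAddGroup.mk v)
    (hφ : ∀ v, ContMDiffAt (𝓘(ℂ, ET).prod 𝓘(ℂ, V)) 𝓘(ℂ, EE) ω (fun p : T × V => (φ p.1 p.2).1)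
        (t, v)) : Y.IsSplitting (φ t) := by
  refine ⟨hp, fun v x => ?_⟩
  refine ContMDiffAt.comp (g := fun p : T × V => (φ p.1 p.2).1) (f := fun x : ℂ => (t, x • v)) x
    (hφ _) (contMDiffAt_const.prodMk ?_)
  exact contMDiffAt_id.smul contMDiffAt_const

variable [FiniteDimensional ℂ ET] [IsManifold 𝓘(ℂ, ET) ω T] [IsManifold 𝓘(ℂ, EE) ω E]

/-- Local one-parameter subgroups of an extension. -/
lemma exists_local_one_parameter [FiniteDimensional ℂ V]
    (hΛ : ∀ t₀, ∀ᶠ p in 𝓝 (t₀, (0 : V)), p.2 ∈ Λ p.1 → p.2 = 0) (t₀ : T) (e : V) :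
    ∃ ψ : ∀ t, ℂ → ↥(Y.π ⁻¹' {t}),
      ContMDiffAt (𝓘(ℂ, ET).prod 𝓘(ℂ, ℂ)) 𝓘(ℂ, EE) ω (fun p : T × ℂ => (ψ p.1 p.2).1) (t₀, 0) ∧
      (∀ᶠ p : T × ℂ in 𝓝 (t₀, 0), Y.proj p.1 (ψ p.1 p.2) = QuotientAddGroup.mk (p.2 • e)) ∧
      ∀ᶠ p : T × ℂ × ℂ in 𝓝 (t₀, 0, 0), ψ p.1 (p.2.1 + p.2.2) = ψ p.1 p.2.1 + ψ p.1 p.2.2 := by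
  obtain ⟨s, hs, hsp, -⟩ := Y.exists_chart t₀ 0
  -- Normalised to vanish at `x = 0`, so that the cocycle below is `1` when its second argument is
  -- `0`.
  let σ : ∀ t, ℂ → ↥(Y.π ⁻¹' {t}) := fun t x => s (t, x • e) - s (t, 0)
  have hσ0 : ∀ t, σ t 0 = 0 := fun t => by
    have : ∀ v : V, v = 0 → s (t, v) - s (t, 0) = 0 := by rintro _ rfl; exact sub_self _
    exact this _ (zero_smul ℂ e)
  have hσ : ContMDiffAt (𝓘(ℂ, ET).prod 𝓘(ℂ, ℂ)) 𝓘(ℂ, EE) ω (fun p : T × ℂ => (σ p.1 p.2).1)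
      (t₀, 0) := by
    refine Y.contMDiffAt_sub (a := fun p : T × ℂ => s (p.1, p.2 • e))
      (b := fun p : T × ℂ => s (p.1, 0)) ?_ ?_
    · refine ContMDiffAt.comp (g := fun p => (s p).1) (f := fun p : T × ℂ => (p.1, p.2 • e))
        (t₀, 0) (by simpa using hs) (contMDiffAt_fst.prodMk ?_)
      exact contMDiffAt_snd.smul contMDiffAt_const
    · exact ContMDiffAt.comp (g := fun p => (s p).1) (f := fun p : T × ℂ => (p.1, (0 : V)))
        (t₀, 0) hs (contMDiffAt_fst.prodMk contMDiffAt_const)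
  have hσp : ∀ᶠ p : T × ℂ in 𝓝 (t₀, 0), Y.proj p.1 (σ p.1 p.2) = QuotientAddGroup.mk (p.2 • e) := by
    have h1 : Tendsto (fun p : T × ℂ => (p.1, p.2 • e)) (𝓝 (t₀, 0)) (𝓝 (t₀, 0)) := by
      have : Continuous fun p : T × ℂ => (p.1, p.2 • e) := by fun_prop
      simpa using this.tendsto (t₀, 0)
    have h2 : Tendsto (fun p : T × ℂ => (p.1, (0 : V))) (𝓝 (t₀, 0)) (𝓝 (t₀, 0)) := by
      have : Continuous fun p : T × ℂ => (p.1, (0 : V)) := by fun_prop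
      simpa using this.tendsto (t₀, 0)
    filter_upwards [h1.eventually hsp, h2.eventually hsp] with p h3 h4
    simp only [σ, map_sub, h3, h4]
    simp
  -- The defect of additivity of `σ` comes from `ℂˣ` where it projects to `0`, in particular near
  -- the origin. Elsewhere the value is irrelevant and is set to `1`.
  have hc : ∀ p : T × ℂ × ℂ, ∃ c : ℂˣ,
      Y.proj p.1 (σ p.1 p.2.1 + σ p.1 p.2.2 - σ p.1 (p.2.1 + p.2.2)) = 0 →
      Y.inc p.1 (Additive.ofMul c) = σ p.1 p.2.1 + σ p.1 p.2.2 - σ p.1 (p.2.1 + p.2.2) := by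
    intro p
    by_cases h : Y.proj p.1 (σ p.1 p.2.1 + σ p.1 p.2.2 - σ p.1 (p.2.1 + p.2.2)) = 0
    · obtain ⟨c, hc⟩ := exists_inc_eq h
      exact ⟨c, fun _ => hc⟩
    · exact ⟨1, fun h' => absurd h' h⟩
  choose c hc using hc
  have hcσ : ∀ᶠ p : T × ℂ × ℂ in 𝓝 (t₀, 0, 0),
      Y.inc p.1 (Additive.ofMul (c p)) = σ p.1 p.2.1 + σ p.1 p.2.2 - σ p.1 (p.2.1 + p.2.2) := by
    have ht : ∀ g : ℂ × ℂ → ℂ, Continuous g → g 0 = 0 →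
        Tendsto (fun p : T × ℂ × ℂ => (p.1, g p.2)) (𝓝 (t₀, 0, 0)) (𝓝 (t₀, 0)) := by
      intro g hg hg0
      have : Continuous fun p : T × ℂ × ℂ => (p.1, g p.2) := by fun_prop
      have h0 := this.tendsto (t₀, 0, 0)
      rwa [show g (t₀, (0 : ℂ), (0 : ℂ)).2 = 0 from hg0] at h0
    filter_upwards [(ht Prod.fst continuous_fst rfl).eventually hσp,
      (ht Prod.snd continuous_snd rfl).eventually hσp,
      (ht (fun q => q.1 + q.2) (by fun_prop) (by simp)).eventually hσp] with p h1 h2 h3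
    apply hc
    rw [map_sub, map_add, h1, h2, h3, add_smul]
    simp
  have hca : ContMDiffAt (𝓘(ℂ, ET).prod (𝓘(ℂ, ℂ).prod 𝓘(ℂ, ℂ))) 𝓘(ℂ, ℂ) ω c (t₀, 0, 0) := by
    refine contMDiffAt_of_inc (Y := Y) (t := fun p : T × ℂ × ℂ => p.1) hΛ ?_
    have hcomp : ∀ g : T × ℂ × ℂ → ℂ,
        ContMDiffAt (𝓘(ℂ, ET).prod (𝓘(ℂ, ℂ).prod 𝓘(ℂ, ℂ))) 𝓘(ℂ, ℂ) ω g (t₀, 0, 0) →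
        g (t₀, 0, 0) = 0 →
        ContMDiffAt (𝓘(ℂ, ET).prod (𝓘(ℂ, ℂ).prod 𝓘(ℂ, ℂ))) 𝓘(ℂ, EE) ω
          (fun p : T × ℂ × ℂ => (σ p.1 (g p)).1) (t₀, 0, 0) := by
      intro g hg hg0
      exact ContMDiffAt.comp (g := fun p : T × ℂ => (σ p.1 p.2).1)
        (f := fun p : T × ℂ × ℂ => (p.1, g p)) (t₀, 0, 0) (by rw [hg0]; exact hσ)
        (contMDiffAt_fst.prodMk hg)
    have h1 := hcomp (fun p => p.2.1) (contMDiffAt_fst.comp _ contMDiffAt_snd) rfl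
    have h2 := hcomp (fun p => p.2.2) (contMDiffAt_snd.comp _ contMDiffAt_snd) rfl
    have h3 := hcomp (fun p => p.2.1 + p.2.2) ((contMDiffAt_fst.comp _ contMDiffAt_snd).add
      (contMDiffAt_snd.comp _ contMDiffAt_snd)) (by simp)
    have h4 := Y.contMDiffAt_sub (a := fun p : T × ℂ × ℂ => σ p.1 p.2.1 + σ p.1 p.2.2)
      (b := fun p : T × ℂ × ℂ => σ p.1 (p.2.1 + p.2.2)) (contMDiffAt_add
        (a := fun p : T × ℂ × ℂ => σ p.1 p.2.1) (b := fun p : T × ℂ × ℂ => σ p.1 p.2.2) h1 h2) h3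
    refine h4.congr_of_eventuallyEq ?_
    filter_upwards [hcσ] with p hp
    rw [hp]
  have hcone : ∀ᶠ p : T × ℂ × ℂ in 𝓝 (t₀, 0, 0), p.2.2 = 0 → c p = 1 := by
    filter_upwards [hcσ] with p hp hp0
    apply Additive.ofMul.injective
    apply Y.inc_injective p.1
    rw [hp, hp0, hσ0, ofMul_one, map_zero]
    simp
  -- Both sides are the defect of additivity for three summands, bracketed in two ways.
  have hccoc : ∀ᶠ p : T × ℂ × ℂ × ℂ in 𝓝 (t₀, 0, 0, 0),
      c (p.1, p.2.1, p.2.2.1) * c (p.1, p.2.1 + p.2.2.1, p.2.2.2) =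
        c (p.1, p.2.2.1, p.2.2.2) * c (p.1, p.2.1, p.2.2.1 + p.2.2.2) := by
    have ht : ∀ g : ℂ × ℂ × ℂ → ℂ × ℂ, Continuous g → g 0 = 0 →
        Tendsto (fun p : T × ℂ × ℂ × ℂ => (p.1, g p.2)) (𝓝 (t₀, 0, 0, 0)) (𝓝 (t₀, 0, 0)) := by
      intro g hg hg0
      have : Continuous fun p : T × ℂ × ℂ × ℂ => (p.1, g p.2) := by fun_prop
      have h0 := this.tendsto (t₀, 0, 0, 0)
      rwa [show g (t₀, (0 : ℂ), (0 : ℂ), (0 : ℂ)).2 = 0 from hg0] at h0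
    filter_upwards [(ht (fun q => (q.1, q.2.1)) (by fun_prop) rfl).eventually hcσ,
      (ht (fun q => (q.1 + q.2.1, q.2.2)) (by fun_prop) (by simp)).eventually hcσ,
      (ht (fun q => (q.2.1, q.2.2)) (by fun_prop) rfl).eventually hcσ,
      (ht (fun q => (q.1, q.2.1 + q.2.2)) (by fun_prop) (by simp)).eventually hcσ]
      with p h1 h2 h3 h4
    apply Additive.ofMul.injective
    apply Y.inc_injective p.1
    rw [ofMul_mul, ofMul_mul, map_add, map_add, h1, h2, h3, h4]
    simp only [add_assoc]
    abel
  -- The theorem on cocycles has its parameter in a normed space, so the base is read in a chart.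
  let χ := extChartAt 𝓘(ℂ, ET) t₀
  have hχt : χ.symm (χ t₀) = t₀ := extChartAt_to_inv t₀
  have hχ : ContMDiffAt 𝓘(ℂ, ET) 𝓘(ℂ, ET) ω χ.symm (χ t₀) :=
    (contMDiffOn_extChartAt_symm t₀).contMDiffAt (extChartAt_target_mem_nhds t₀)
  have hχc : ContinuousAt χ.symm (χ t₀) := hχ.continuousAt
  have hlim : ∀ {X : Type} [TopologicalSpace X] (x₀ : X),
      Tendsto (fun q : ET × X => (χ.symm q.1, q.2)) (𝓝 (χ t₀, x₀)) (𝓝 (t₀, x₀)) := by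
    intro X _ x₀
    have : ContinuousAt (fun q : ET × X => (χ.symm q.1, q.2)) (χ t₀, x₀) :=
      (ContinuousAt.comp (x := (χ t₀, x₀)) (f := Prod.fst) hχc continuousAt_fst).prodMk
        continuousAt_snd
    simpa only [ContinuousAt, hχt] using this
  have hanal : AnalyticAt ℂ (fun q : ET × ℂ × ℂ => (c (χ.symm q.1, q.2) : ℂ)) (χ t₀, 0, 0) := by
    apply ContDiffAt.analyticAt
    rw [← contMDiffAt_iff_contDiffAt]
    refine contMDiffAt_units_coe ?_
    refine ContMDiffAt.comp (I' := 𝓘(ℂ, ET).prod (𝓘(ℂ, ℂ).prod 𝓘(ℂ, ℂ))) (g := c)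
      (f := fun q : ET × ℂ × ℂ => (χ.symm q.1, q.2)) _ (by simpa only [hχt] using hca)
      (ContMDiffAt.prodMk ?_ (ContMDiffAt.prodMk ?_ ?_))
    · exact ContMDiffAt.comp (f := Prod.fst) _ hχ contDiffAt_fst.contMDiffAt
    · exact (contDiff_fst.comp contDiff_snd).contDiffAt.contMDiffAt
    · exact (contDiff_snd.comp contDiff_snd).contDiffAt.contMDiffAt
  obtain ⟨h, hha, hh⟩ := exists_local_trivialisation_of_cocycle hanal (by
      have h1 : Tendsto (fun q : ET × ℂ => (q.1, q.2, (0 : ℂ))) (𝓝 (χ t₀, 0)) (𝓝 (χ t₀, 0, 0)) := by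
        have : Continuous fun q : ET × ℂ => (q.1, q.2, (0 : ℂ)) := by fun_prop
        exact this.tendsto (χ t₀, 0)
      filter_upwards [((hlim ((0 : ℂ), (0 : ℂ))).comp h1).eventually hcone] with q hq
      exact congrArg Units.val (hq rfl)) (by
      filter_upwards [(hlim ((0 : ℂ), (0 : ℂ), (0 : ℂ))).eventually hccoc] with q hq
      exact congrArg Units.val hq)
  have hχ' : ContMDiffAt 𝓘(ℂ, ET) 𝓘(ℂ, ET) ω χ t₀ := contMDiffAt_extChartAt
  -- The exponential of the cochain cancels the defect of additivity of `σ`.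
  refine ⟨fun t x => σ t x + Y.inc t (Additive.ofMul (expU (h (χ t, x)))), ?_, ?_, ?_⟩
  · refine contMDiffAt_add (a := fun p : T × ℂ => σ p.1 p.2)
      (b := fun p : T × ℂ => Y.inc p.1 (Additive.ofMul (expU (h (χ p.1, p.2))))) hσ ?_
    refine contMDiffAt_inc contMDiffAt_fst (contMDiffAt_units_of_coe ?_)
    have h1 : ContMDiffAt 𝓘(ℂ, ET × ℂ) 𝓘(ℂ, ℂ) ω (fun q => Complex.exp (h q)) (χ t₀, 0) :=
      hha.contDiffAt.cexp.contMDiffAt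
    refine ContMDiffAt.comp (f := fun p : T × ℂ => (χ p.1, p.2))
      (g := fun q => Complex.exp (h q)) (t₀, 0) h1 ?_
    exact (ContMDiffAt.comp (f := Prod.fst) (t₀, (0 : ℂ)) hχ' contMDiffAt_fst).prodMk_space
      contMDiffAt_snd
  · filter_upwards [hσp] with p hp
    rw [map_add, hp, proj_inc, add_zero]
  · have h1 : Tendsto (fun p : T × ℂ × ℂ => (χ p.1, p.2)) (𝓝 (t₀, 0, 0)) (𝓝 (χ t₀, 0, 0)) := by
      have : ContinuousAt (fun p : T × ℂ × ℂ => (χ p.1, p.2)) (t₀, 0, 0) :=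
        (ContinuousAt.comp (x := (t₀, ((0 : ℂ), (0 : ℂ)))) (f := Prod.fst) hχ'.continuousAt
          continuousAt_fst).prodMk continuousAt_snd
      exact this
    have h2 : ∀ᶠ p : T × ℂ × ℂ in 𝓝 (t₀, 0, 0), χ.symm (χ p.1) = p.1 := by
      have : Tendsto (fun p : T × ℂ × ℂ => p.1) (𝓝 (t₀, 0, 0)) (𝓝 t₀) :=
        continuous_fst.tendsto (t₀, ((0 : ℂ), (0 : ℂ)))
      filter_upwards [this (extChartAt_source_mem_nhds (I := 𝓘(ℂ, ET)) t₀)] with p hp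
      exact χ.left_inv hp
    filter_upwards [hcσ, h1.eventually hh, h2] with p h3 h4 h5
    simp only [h5] at h4
    have h6 : c p * expU (h (χ p.1, p.2.1) + h (χ p.1, p.2.2) - h (χ p.1, p.2.1 + p.2.2)) = 1 :=
      Units.ext h4
    rw [sub_eq_add_neg, expU_add, expU_add, expU_neg] at h6
    have h7 := congrArg (fun z => Y.inc p.1 (Additive.ofMul z)) h6
    simp only [ofMul_mul, ofMul_inv, map_add, map_neg, h3, ofMul_one, map_zero] at h7
    rw [← sub_eq_zero, ← neg_eq_zero, ← h7]
    abel

variable [FiniteDimensional ℂ V]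

/-- Locally on the base, the pullback of an extension to `V` has a holomorphic splitting. -/
theorem exists_local_splitting
    (hΛ : ∀ t₀, ∀ᶠ p in 𝓝 (t₀, (0 : V)), p.2 ∈ Λ p.1 → p.2 = 0) (t₀ : T) :
    ∃ φ : ∀ t, V →+ ↥(Y.π ⁻¹' {t}), ∀ᶠ t in 𝓝 t₀,
      (∀ v, Y.proj t (φ t v) = QuotientAddGroup.mk v) ∧
      ∀ v, ContMDiffAt (𝓘(ℂ, ET).prod 𝓘(ℂ, V)) 𝓘(ℂ, EE) ω (fun p : T × V => (φ p.1 p.2).1)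
        (t, v) := by
  let b := Module.finBasis ℂ V
  let co : ∀ i, V →L[ℂ] ℂ := fun i => LinearMap.toContinuousLinearMap (b.coord i)
  choose ψ hψ hψp hψa using fun i => exists_local_one_parameter (Y := Y) hΛ t₀ (b i)
  -- The fibres are commutative, so the sum of local one-parameter subgroups along a basis is again
  -- a local homomorphism.
  let f : ∀ t, V → ↥(Y.π ⁻¹' {t}) := fun t v => ∑ i, ψ i t (co i v)
  have hf : ContMDiffAt (𝓘(ℂ, ET).prod 𝓘(ℂ, V)) 𝓘(ℂ, EE) ω (fun p : T × V => (f p.1 p.2).1)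
      (t₀, 0) := by
    refine contMDiffAt_sum Finset.univ (a := fun i (p : T × V) => ψ i p.1 (co i p.2))
      contMDiffAt_fst fun i _ => ?_
    refine ContMDiffAt.comp (g := fun p : T × ℂ => (ψ i p.1 p.2).1)
      (f := fun p : T × V => (p.1, co i p.2)) (t₀, 0) (by simpa using hψ i)
      (contMDiffAt_fst.prodMk ?_)
    exact (co i).contMDiff.contMDiffAt.comp (t₀, (0 : V)) contMDiffAt_snd
  have hfp : ∀ᶠ p : T × V in 𝓝 (t₀, 0), Y.proj p.1 (f p.1 p.2) = QuotientAddGroup.mk p.2 := by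
    have h1 : ∀ᶠ p : T × V in 𝓝 (t₀, 0), ∀ i,
        Y.proj p.1 (ψ i p.1 (co i p.2)) = QuotientAddGroup.mk (co i p.2 • b i) := by
      refine eventually_all.2 fun i => ?_
      have : Tendsto (fun p : T × V => (p.1, co i p.2)) (𝓝 (t₀, 0)) (𝓝 (t₀, 0)) := by
        have : Continuous fun p : T × V => (p.1, co i p.2) := by fun_prop
        simpa using this.tendsto (t₀, 0)
      exact this.eventually (hψp i)
    filter_upwards [h1] with p hp
    simp only [f, map_sum, hp]
    rw [← QuotientAddGroup.mk_sum]
    congr 1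
    exact b.sum_repr p.2
  have hfa : ∀ᶠ p : T × V × V in 𝓝 (t₀, 0, 0), f p.1 (p.2.1 + p.2.2) = f p.1 p.2.1 + f p.1 p.2.2 := by
    have h1 : ∀ᶠ p : T × V × V in 𝓝 (t₀, 0, 0), ∀ i,
        ψ i p.1 (co i p.2.1 + co i p.2.2) = ψ i p.1 (co i p.2.1) + ψ i p.1 (co i p.2.2) := by
      refine eventually_all.2 fun i => ?_
      have : Tendsto (fun p : T × V × V => (p.1, co i p.2.1, co i p.2.2)) (𝓝 (t₀, 0, 0))
          (𝓝 (t₀, 0, 0)) := by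
        have : Continuous fun p : T × V × V => (p.1, co i p.2.1, co i p.2.2) := by fun_prop
        simpa using this.tendsto (t₀, 0, 0)
      exact this.eventually (hψa i)
    filter_upwards [h1] with p hp
    simp only [f, map_add, hp, Finset.sum_add_distrib]
  have hev : ∀ {W : Type _} [NormedAddCommGroup W] {p : T × W → Prop},
      (∀ᶠ q in 𝓝 (t₀, (0 : W)), p q) → ∃ ε > 0, ∀ᶠ t in 𝓝 t₀, ∀ w, ‖w‖ < ε → p (t, w) := by
    intro W _ p hp
    rw [nhds_prod_eq] at hp
    obtain ⟨P₁, h1, P₂, h2, h12⟩ := eventually_prod_iff.1 hp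
    obtain ⟨ε, hε, h3⟩ := Metric.eventually_nhds_iff_ball.1 h2
    refine ⟨ε, hε, h1.mono fun t ht w hw => h12 ht (h3 w (by simpa using hw))⟩
  obtain ⟨ε₁, hε₁, H1⟩ := hev hfp
  obtain ⟨ε₂, hε₂, H2⟩ := hev hfa
  obtain ⟨ε₃, hε₃, H3⟩ := hev
    (((contMDiffAt_iff_contMDiffAt_nhds (by decide)).1 hf : ∀ᶠ p in 𝓝 (t₀, (0 : V)), _))
  let ε := min ε₁ (min ε₂ ε₃)
  have hε : 0 < ε := by positivity
  have h1 : ∀ t, ∃ φ : V →+ ↥(Y.π ⁻¹' {t}),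
      (∀ v w, ‖v‖ < ε → ‖w‖ < ε → f t (v + w) = f t v + f t w) →
      ∀ (v : V) (n : ℕ), ‖v‖ < n * ε → φ v = n • f t ((n : ℂ)⁻¹ • v) := by
    intro t
    by_cases h : ∀ v w, ‖v‖ < ε → ‖w‖ < ε → f t (v + w) = f t v + f t w
    · obtain ⟨φ, hφ⟩ := exists_hom_of_local_hom hε fun v w hv hw _ => h v w hv hw
      exact ⟨φ, fun _ => hφ⟩
    · exact ⟨0, fun h' => absurd h' h⟩
  choose φ hφ using h1
  have H2' : ∀ᶠ t in 𝓝 t₀, ∀ v w, ‖v‖ < ε → ‖w‖ < ε → f t (v + w) = f t v + f t w := by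
    filter_upwards [H2] with t ht v w hv hw
    refine ht (v, w) ?_
    rw [Prod.norm_def]
    exact (max_lt hv hw).trans_le ((min_le_right _ _).trans (min_le_left _ _))
  have hscale : ∀ v : V, ∃ n : ℕ, ‖v‖ < n * ε ∧ ‖(n : ℂ)⁻¹ • v‖ < ε ∧ (n : ℂ) ≠ 0 := by
    intro v
    obtain ⟨n, hn⟩ := exists_nat_gt (‖v‖ / ε)
    have hn0 : (0 : ℝ) < n := lt_of_le_of_lt (by positivity) hn
    rw [div_lt_iff₀ hε] at hn
    refine ⟨n, hn, ?_, by exact_mod_cast hn0.ne'⟩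
    rw [norm_smul, norm_inv, Complex.norm_natCast, inv_mul_lt_iff₀ hn0]
    exact hn
  refine ⟨φ, ?_⟩
  filter_upwards [H1, H2'.eventually_nhds, H3] with t ht1 ht2 ht3
  refine ⟨fun v => ?_, fun v => ?_⟩
  · obtain ⟨n, hn, hn', hn0⟩ := hscale v
    rw [hφ t ht2.self_of_nhds v n hn, map_nsmul, ht1 _ (hn'.trans_le (min_le_left _ _)),
      ← QuotientAddGroup.mk_nsmul, ← Nat.cast_smul_eq_nsmul ℂ, smul_smul, mul_inv_cancel₀ hn0,
      one_smul]
  -- One `n` serves for all vectors near `v`, so holomorphy at `v` reduces to holomorphy of `f` near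
  -- the zero section.
  · obtain ⟨n, hn, hn', -⟩ := hscale v
    have h2 := ht3 _ (hn'.trans_le ((min_le_right _ _).trans (min_le_right _ _)))
    have h3 : ContMDiffAt (𝓘(ℂ, ET).prod 𝓘(ℂ, V)) 𝓘(ℂ, EE) ω
        (fun p : T × V => (f p.1 ((n : ℂ)⁻¹ • p.2)).1) (t, v) := by
      refine ContMDiffAt.comp (g := fun p : T × V => (f p.1 p.2).1)
        (f := fun p : T × V => (p.1, (n : ℂ)⁻¹ • p.2)) (t, v) h2 (contMDiffAt_fst.prodMk ?_)
      exact (contDiff_const_smul ((n : ℂ)⁻¹)).contMDiff.contMDiffAt.comp (t, v) contMDiffAt_snd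
    refine (contMDiffAt_nsmul n (a := fun p : T × V => f p.1 ((n : ℂ)⁻¹ • p.2))
      h3).congr_of_eventuallyEq ?_
    have h4 : ∀ᶠ p : T × V in 𝓝 (t, v), ∀ v w, ‖v‖ < ε → ‖w‖ < ε →
        f p.1 (v + w) = f p.1 v + f p.1 w := (continuous_fst.tendsto (t, v)).eventually ht2
    have h5 : ∀ᶠ p : T × V in 𝓝 (t, v), ‖p.2‖ < n * ε :=
      (continuous_snd.norm.tendsto (t, v)).eventually (gt_mem_nhds hn)
    filter_upwards [h4, h5] with p h6 h7
    rw [hφ p.1 h6 p.2 n h7]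

end TorusExtension
end Splittings
end PoincareTorsor
end

noncomputable section
namespace PoincareTorsor
open Filter Topology

/-! ### Lattices over the Siegel space -/

section SiegelLattice

variable {d : ℕ}

/-- The point `κ (m₁ - τ m₂)` of `ℂ^d`. -/
def latPt (κ : ℂ) (τ : Siegel d) (m : (Fin d → ℤ) × (Fin d → ℤ)) : Fin d → ℂ :=
  fun i => κ * ((m.1 i : ℂ) - ∑ j, ent τ i j * (m.2 j : ℂ))

/-- The pairing `n · v`. -/
def dotZ (n : Fin d → ℤ) (v : Fin d → ℂ) : ℂ := ∑ i, (n i : ℂ) * v i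

lemma ent_symm (τ : Siegel d) (i j : Fin d) : ent τ i j = ent τ j i := τ.1.2 i j

lemma latPt_add (κ : ℂ) (τ : Siegel d) (m m' : (Fin d → ℤ) × (Fin d → ℤ)) :
    latPt κ τ (m + m') = latPt κ τ m + latPt κ τ m' := by
  ext i
  simp only [latPt, Prod.fst_add, Prod.snd_add, Pi.add_apply, Int.cast_add, mul_add,
    Finset.sum_add_distrib]
  ring

lemma latPt_zero (κ : ℂ) (τ : Siegel d) : latPt κ τ 0 = 0 := by
  ext i; simp [latPt]

lemma latPt_neg (κ : ℂ) (τ : Siegel d) (m : (Fin d → ℤ) × (Fin d → ℤ)) :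
    latPt κ τ (-m) = -latPt κ τ m := by
  rw [eq_neg_iff_add_eq_zero, ← latPt_add, neg_add_cancel, latPt_zero]

lemma dotZ_add (n : Fin d → ℤ) (v w : Fin d → ℂ) : dotZ n (v + w) = dotZ n v + dotZ n w := by
  simp [dotZ, mul_add, Finset.sum_add_distrib]

lemma dotZ_add_left (n n' : Fin d → ℤ) (v : Fin d → ℂ) :
    dotZ (n + n') v = dotZ n v + dotZ n' v := by
  simp [dotZ, add_mul, Finset.sum_add_distrib]

lemma dotZ_zero (n : Fin d → ℤ) : dotZ n (0 : Fin d → ℂ) = 0 := by simp [dotZ]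

lemma dotZ_zero_left (v : Fin d → ℂ) : dotZ 0 v = 0 := by simp [dotZ]

lemma dotZ_neg_left (n : Fin d → ℤ) (v : Fin d → ℂ) : dotZ (-n) v = -dotZ n v := by
  simp [dotZ]

/-- The reciprocity between the two lattices: `m₂ · (n₁ - τ n₂) - n₂ · (m₁ - τ m₂)` is an integer. -/
lemma dotZ_latPt_sub (κ κ' : ℂ) (τ : Siegel d) (m n : (Fin d → ℤ) × (Fin d → ℤ)) :
    κ * dotZ m.2 (latPt κ' τ n) - κ' * dotZ n.2 (latPt κ τ m) =
      κ * κ' * ((∑ i, (m.2 i * n.1 i - n.2 i * m.1 i) : ℤ) : ℂ) := by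
  -- By the symmetry of `τ` the two terms containing it agree, and only the integral part of the
  -- difference survives.
  have h : ∑ i, ∑ j, (m.2 i : ℂ) * (ent τ i j * n.2 j) =
      ∑ i, ∑ j, (n.2 i : ℂ) * (ent τ i j * m.2 j) := by
    rw [Finset.sum_comm]
    refine Finset.sum_congr rfl fun i _ => Finset.sum_congr rfl fun j _ => ?_
    rw [ent_symm τ j i]; ring
  have e : ∀ (c : ℂ) (a : Fin d → ℤ) (b : (Fin d → ℤ) × (Fin d → ℤ)), dotZ a (latPt c τ b) =
      c * (∑ i, (a i : ℂ) * b.1 i - ∑ i, ∑ j, (a i : ℂ) * (ent τ i j * b.2 j)) := by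
    intro c a b
    simp only [dotZ, latPt]
    rw [← Finset.sum_sub_distrib, Finset.mul_sum]
    refine Finset.sum_congr rfl fun i _ => ?_
    rw [← Finset.mul_sum]; ring
  rw [e, e, h]
  push_cast
  rw [Finset.sum_sub_distrib]
  ring

/-- The real-linear map `(x, y) ↦ x - τ y`. -/
def realPt (τ : Siegel d) (x : (Fin d → ℝ) × (Fin d → ℝ)) : Fin d → ℂ :=
  fun i => (x.1 i : ℂ) - ∑ j, ent τ i j * (x.2 j : ℂ)

lemma posDef_im (τ : Siegel d) : (Matrix.of fun i j => (ent τ i j).im).PosDef := τ.2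

lemma eq_zero_of_im_mulVec (τ : Siegel d) {y : Fin d → ℝ}
    (h : ∀ i, ∑ j, (ent τ i j).im * y j = 0) : y = 0 := by
  by_contra hy
  have := ((Matrix.posDef_iff_dotProduct_mulVec.1 (posDef_im τ)).2 hy)
  have h0 : (Matrix.of fun i j => (ent τ i j).im).mulVec y = 0 := by
    ext i
    simpa [Matrix.mulVec, dotProduct] using h i
  rw [h0] at this
  simp at this

/-- The imaginary part of `x - τ y` is `-(Im τ) y`, so definiteness gives `y = 0`, and then `x = 0`.
-/
lemma realPt_eq_zero {τ : Siegel d} {x : (Fin d → ℝ) × (Fin d → ℝ)} (h : realPt τ x = 0) :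
    x = 0 := by
  have h2 : x.2 = 0 := by
    apply eq_zero_of_im_mulVec τ
    intro i
    have := congrArg Complex.im (congrFun h i)
    simpa [realPt] using this
  have h1 : x.1 = 0 := by
    ext i
    have := congrFun h i
    simpa [realPt, h2] using this
  exact Prod.ext h1 h2

lemma continuous_ent (i j : Fin d) : Continuous fun τ : Siegel d => ent τ i j :=
  (continuous_apply_apply i j).comp (continuous_subtype_val.comp continuous_subtype_val)

lemma continuous_realPt :
    Continuous fun p : Siegel d × ((Fin d → ℝ) × (Fin d → ℝ)) => realPt p.1 p.2 := by
  refine continuous_pi fun i => ?_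
  simp only [realPt]
  have : ∀ j, Continuous fun p : Siegel d × ((Fin d → ℝ) × (Fin d → ℝ)) => ent p.1 i j :=
    fun j => (continuous_ent i j).comp continuous_fst
  refine Continuous.sub ?_ (continuous_finsetSum _ fun j _ => (this j).mul ?_)
  · exact Complex.continuous_ofReal.comp
      ((continuous_apply i).comp (continuous_fst.comp continuous_snd))
  · exact Complex.continuous_ofReal.comp
      ((continuous_apply j).comp (continuous_snd.comp continuous_snd))

/-- The lattices `{x - τ y}` are uniformly discrete, locally in `τ`. -/
lemma exists_le_norm_realPt (τ₀ : Siegel d) : ∃ c > 0, ∀ᶠ τ in 𝓝 τ₀,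
    ∀ x : (Fin d → ℝ) × (Fin d → ℝ), c * ‖x‖ ≤ ‖realPt τ x‖ := by
  have hK : IsCompact (Metric.sphere (0 : (Fin d → ℝ) × (Fin d → ℝ)) 1) := isCompact_sphere _ _
  obtain ⟨c, hc, hcK⟩ : ∃ c > 0, ∀ x ∈ Metric.sphere (0 : (Fin d → ℝ) × (Fin d → ℝ)) 1,
      c < ‖realPt τ₀ x‖ := by
    rcases (Metric.sphere (0 : (Fin d → ℝ) × (Fin d → ℝ)) 1).eq_empty_or_nonempty with h | h
    · exact ⟨1, one_pos, fun x hx => by simp [h] at hx⟩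
    · have hcont : ContinuousOn (fun x => ‖realPt τ₀ x‖)
          (Metric.sphere (0 : (Fin d → ℝ) × (Fin d → ℝ)) 1) :=
        (continuous_realPt.comp (continuous_const.prodMk continuous_id)).norm.continuousOn
      obtain ⟨x₀, hx₀, hmin⟩ := hK.exists_isMinOn h hcont
      have hpos : 0 < ‖realPt τ₀ x₀‖ := by
        rw [norm_pos_iff]
        intro h0
        have := realPt_eq_zero h0
        rw [this] at hx₀
        simp at hx₀
      -- Half the minimum gives a strict inequality, which persists for `τ` near `τ₀` by compactness
      -- of the sphere.
      exact ⟨‖realPt τ₀ x₀‖ / 2, by positivity, fun x hx => by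
        have := isMinOn_iff.1 hmin x hx
        linarith⟩
  refine ⟨c, hc, ?_⟩
  have h1 : ∀ᶠ τ in 𝓝 τ₀, ∀ x ∈ Metric.sphere (0 : (Fin d → ℝ) × (Fin d → ℝ)) 1,
      c < ‖realPt τ x‖ := by
    refine hK.eventually_forall_of_forall_eventually fun x hx => ?_
    exact continuous_realPt.norm.continuousAt.eventually (lt_mem_nhds (hcK x hx))
  filter_upwards [h1] with τ hτ x
  rcases eq_or_ne x 0 with rfl | hx
  · simp
  have hn : 0 < ‖x‖ := norm_pos_iff.2 hx
  -- Homogeneity carries the bound from the unit sphere to all vectors.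
  have h2 := hτ (‖x‖⁻¹ • x) (by simp [norm_smul, hn.ne'])
  have h3 : realPt τ (‖x‖⁻¹ • x) = (‖x‖⁻¹ : ℂ) • realPt τ x := by
    ext i
    simp only [realPt, Prod.smul_fst, Prod.smul_snd, Pi.smul_apply, smul_eq_mul, mul_sub,
      Finset.mul_sum]
    push_cast
    congr 1
    exact Finset.sum_congr rfl fun j _ => by ring
  rw [h3, norm_smul, norm_inv, Complex.norm_real, norm_norm, lt_inv_mul_iff₀ hn] at h2
  linarith

/-- The embedding `ℤ^{2d} → ℝ^{2d}`. -/
def castPt (m : (Fin d → ℤ) × (Fin d → ℤ)) : (Fin d → ℝ) × (Fin d → ℝ) :=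
  (fun i => m.1 i, fun i => m.2 i)

lemma latPt_eq_smul (κ : ℂ) (τ : Siegel d) (m : (Fin d → ℤ) × (Fin d → ℤ)) :
    latPt κ τ m = κ • realPt τ (castPt m) := by
  ext i
  simp [latPt, realPt, castPt]

lemma norm_castPt (m : (Fin d → ℤ) × (Fin d → ℤ)) : ‖castPt m‖ = ‖m‖ := by
  have h : ∀ a : Fin d → ℤ, ‖fun i => (a i : ℝ)‖ = ‖a‖ := by
    intro a
    simp only [Pi.norm_def]
    congr 1
  simp only [castPt, Prod.norm_def, h]

lemma eq_zero_of_latPt_eq_zero {κ : ℂ} (hκ : κ ≠ 0) {τ : Siegel d}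
    {m : (Fin d → ℤ) × (Fin d → ℤ)} (h : latPt κ τ m = 0) : m = 0 := by
  rw [latPt_eq_smul, smul_eq_zero_iff_right hκ] at h
  have := realPt_eq_zero h
  rwa [← norm_eq_zero, norm_castPt, norm_eq_zero] at this

lemma exists_le_norm_latPt {κ : ℂ} (hκ : κ ≠ 0) (τ₀ : Siegel d) : ∃ c > 0, ∀ᶠ τ in 𝓝 τ₀,
    ∀ m : (Fin d → ℤ) × (Fin d → ℤ), c * ‖m‖ ≤ ‖latPt κ τ m‖ := by
  obtain ⟨c, hc, h⟩ := exists_le_norm_realPt τ₀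
  refine ⟨‖κ‖ * c, mul_pos (norm_pos_iff.2 hκ) hc, h.mono fun τ hτ m => ?_⟩
  rw [latPt_eq_smul, norm_smul, mul_assoc, ← norm_castPt]
  exact mul_le_mul_of_nonneg_left (hτ _) (norm_nonneg _)

/-- A lattice point of norm less than `c` comes from an integral `m` with `‖m‖ < 1`, hence from `0`.
This is the form in which discreteness enters the theory of extensions. -/
lemma eventually_latPt_eq_zero {κ : ℂ} (hκ : κ ≠ 0) (τ₀ : Siegel d) :
    ∀ᶠ p in 𝓝 (τ₀, (0 : Fin d → ℂ)), (∃ m, p.2 = latPt κ p.1 m) → p.2 = 0 := by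
  obtain ⟨c, hc, h⟩ := exists_le_norm_latPt hκ τ₀
  have h1 : ∀ᶠ p in 𝓝 (τ₀, (0 : Fin d → ℂ)), ‖p.2‖ < c := by
    have : Continuous fun p : Siegel d × (Fin d → ℂ) => ‖p.2‖ := by fun_prop
    exact this.continuousAt.eventually (gt_mem_nhds (by simpa using hc))
  filter_upwards [(continuous_fst.tendsto (τ₀, (0 : Fin d → ℂ))).eventually h, h1] with p h2 h3
  rintro ⟨m, hm⟩
  have h4 := h2 m
  rw [← hm] at h4
  have h5 : ‖m‖ < 1 := by
    by_contra h6
    rw [not_lt] at h6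
    nlinarith
  have h6 : m = 0 := by
    have h7 : ∀ a : Fin d → ℤ, ‖a‖ < 1 → a = 0 := by
      intro a ha
      ext i
      have := (norm_le_pi_norm a i).trans_lt ha
      rw [Int.norm_eq_abs] at this
      have h8 : |a i| < 1 := by exact_mod_cast this
      exact Int.abs_lt_one_iff.1 h8
    exact Prod.ext (h7 _ ((norm_fst_le m).trans_lt h5)) (h7 _ ((norm_snd_le m).trans_lt h5))
  rw [hm, h6, latPt_zero]

section Holomorphic

variable {EM : Type*} [NormedAddCommGroup EM] [NormedSpace ℂ EM]
  {HM : Type*} [TopologicalSpace HM] {I : ModelWithCorners ℂ EM HM}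
  {M : Type*} [TopologicalSpace M] [ChartedSpace HM M]

lemma contMDiff_siegel_coe :
    ContMDiff 𝓘(ℂ, SymMat d) 𝓘(ℂ, SymMat d) ω (fun τ : Siegel d => τ.1) :=
  contMDiff_subtype_val

lemma contMDiff_ent (i j : Fin d) :
    ContMDiff 𝓘(ℂ, SymMat d) 𝓘(ℂ, ℂ) ω (fun τ : Siegel d => ent τ i j) := by
  let l : SymMat d →L[ℂ] ℂ :=
    (ContinuousLinearMap.proj j ∘L ContinuousLinearMap.proj (R := ℂ) (φ := fun _ => Fin d → ℂ) i)
      ∘L (SymMat d).subtypeL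
  exact l.contMDiff.comp contMDiff_siegel_coe

lemma contMDiffAt_latPt (κ : ℂ) (m : (Fin d → ℤ) × (Fin d → ℤ)) {t : M → Siegel d} {x₀ : M}
    (ht : ContMDiffAt I 𝓘(ℂ, SymMat d) ω t x₀) :
    ContMDiffAt I 𝓘(ℂ, Fin d → ℂ) ω (fun x => latPt κ (t x) m) x₀ := by
  rw [contMDiffAt_pi_space]
  intro i
  simp only [latPt]
  refine contMDiffAt_const.mul (contMDiffAt_const.sub ?_)
  refine ContMDiffAt.sum fun j _ => ?_
  exact ((contMDiff_ent i j).contMDiffAt.comp x₀ ht).mul contMDiffAt_const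

lemma contMDiffAt_dotZ (n : Fin d → ℤ) {v : M → Fin d → ℂ} {x₀ : M}
    (hv : ContMDiffAt I 𝓘(ℂ, Fin d → ℂ) ω v x₀) :
    ContMDiffAt I 𝓘(ℂ, ℂ) ω (fun x => dotZ n (v x)) x₀ := by
  simp only [dotZ]
  refine ContMDiffAt.sum fun j _ => ?_
  exact contMDiffAt_const.mul (contMDiffAt_pi_space.1 hv j)

end Holomorphic

end SiegelLattice
end PoincareTorsor
end

noncomputable section
namespace PoincareTorsor
open Filter Topology

/-! ### Splittings adapted to the lattice, and the invariant `u` -/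

section Adapted

variable {d : ℕ} {κ : ℂ} {Λ : Siegel d → AddSubgroup (Fin d → ℂ)}
  {ET : Type*} [NormedAddCommGroup ET] [NormedSpace ℂ ET]
  {T : Type*} [TopologicalSpace T] [ChartedSpace ET T]
  {EE : Type*} [NormedAddCommGroup EE] [NormedSpace ℂ EE]
  {E : Type*} [TopologicalSpace E] [ChartedSpace EE E]
  {f : T → Siegel d} {Y : TorusExtension ET T EE E (fun t => Λ (f t))}

lemma latPt_single_left (κ : ℂ) (τ : Siegel d) (j : Fin d) :
    latPt κ τ (Pi.single j 1, 0) = κ • Pi.single j 1 := by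
  ext i
  rcases eq_or_ne i j with rfl | hij
  · simp [latPt]
  · simp [latPt, hij]

lemma dotZ_single (j : Fin d) (u : Fin d → ℂ) : dotZ (Pi.single j 1) u = u j := by
  rw [dotZ, Finset.sum_eq_single j] <;> simp +contextual

lemma sum_zsmul_single (m : (Fin d → ℤ) × (Fin d → ℤ)) :
    m = ∑ j, m.1 j • ((Pi.single j 1, 0) : (Fin d → ℤ) × (Fin d → ℤ)) +
      ∑ j, m.2 j • ((0, Pi.single j 1) : (Fin d → ℤ) × (Fin d → ℤ)) := by
  have h : ∀ a : Fin d → ℤ, ∑ j, a j • (Pi.single j 1 : Fin d → ℤ) = a := fun a => by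
    conv_rhs => rw [← Finset.univ_sum_single a]
    refine Finset.sum_congr rfl fun j _ => ?_
    rw [← Pi.single_smul, smul_eq_mul, mul_one]
  refine Prod.ext ?_ ?_
  · simp only [Prod.fst_add, Prod.fst_sum, Prod.smul_fst, smul_zero, Finset.sum_const_zero,
      add_zero, h]
  · simp only [Prod.snd_add, Prod.snd_sum, Prod.smul_snd, smul_zero, Finset.sum_const_zero,
      zero_add, h]

/-- A splitting of a fibre of an extension which on the lattice is the character
`κ (m₁ - τ m₂) ↦ exp (κ u · m₂)`. -/
structure IsAdapted (κ : ℂ) (f : T → Siegel d) (Y : TorusExtension ET T EE E (fun t => Λ (f t)))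
    {t : T} (u : Fin d → ℂ) (φ : (Fin d → ℂ) →+ ↥(Y.π ⁻¹' {t})) : Prop extends
    Y.IsSplitting φ where
  lattice : ∀ m, φ (latPt κ (f t) m) = Y.inc t (Additive.ofMul (expU (κ * dotZ m.2 u)))

/-- The homomorphism `(v, c) ↦ φ v + exp c`. -/
def splitHom {Λ : T → AddSubgroup (Fin d → ℂ)} (Y : TorusExtension ET T EE E Λ) {t : T}
    (φ : (Fin d → ℂ) →+ ↥(Y.π ⁻¹' {t})) : (Fin d → ℂ) × ℂ →+ ↥(Y.π ⁻¹' {t}) :=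
  AddMonoidHom.mk' (fun a => φ a.1 + Y.inc t (Additive.ofMul (expU a.2))) fun a b => by
    rw [Prod.fst_add, Prod.snd_add, map_add, expU_add, ofMul_mul, map_add]; abel

lemma splitHom_apply {Λ : T → AddSubgroup (Fin d → ℂ)} (Y : TorusExtension ET T EE E Λ) {t : T}
    (φ : (Fin d → ℂ) →+ ↥(Y.π ⁻¹' {t})) (a : (Fin d → ℂ) × ℂ) :
    splitHom Y φ a = φ a.1 + Y.inc t (Additive.ofMul (expU a.2)) := rfl

lemma splitHom_surjective {Λ : T → AddSubgroup (Fin d → ℂ)} {Y : TorusExtension ET T EE E Λ}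
    {t : T} {φ : (Fin d → ℂ) →+ ↥(Y.π ⁻¹' {t})} (h : Y.IsSplitting φ) :
    Function.Surjective (splitHom Y φ) := by
  intro e
  obtain ⟨v, hv⟩ := QuotientAddGroup.mk_surjective (Y.proj t e)
  obtain ⟨z, hz⟩ := TorusExtension.exists_inc_eq (Y := Y) (e := e - φ v)
    (by rw [map_sub, h.proj, hv, sub_self])
  obtain ⟨c, rfl⟩ := expU_surjective z
  exact ⟨(v, c), by rw [splitHom_apply, hz]; abel⟩

/-- Projection to the torus puts `a.1` in the lattice, where the splitting is a known character. So
the fibre is the quotient of `ℂ^d × ℂ` by a subgroup depending only on `κ`, `f t` and `u`. -/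
lemma IsAdapted.splitHom_eq_zero_iff (hΛ : ∀ τ v, v ∈ Λ τ ↔ ∃ m, v = latPt κ τ m) {t : T}
    {u : Fin d → ℂ} {φ : (Fin d → ℂ) →+ ↥(Y.π ⁻¹' {t})} (h : IsAdapted κ f Y u φ)
    (a : (Fin d → ℂ) × ℂ) : splitHom Y φ a = 0 ↔
      ∃ m, a.1 = latPt κ (f t) m ∧ expU (κ * dotZ m.2 u + a.2) = 1 := by
  have key : ∀ m, splitHom Y φ (latPt κ (f t) m, a.2) =
      Y.inc t (Additive.ofMul (expU (κ * dotZ m.2 u + a.2))) := fun m => by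
    rw [splitHom_apply, h.lattice, expU_add, ofMul_mul, map_add]
  constructor
  · intro h0
    have h1 := congrArg (Y.proj t) h0
    rw [splitHom_apply, map_add, h.proj, TorusExtension.proj_inc, add_zero, map_zero,
      QuotientAddGroup.eq_zero_iff, hΛ] at h1
    obtain ⟨m, hm⟩ := h1
    refine ⟨m, hm, ?_⟩
    have h2 := key m
    rw [← hm, Prod.mk.eta, h0] at h2
    apply Additive.ofMul.injective
    apply Y.inc_injective t
    rw [← h2, ofMul_one, map_zero]
  · rintro ⟨m, hm, h1⟩
    have h2 := key m
    rw [← hm, Prod.mk.eta, h1, ofMul_one, map_zero] at h2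
    exact h2

/-- The lattice character determines `u` up to the dual lattice, and the splitting up to the
exponential of the corresponding linear form. -/
lemma IsAdapted.exists_eq [IsManifold 𝓘(ℂ, EE) ω E] (hκ : κ ≠ 0) (hf : Continuous f)
    (hΛ : ∀ τ v, v ∈ Λ τ ↔ ∃ m, v = latPt κ τ m) {t : T}
    {u u' : Fin d → ℂ} {φ φ' : (Fin d → ℂ) →+ ↥(Y.π ⁻¹' {t})}
    (h : IsAdapted κ f Y u φ) (h' : IsAdapted κ f Y u' φ') :
    ∃ n, u' = u + latPt (2 * Real.pi * Complex.I / κ) (f t) n ∧ ∀ v, φ' v = φ v +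
      Y.inc t (Additive.ofMul (expU (2 * Real.pi * Complex.I / κ * dotZ n.2 v))) := by
  have hdisc : ∀ t₀, ∀ᶠ p in 𝓝 (t₀, (0 : Fin d → ℂ)), p.2 ∈ Λ (f p.1) → p.2 = 0 := by
    intro t₀
    have hc : Continuous fun p : T × (Fin d → ℂ) => (f p.1, p.2) := by fun_prop
    filter_upwards [(hc.tendsto (t₀, 0)).eventually (eventually_latPt_eq_zero hκ (f t₀))]
      with p hp hm
    exact hp ((hΛ _ _).1 hm)
  obtain ⟨L, hL⟩ := TorusExtension.IsSplitting.exists_linear hdisc h.toIsSplitting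
    h'.toIsSplitting
  have hlat : ∀ m, expU (κ * dotZ m.2 u') = expU (κ * dotZ m.2 u + L (latPt κ (f t) m)) := by
    intro m
    apply Additive.ofMul.injective
    apply Y.inc_injective t
    rw [← h'.lattice, hL, h.lattice, ← map_add, ← ofMul_mul, ← expU_add]
  have hlat' : ∀ m, ∃ n : ℤ, κ * dotZ m.2 u + L (latPt κ (f t) m) - κ * dotZ m.2 u' =
      n * (2 * Real.pi * Complex.I) := by
    intro m
    rw [← expU_eq_one_iff, sub_eq_add_neg, expU_add, expU_neg, hlat m, mul_inv_cancel]
  -- On the first half of the lattice both characters are trivial, so `L` has values in `2πi ℤ`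
  -- there and is given by an integral vector `p`. Comparison on the second half then computes `u' -
  -- u`.
  choose p hp using fun j => hlat' (Pi.single j 1, 0)
  choose r hr using fun j => hlat' (0, Pi.single j 1)
  have hLp : ∀ v, L v = 2 * Real.pi * Complex.I / κ * dotZ p v := by
    intro v
    have h2 : ∀ j, L (Pi.single j 1) = 2 * Real.pi * Complex.I / κ * p j := by
      intro j
      have h3 := hp j
      rw [latPt_single_left, map_smul, smul_eq_mul] at h3
      simp only [dotZ_zero_left, mul_zero, zero_add, sub_zero] at h3
      field_simp
      linear_combination h3
    conv_lhs => rw [← Finset.univ_sum_single v]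
    rw [map_sum, dotZ, Finset.mul_sum]
    refine Finset.sum_congr rfl fun j _ => ?_
    have : (Pi.single j (v j) : Fin d → ℂ) = v j • Pi.single j 1 := by
      rw [← Pi.single_smul, smul_eq_mul, mul_one]
    rw [this, map_smul, h2, smul_eq_mul]
    ring
  refine ⟨(-r, p), ?_, fun v => by rw [hL, hLp]⟩
  ext j
  have h4 := hr j
  have h7 : dotZ p (latPt κ (f t) (0, Pi.single j 1)) = -κ * ∑ i, ent (f t) j i * (p i : ℂ) := by
    simp only [dotZ, latPt, Finset.mul_sum]
    refine Finset.sum_congr rfl fun i _ => ?_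
    rw [Finset.sum_eq_single j]
    · simp [ent_symm (f t) i j]; ring
    · simp +contextual
    · simp
  rw [hLp, h7, dotZ_single, dotZ_single] at h4
  simp only [Pi.add_apply, latPt, Pi.neg_apply, Int.cast_neg]
  field_simp at h4 ⊢
  linear_combination -h4

/-- Locally on the base, an extension has a holomorphic family of adapted splittings. -/
lemma exists_local_adapted [FiniteDimensional ℂ ET] [IsManifold 𝓘(ℂ, ET) ω T]
    [IsManifold 𝓘(ℂ, EE) ω E] (hκ : κ ≠ 0) (hf : ContMDiff 𝓘(ℂ, ET) 𝓘(ℂ, SymMat d) ω f)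
    (hΛ : ∀ τ v, v ∈ Λ τ ↔ ∃ m, v = latPt κ τ m)
    (Y : TorusExtension ET T EE E (fun t => Λ (f t))) (t₀ : T) :
    ∃ (u : T → Fin d → ℂ) (φ : ∀ t, (Fin d → ℂ) →+ ↥(Y.π ⁻¹' {t})),
      ContMDiffAt 𝓘(ℂ, ET) 𝓘(ℂ, Fin d → ℂ) ω u t₀ ∧
      (∀ v, ContMDiffAt (𝓘(ℂ, ET).prod 𝓘(ℂ, Fin d → ℂ)) 𝓘(ℂ, EE) ω
        (fun p : T × (Fin d → ℂ) => (φ p.1 p.2).1) (t₀, v)) ∧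
      ∀ᶠ t in 𝓝 t₀, IsAdapted κ f Y (u t) (φ t) := by
  have hdisc : ∀ t₀, ∀ᶠ p in 𝓝 (t₀, (0 : Fin d → ℂ)), p.2 ∈ Λ (f p.1) → p.2 = 0 := by
    intro t₀
    have hc : Continuous fun p : T × (Fin d → ℂ) => (f p.1, p.2) := by
      have := hf.continuous
      fun_prop
    filter_upwards [(hc.tendsto (t₀, 0)).eventually (eventually_latPt_eq_zero hκ (f t₀))]
      with p hp hm
    exact hp ((hΛ _ _).1 hm)
  obtain ⟨φ, hφ⟩ := TorusExtension.exists_local_splitting (Y := Y) hdisc t₀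
  -- On lattice points the splitting takes values in `ℂˣ`; these are local holomorphic logarithms of
  -- the values.
  have hlog : ∀ m, ∃ a : T → ℂ, ContMDiffAt 𝓘(ℂ, ET) 𝓘(ℂ, ℂ) ω a t₀ ∧
      ∀ᶠ t in 𝓝 t₀, φ t (latPt κ (f t) m) = Y.inc t (Additive.ofMul (expU (a t))) := by
    intro m
    have h1 : ∀ t, ∃ c : ℂˣ, (∀ v, Y.proj t (φ t v) = QuotientAddGroup.mk v) →
        Y.inc t (Additive.ofMul c) = φ t (latPt κ (f t) m) := by
      intro t
      by_cases h : ∀ v, Y.proj t (φ t v) = QuotientAddGroup.mk v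
      · obtain ⟨c, hc⟩ := TorusExtension.exists_inc_eq (Y := Y) (e := φ t (latPt κ (f t) m))
          (by rw [h, QuotientAddGroup.eq_zero_iff, hΛ]; exact ⟨m, rfl⟩)
        exact ⟨c, fun _ => hc⟩
      · exact ⟨1, fun h' => absurd h' h⟩
    choose c hc using h1
    have h2 : ContMDiffAt 𝓘(ℂ, ET) 𝓘(ℂ, EE) ω (fun t => (φ t (latPt κ (f t) m)).1) t₀ :=
      ContMDiffAt.comp (g := fun p : T × (Fin d → ℂ) => (φ p.1 p.2).1)
        (f := fun t => (t, latPt κ (f t) m)) t₀ (hφ.self_of_nhds.2 _)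
        (contMDiffAt_id.prodMk (contMDiffAt_latPt κ m hf.contMDiffAt))
    have h3 : ContMDiffAt 𝓘(ℂ, ET) 𝓘(ℂ, ℂ) ω c t₀ := by
      refine TorusExtension.contMDiffAt_of_inc (Y := Y) (t := fun t => t) hdisc
        (h2.congr_of_eventuallyEq ?_)
      filter_upwards [hφ] with t ht
      rw [hc t ht.1]
    obtain ⟨l, hl, -, hlc⟩ := exists_local_log (Complex.exp_log (c t₀).ne_zero) h3
    refine ⟨l, hl, ?_⟩
    filter_upwards [hlc, hφ] with t h4 h5
    rw [← hc t h5.1]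
    congr 2
    exact Units.ext h4.symm
  choose a ha hφa using hlog
  -- The linear form whose value at `κ e_j` is the logarithm found there. Subtracting its
  -- exponential makes the character trivial on `κ ℤ^d`.
  let L : T → (Fin d → ℂ) → ℂ := fun t v => κ⁻¹ * ∑ j, a (Pi.single j 1, 0) t * v j
  have hLadd : ∀ t v w, L t (v + w) = L t v + L t w := by
    intro t v w
    simp only [L, Pi.add_apply, mul_add, Finset.sum_add_distrib]
  let ψ : ∀ t, (Fin d → ℂ) →+ ↥(Y.π ⁻¹' {t}) := fun t =>
    AddMonoidHom.mk' (fun v => φ t v - Y.inc t (Additive.ofMul (expU (L t v)))) fun v w => by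
      rw [hLadd, expU_add, ofMul_mul, map_add, map_add]; abel
  have hL : ∀ {t₀ : T} {v : T → Fin d → ℂ}, (∀ m, ContMDiffAt 𝓘(ℂ, ET) 𝓘(ℂ, ℂ) ω (a m) t₀) →
      ContMDiffAt 𝓘(ℂ, ET) 𝓘(ℂ, Fin d → ℂ) ω v t₀ →
      ContMDiffAt 𝓘(ℂ, ET) 𝓘(ℂ, ℂ) ω (fun t => L t (v t)) t₀ := by
    intro t₀ v ha hv
    refine contMDiffAt_const.mul (ContMDiffAt.sum fun j _ => ?_)
    exact (ha _).mul (contMDiffAt_pi_space.1 hv j)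
  have hL2 : ∀ v, ContMDiffAt (𝓘(ℂ, ET).prod 𝓘(ℂ, Fin d → ℂ)) 𝓘(ℂ, ℂ) ω
      (fun p : T × (Fin d → ℂ) => L p.1 p.2) (t₀, v) := by
    intro v
    refine contMDiffAt_const.mul (ContMDiffAt.sum fun j _ => ?_)
    refine ContMDiffAt.mul ?_ (contMDiffAt_pi_space.1 contMDiffAt_snd j)
    exact ContMDiffAt.comp (f := Prod.fst) (t₀, v) (ha _) contMDiffAt_fst
  have hψ : ∀ v, ContMDiffAt (𝓘(ℂ, ET).prod 𝓘(ℂ, Fin d → ℂ)) 𝓘(ℂ, EE) ω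
      (fun p : T × (Fin d → ℂ) => (ψ p.1 p.2).1) (t₀, v) := by
    intro v
    refine Y.contMDiffAt_sub (a := fun p : T × (Fin d → ℂ) => φ p.1 p.2)
      (b := fun p : T × (Fin d → ℂ) => Y.inc p.1 (Additive.ofMul (expU (L p.1 p.2))))
      (hφ.self_of_nhds.2 v) ?_
    refine TorusExtension.contMDiffAt_inc contMDiffAt_fst (contMDiffAt_units_of_coe ?_)
    exact ContMDiffAt.comp (g := Complex.exp) (t₀, v) Complex.contDiff_exp.contMDiff.contMDiffAt
      (hL2 v)
  refine ⟨fun t j => κ⁻¹ * (a (0, Pi.single j 1) t - L t (latPt κ (f t) (0, Pi.single j 1))), ψ,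
    ?_, hψ, ?_⟩
  · rw [contMDiffAt_pi_space]
    intro j
    exact contMDiffAt_const.mul ((ha _).sub (hL ha (contMDiffAt_latPt κ _ hf.contMDiffAt)))
  have e1 : ∀ᶠ t in 𝓝 t₀, ∀ j, φ t (latPt κ (f t) (Pi.single j 1, 0)) =
      Y.inc t (Additive.ofMul (expU (a (Pi.single j 1, 0) t))) := eventually_all.2 fun j => hφa _
  have e2 : ∀ᶠ t in 𝓝 t₀, ∀ j, φ t (latPt κ (f t) (0, Pi.single j 1)) =
      Y.inc t (Additive.ofMul (expU (a (0, Pi.single j 1) t))) := eventually_all.2 fun j => hφa _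
  filter_upwards [hφ, e1, e2] with t h1 h2 h3
  have hs := TorusExtension.isSplitting_of_contMDiffAt h1.1 h1.2
  refine ⟨⟨fun v => ?_, fun v x => ?_⟩, fun m => ?_⟩
  · change Y.proj t (φ t v - Y.inc t (Additive.ofMul (expU (L t v)))) = _
    rw [map_sub, h1.1, TorusExtension.proj_inc, sub_zero]
  · have h4 : ∀ x : ℂ, L t (x • v) = x * L t v := by
      intro x
      simp only [L, Pi.smul_apply, smul_eq_mul, Finset.mul_sum]
      exact Finset.sum_congr rfl fun j _ => by ring
    refine Y.contMDiffAt_sub (t := fun _ : ℂ => t) (a := fun x : ℂ => φ t (x • v))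
      (b := fun x : ℂ => Y.inc t (Additive.ofMul (expU (L t (x • v))))) (hs.holomorphic v x) ?_
    refine TorusExtension.contMDiffAt_inc (t := fun _ : ℂ => t) contMDiffAt_const
      (contMDiffAt_units_of_coe ?_)
    simp only [h4, coe_expU]
    exact (contDiff_id.mul contDiff_const).cexp.contMDiff.contMDiffAt
  · have hL1 : ∀ j, L t (latPt κ (f t) (Pi.single j 1, 0)) = a (Pi.single j 1, 0) t := by
      intro j
      simp only [L]
      rw [latPt_single_left, Finset.sum_eq_single j]
      · simp; field_simp
      · intro i _ hij; simp [hij]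
      · simp
    have g1 : ∀ j, ψ t (latPt κ (f t) (Pi.single j 1, 0)) = 0 := by
      intro j
      change φ t _ - Y.inc t (Additive.ofMul (expU (L t _))) = 0
      rw [h2, hL1, sub_self]
    let U : Fin d → ℂ := fun j =>
      κ⁻¹ * (a (0, Pi.single j 1) t - L t (latPt κ (f t) (0, Pi.single j 1)))
    have g2 : ∀ j, ψ t (latPt κ (f t) (0, Pi.single j 1)) =
        Y.inc t (Additive.ofMul (expU (κ * U j))) := by
      intro j
      change φ t _ - Y.inc t (Additive.ofMul (expU (L t _))) = _
      rw [h3, mul_inv_cancel_left₀ hκ, sub_eq_add_neg (a (0, Pi.single j 1) t), expU_add, expU_neg,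
        ofMul_mul, ofMul_inv, map_add, map_neg, sub_eq_add_neg]
    -- Both sides are homomorphisms in `m`, so they need only be compared on generators.
    let G₁ : (Fin d → ℤ) × (Fin d → ℤ) →+ ↥(Y.π ⁻¹' {t}) :=
      AddMonoidHom.mk' (fun m => ψ t (latPt κ (f t) m)) fun m m' => by rw [latPt_add, map_add]
    let G₂ : (Fin d → ℤ) × (Fin d → ℤ) →+ ↥(Y.π ⁻¹' {t}) :=
      AddMonoidHom.mk' (fun m => Y.inc t (Additive.ofMul (expU (κ * dotZ m.2 U)))) fun m m' => by
        rw [Prod.snd_add, dotZ_add_left, mul_add, expU_add, ofMul_mul, map_add]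
    change G₁ m = G₂ m
    rw [sum_zsmul_single m]
    simp only [map_add, map_sum, map_zsmul]
    congr 1
    · refine Finset.sum_congr rfl fun j _ => congrArg _ ((g1 j).trans ?_)
      change 0 = Y.inc t (Additive.ofMul (expU (κ * dotZ 0 U)))
      rw [dotZ_zero_left, mul_zero, expU_zero, ofMul_one, map_zero]
    · refine Finset.sum_congr rfl fun j _ => congrArg _ ((g2 j).trans ?_)
      change _ = Y.inc t (Additive.ofMul (expU (κ * dotZ (Pi.single j 1) U)))
      rw [dotZ_single]

/-- The fibres of two extensions with adapted splittings for the same `u` are isomorphic. -/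
lemma exists_equiv_of_adapted {ET' : Type*} [NormedAddCommGroup ET'] [NormedSpace ℂ ET']
    {T' : Type*} [TopologicalSpace T'] [ChartedSpace ET' T']
    {EE' : Type*} [NormedAddCommGroup EE'] [NormedSpace ℂ EE']
    {E' : Type*} [TopologicalSpace E'] [ChartedSpace EE' E']
    {f' : T' → Siegel d} {Y' : TorusExtension ET' T' EE' E' (fun t => Λ (f' t))}
    (hΛ : ∀ τ v, v ∈ Λ τ ↔ ∃ m, v = latPt κ τ m) {t : T} {t' : T'} (ht : f' t' = f t)
    {u : Fin d → ℂ} {φ : (Fin d → ℂ) →+ ↥(Y.π ⁻¹' {t})} {φ' : (Fin d → ℂ) →+ ↥(Y'.π ⁻¹' {t'})}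
    (h : IsAdapted κ f Y u φ) (h' : IsAdapted κ f' Y' u φ') :
    ∃ e : ↥(Y.π ⁻¹' {t}) ≃+ ↥(Y'.π ⁻¹' {t'}), ∀ a, e (splitHom Y φ a) = splitHom Y' φ' a := by
  -- Both fibres are quotients of `ℂ^d × ℂ`, and the subgroups agree because `u` and the point of
  -- the Siegel space do.
  have hker : (splitHom Y φ).ker = (splitHom Y' φ').ker := by
    ext a
    rw [AddMonoidHom.mem_ker, AddMonoidHom.mem_ker, h.splitHom_eq_zero_iff hΛ,
      h'.splitHom_eq_zero_iff hΛ, ht]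
  let e₁ := QuotientAddGroup.quotientKerEquivOfSurjective _ (splitHom_surjective h.toIsSplitting)
  let e₂ := QuotientAddGroup.quotientKerEquivOfSurjective _ (splitHom_surjective h'.toIsSplitting)
  let e₃ := QuotientAddGroup.quotientAddEquivOfEq hker
  refine ⟨(e₁.symm.trans e₃).trans e₂, fun a => ?_⟩
  have : e₁.symm (splitHom Y φ a) = QuotientAddGroup.mk a := by
    rw [AddEquiv.symm_apply_eq]; rfl
  simp only [AddEquiv.trans_apply, this]
  rfl

end Adapted
end PoincareTorsor
end

noncomputable section
namespace PoincareTorsor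
open Filter Topology

/-! ### The Heisenberg action in coordinates and the fibres of the Poincaré torsor -/

section Construction

/-- The scale of the dual lattice. -/
abbrev dualScale (κ : ℂ) : ℂ := 2 * Real.pi * Complex.I / κ

variable {d : ℕ}

/-- The action of the Heisenberg group in the coordinates `(τ, u, v, w)`. -/
def moveCoord (κ : ℂ) (g : ((Fin d → ℤ) × (Fin d → ℤ)) × ((Fin d → ℤ) × (Fin d → ℤ)) × ℤ)
    (x : Coord d) : Coord d :=
  (x.1, x.2.1 + latPt (dualScale κ) x.1 g.2.1, x.2.2.1 + latPt κ x.1 g.1,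
    x.2.2.2 - dualScale κ * dotZ g.2.1.2 x.2.2.1 -
      κ * dotZ g.1.2 (x.2.1 + latPt (dualScale κ) x.1 g.2.1) +
      g.2.2 * (2 * Real.pi * Complex.I))

/-- The vector space on which `ℍ_d × M_{1,d}(ℂ) × M_{d,1}(ℂ) × ℂ` is modelled. -/
abbrev CoordSpace (d : ℕ) : Type := SymMat d × (Fin d → ℂ) × (Fin d → ℂ) × ℂ

/-- The model with corners of `ℍ_d × M_{1,d}(ℂ) × M_{d,1}(ℂ) × ℂ`. -/
abbrev coordModel (d : ℕ) :=
  𝓘(ℂ, SymMat d).prod (𝓘(ℂ, Fin d → ℂ).prod (𝓘(ℂ, Fin d → ℂ).prod 𝓘(ℂ, ℂ)))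

/-- The model with corners of `ℍ_d × ℂ^d`. -/
abbrev famModel (d : ℕ) := 𝓘(ℂ, SymMat d).prod 𝓘(ℂ, Fin d → ℂ)

variable {κ : ℂ} {Λ Λ' : Siegel d → AddSubgroup (Fin d → ℂ)}
  [TopologicalSpace (Total Λ')] [ChartedSpace (SymMat d × (Fin d → ℂ)) (Total Λ')]
  {P : Type*} [TopologicalSpace P] [ChartedSpace (CoordSpace d) P]

/-- Holomorphic coordinates `(τ, u, v, w)` on `P`, unique up to the Heisenberg group. -/
structure PoincareChart (κ : ℂ) (Λ Λ' : Siegel d → AddSubgroup (Fin d → ℂ))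
    [TopologicalSpace (Total Λ')] [ChartedSpace (SymMat d × (Fin d → ℂ)) (Total Λ')]
    {P : Type*} [TopologicalSpace P] [ChartedSpace (CoordSpace d) P] (q : Coord d → P) : Prop where
  scale_ne : κ ≠ 0
  mem_iff : ∀ τ v, v ∈ Λ τ ↔ ∃ m, v = latPt κ τ m
  mem_dual_iff : ∀ τ u, u ∈ Λ' τ ↔ ∃ n, u = latPt (dualScale κ) τ n
  cls_localDiffeo : IsLocalDiffeomorph (famModel d) 𝓘(ℂ, SymMat d × (Fin d → ℂ)) ω
    (fun x : Siegel d × (Fin d → ℂ) => Total.cls Λ' x.1 x.2)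
  surjective : Function.Surjective q
  localDiffeo : IsLocalDiffeomorph (coordModel d) 𝓘(ℂ, CoordSpace d) ω q
  rel : ∀ x y, q x = q y ↔ ∃ g, y = moveCoord κ g x

omit [TopologicalSpace (Total Λ')] [ChartedSpace (SymMat d × (Fin d → ℂ)) (Total Λ')] in
lemma cls_eq_iff {τ : Siegel d} {u u' : Fin d → ℂ} :
    Total.cls Λ' τ u = Total.cls Λ' τ u' ↔ u' - u ∈ Λ' τ := by
  simp only [Total.cls, Total.mk.injEq, heq_eq_eq, true_and]
  rw [QuotientAddGroup.eq, neg_add_eq_sub]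

omit [TopologicalSpace (Total Λ')] [ChartedSpace (SymMat d × (Fin d → ℂ)) (Total Λ')] in
lemma cls_eq_cls_iff {τ τ' : Siegel d} {u u' : Fin d → ℂ} :
    Total.cls Λ' τ u = Total.cls Λ' τ' u' ↔ τ = τ' ∧ u' - u ∈ Λ' τ := by
  constructor
  · intro h
    have h1 : τ = τ' := congrArg Total.base h
    subst h1
    exact ⟨rfl, cls_eq_iff.1 h⟩
  · rintro ⟨rfl, h⟩
    exact cls_eq_iff.2 h

namespace PoincareChart

variable {q : Coord d → P} (h : PoincareChart κ Λ Λ' q)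

include h

lemma dualScale_ne : dualScale κ ≠ 0 :=
  div_ne_zero Complex.two_pi_I_ne_zero h.scale_ne

lemma cls_eq (x y : Coord d) (hxy : q x = q y) :
    Total.cls Λ' x.1 x.2.1 = Total.cls Λ' y.1 y.2.1 := by
  obtain ⟨g, rfl⟩ := (h.rel x y).1 hxy
  refine cls_eq_iff.2 ((h.mem_dual_iff _ _).2 ⟨g.2.1, ?_⟩)
  simp [moveCoord]

/-- If `u` does not move, the component of the group element in the dual lattice is zero. What
remains are the relations between `v` and `w` of the extension attached to `u`. -/
lemma eq_iff {τ : Siegel d} {u v v' : Fin d → ℂ} {w w' : ℂ} :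
    q (τ, u, v, w) = q (τ, u, v', w') ↔
      ∃ m, v' - v = latPt κ τ m ∧ expU (κ * dotZ m.2 u + (w' - w)) = 1 := by
  rw [h.rel]
  constructor
  · rintro ⟨⟨m, n, z⟩, hg⟩
    simp only [moveCoord, Prod.mk.injEq, true_and] at hg
    obtain ⟨h1, rfl, rfl⟩ := hg
    obtain rfl := eq_zero_of_latPt_eq_zero h.dualScale_ne (left_eq_add.1 h1)
    refine ⟨m, by simp, expU_eq_one_iff.2 ⟨z, ?_⟩⟩
    simp only [latPt_zero, add_zero, Prod.snd_zero, dotZ_zero_left]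
    ring
  · rintro ⟨m, h1, h2⟩
    obtain ⟨z, hz⟩ := expU_eq_one_iff.1 h2
    refine ⟨(m, 0, z), ?_⟩
    simp only [moveCoord, latPt_zero, add_zero, Prod.snd_zero, dotZ_zero_left, ← h1, ← hz]
    refine Prod.ext rfl (Prod.ext rfl (Prod.ext (by simp) ?_))
    simp only
    ring

/-- An element of the group that moves `u` but not `v` corrects `w` by a term additive in `v`. For
this reason the group structure of a fibre does not depend on the representative `u`. -/
lemma shift (τ : Siegel d) (u v : Fin d → ℂ) (w : ℂ) (n : (Fin d → ℤ) × (Fin d → ℤ)) :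
    q (τ, u + latPt (dualScale κ) τ n, v, w) = q (τ, u, v, w + dualScale κ * dotZ n.2 v) := by
  refine ((h.rel _ _).2 ⟨(0, n, 0), ?_⟩).symm
  simp [moveCoord, latPt_zero, dotZ_zero_left]

/-- The projection `[τ, u, v, w] ↦ [τ, u]`. -/
def proj (h : PoincareChart κ Λ Λ' q) (p : P) : Total Λ' :=
  Total.cls Λ' (h.surjective p).choose.1 (h.surjective p).choose.2.1

lemma proj_apply (x : Coord d) : h.proj (q x) = Total.cls Λ' x.1 x.2.1 :=
  h.cls_eq _ _ (h.surjective (q x)).choose_spec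

omit [TopologicalSpace (Total Λ')] [ChartedSpace (SymMat d × (Fin d → ℂ)) (Total Λ')] h in
/-- A representative of a point of the dual torus. -/
def _root_.PoincareTorsor.Total.rep (b : Total Λ') : Fin d → ℂ := Quotient.out b.pt

omit [TopologicalSpace (Total Λ')] [ChartedSpace (SymMat d × (Fin d → ℂ)) (Total Λ')] h in
lemma _root_.PoincareTorsor.Total.cls_rep (b : Total Λ') : Total.cls Λ' b.base b.rep = b := by
  obtain ⟨τ, p⟩ := b
  simp only [Total.cls, Total.rep, Total.mk.injEq, heq_eq_eq, true_and]
  exact Quotient.out_eq p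

/-- The relations between the coordinates `(v, w)` on a fibre. -/
def relations (_h : PoincareChart κ Λ Λ' q) (b : Total Λ') : AddSubgroup ((Fin d → ℂ) × ℂ) where
  carrier := {a | ∃ m, a.1 = latPt κ b.base m ∧ expU (κ * dotZ m.2 b.rep + a.2) = 1}
  zero_mem' := ⟨0, by simp [latPt_zero, dotZ_zero_left, expU_zero]⟩
  add_mem' := by
    rintro a a' ⟨m, h1, h2⟩ ⟨m', h1', h2'⟩
    refine ⟨m + m', by rw [Prod.fst_add, h1, h1', latPt_add], ?_⟩
    rw [Prod.snd_add, Prod.snd_add, dotZ_add_left,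
      show κ * (dotZ m.2 b.rep + dotZ m'.2 b.rep) + (a.2 + a'.2) =
        (κ * dotZ m.2 b.rep + a.2) + (κ * dotZ m'.2 b.rep + a'.2) by ring, expU_add, h2, h2', one_mul]
  neg_mem' := by
    rintro a ⟨m, h1, h2⟩
    refine ⟨-m, by rw [Prod.fst_neg, h1, latPt_neg], ?_⟩
    rw [Prod.snd_neg, Prod.snd_neg, dotZ_neg_left,
      show κ * -dotZ m.2 b.rep + -a.2 = -(κ * dotZ m.2 b.rep + a.2) by ring, expU_neg, h2, inv_one]

/-- The point of the fibre at `b` with coordinates `(v, w)`. -/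
def fibPt (h : PoincareChart κ Λ Λ' q) (b : Total Λ') (a : (Fin d → ℂ) × ℂ) :
    ↥(h.proj ⁻¹' {b}) :=
  ⟨q (b.base, b.rep, a.1, a.2), (h.proj_apply _).trans b.cls_rep⟩

lemma fibPt_eq_iff (b : Total Λ') (a a' : (Fin d → ℂ) × ℂ) :
    h.fibPt b a = h.fibPt b a' ↔ -a + a' ∈ h.relations b := by
  rw [Subtype.ext_iff]
  change q (b.base, b.rep, a.1, a.2) = q (b.base, b.rep, a'.1, a'.2) ↔ _
  rw [h.eq_iff, neg_add_eq_sub]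
  rfl

lemma exists_rep (τ : Siegel d) (u : Fin d → ℂ) :
    ∃ n, u = (Total.cls Λ' τ u).rep + latPt (dualScale κ) τ n := by
  have h1 : Total.cls Λ' τ (Total.cls Λ' τ u).rep = Total.cls Λ' τ u :=
    Total.cls_rep (Total.cls Λ' τ u)
  obtain ⟨n, hn⟩ := (h.mem_dual_iff _ _).1 (cls_eq_iff.1 h1)
  exact ⟨n, by rw [← hn]; abel⟩

lemma fibPt_surjective (b : Total Λ') : Function.Surjective (h.fibPt b) := by
  rintro ⟨p, hp⟩
  obtain ⟨⟨τ, u, v, w⟩, rfl⟩ := h.surjective p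
  have hb : Total.cls Λ' τ u = b := (h.proj_apply _).symm.trans hp
  subst hb
  obtain ⟨n, hn⟩ := h.exists_rep τ u
  refine ⟨(v, w + dualScale κ * dotZ n.2 v), Subtype.ext ?_⟩
  have := h.shift τ (Total.cls Λ' τ u).rep v w n
  rw [← hn] at this
  exact this.symm

/-- The coordinates `(v, w)` on a fibre. -/
def fibEquiv (h : PoincareChart κ Λ Λ' q) (b : Total Λ') :
    ((Fin d → ℂ) × ℂ) ⧸ h.relations b ≃ ↥(h.proj ⁻¹' {b}) :=
  Equiv.ofBijective
    (Quotient.lift (h.fibPt b) fun a a' haa' =>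
      (h.fibPt_eq_iff b a a').2 (QuotientAddGroup.leftRel_apply.1 haa'))
    ⟨by
      rintro ⟨a⟩ ⟨a'⟩ haa'
      exact QuotientAddGroup.eq.2 ((h.fibPt_eq_iff b a a').1 haa'),
    fun p => by
      obtain ⟨a, ha⟩ := h.fibPt_surjective b p
      exact ⟨QuotientAddGroup.mk a, ha⟩⟩

/-- The group structures on the fibres. -/
@[reducible]
def fibGroup (h : PoincareChart κ Λ Λ' q) (b : Total Λ') : AddCommGroup ↥(h.proj ⁻¹' {b}) :=
  (h.fibEquiv b).symm.addCommGroup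

/-- The coordinates `(v, w)` as a homomorphism onto the fibre. -/
def fibHom (h : PoincareChart κ Λ Λ' q) (b : Total Λ') :
    letI := h.fibGroup b
    (Fin d → ℂ) × ℂ →+ ↥(h.proj ⁻¹' {b}) :=
  letI := h.fibGroup b
  ((h.fibEquiv b).symm.addEquiv.symm : _ →+ ↥(h.proj ⁻¹' {b})).comp
    (QuotientAddGroup.mk' (h.relations b))

lemma fibHom_apply (b : Total Λ') (a : (Fin d → ℂ) × ℂ) : h.fibHom b a = h.fibPt b a := rfl

/-- The coordinates `(v, w)` on a fibre for an arbitrary choice of `u`. -/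
def coordHom (h : PoincareChart κ Λ Λ' q) (τ : Siegel d) (u : Fin d → ℂ) :
    letI := h.fibGroup (Total.cls Λ' τ u)
    (Fin d → ℂ) × ℂ →+ ↥(h.proj ⁻¹' {Total.cls Λ' τ u}) :=
  letI := h.fibGroup (Total.cls Λ' τ u)
  AddMonoidHom.mk' (fun a => ⟨q (τ, u, a.1, a.2), h.proj_apply _⟩) (by
    obtain ⟨n, hn⟩ := h.exists_rep τ u
    intro a a'
    have key : ∀ a : (Fin d → ℂ) × ℂ, (⟨q (τ, u, a.1, a.2), h.proj_apply _⟩ :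
        ↥(h.proj ⁻¹' {Total.cls Λ' τ u})) = h.fibHom (Total.cls Λ' τ u)
          (a.1, a.2 + dualScale κ * dotZ n.2 a.1) := by
      intro a
      apply Subtype.ext
      have := h.shift τ (Total.cls Λ' τ u).rep a.1 a.2 n
      rw [← hn] at this
      exact this
    refine (key _).trans (Eq.trans ?_ (congrArg₂ (· + ·) (key a) (key a')).symm)
    rw [← map_add]
    congr 1
    refine Prod.ext rfl ?_
    simp only [Prod.fst_add, Prod.snd_add, dotZ_add]
    ring)

end PoincareChart

end Construction
end PoincareTorsor
end

noncomputable section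
namespace PoincareTorsor
open Filter Topology

/-! ### The extension defined by the coordinates -/

section ExtensionOfChart

variable {d : ℕ} {κ : ℂ} {Λ Λ' : Siegel d → AddSubgroup (Fin d → ℂ)}
  [TopologicalSpace (Total Λ')] [ChartedSpace (SymMat d × (Fin d → ℂ)) (Total Λ')]
  {P : Type*} [TopologicalSpace P] [ChartedSpace (CoordSpace d) P]

namespace PoincareChart

variable {q : Coord d → P} (h : PoincareChart κ Λ Λ' q)

include h

/-- Changing `w` by a period is a relation with lattice component `0`. Hence `ℂˣ` may be included by
means of any logarithm. -/
lemma fibHom_exp {b : Total Λ'} {c c' : ℂ} (hc : expU c = expU c') :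
    h.fibHom b (0, c) = h.fibHom b (0, c') := by
  rw [fibHom_apply, fibHom_apply, fibPt_eq_iff]
  refine ⟨0, by simp [latPt_zero], ?_⟩
  simp only [Prod.snd_zero, dotZ_zero_left, mul_zero, zero_add, Prod.snd_add, Prod.snd_neg]
  rw [expU_add, expU_neg, hc, inv_mul_cancel]

/-- The inclusion of `ℂˣ` in a fibre. -/
def incHom (h : PoincareChart κ Λ Λ' q) (b : Total Λ') :
    letI := h.fibGroup b
    Additive ℂˣ →+ ↥(h.proj ⁻¹' {b}) :=
  letI := h.fibGroup b
  AddMonoidHom.mk' (fun z => h.fibHom b (0, Complex.log z.toMul)) fun z z' => by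
    rw [← map_add, Prod.mk_add_mk, add_zero]
    refine h.fibHom_exp ?_
    rw [expU_add]
    apply Units.ext
    simp only [coe_expU, Units.val_mul, toMul_add]
    rw [Complex.exp_log (Units.ne_zero _), Complex.exp_log (Units.ne_zero _),
      Complex.exp_log (mul_ne_zero (Units.ne_zero _) (Units.ne_zero _))]

lemma incHom_expU (b : Total Λ') (c : ℂ) :
    h.incHom b (Additive.ofMul (expU c)) = h.fibHom b (0, c) :=
  h.fibHom_exp (Units.ext (Complex.exp_log (Units.ne_zero _)))

/-- The projection to the torus in the coordinates `(v, w)`. -/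
def torusLift (h : PoincareChart κ Λ Λ' q) (b : Total Λ') :
    ((Fin d → ℂ) × ℂ) ⧸ h.relations b →+ (Fin d → ℂ) ⧸ Λ b.base :=
  QuotientAddGroup.lift (h.relations b)
    ((QuotientAddGroup.mk' (Λ b.base)).comp (AddMonoidHom.fst (Fin d → ℂ) ℂ)) (by
      rintro a ⟨m, hm, -⟩
      exact (QuotientAddGroup.eq_zero_iff _).2 ((h.mem_iff _ _).2 ⟨m, hm⟩))

/-- The projection of a fibre to the torus. -/
def torusHom (h : PoincareChart κ Λ Λ' q) (b : Total Λ') :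
    letI := h.fibGroup b
    ↥(h.proj ⁻¹' {b}) →+ (Fin d → ℂ) ⧸ Λ b.base :=
  letI := h.fibGroup b
  (h.torusLift b).comp ((h.fibEquiv b).symm.addEquiv : ↥(h.proj ⁻¹' {b}) →+ _)

lemma torusHom_fibHom (b : Total Λ') (a : (Fin d → ℂ) × ℂ) :
    h.torusHom b (h.fibHom b a) = QuotientAddGroup.mk a.1 :=
  congrArg (h.torusLift b) ((h.fibEquiv b).symm_apply_apply (QuotientAddGroup.mk a))

lemma base_eq {b : Total Λ'} (e : ↥(h.proj ⁻¹' {b})) {τ : Siegel d} {u v : Fin d → ℂ} {w : ℂ}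
    (he : e.1 = q (τ, u, v, w)) : b = Total.cls Λ' τ u := by
  have h1 : h.proj e.1 = b := e.2
  rw [← h1, he, h.proj_apply]

/-- Points of a fibre written with a common `u` are values of the homomorphism `coordHom`, so the
group law can be read off for every `u`, not only for the chosen representative. -/
lemma sub_val {b : Total Λ'} (e e' : ↥(h.proj ⁻¹' {b})) {τ : Siegel d} {u v v' : Fin d → ℂ}
    {w w' : ℂ} (he : e.1 = q (τ, u, v, w)) (he' : e'.1 = q (τ, u, v', w')) :
    letI := h.fibGroup b
    (e - e').1 = q (τ, u, v - v', w - w') := by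
  obtain rfl := h.base_eq e he
  obtain rfl : e = h.coordHom τ u (v, w) := Subtype.ext he
  obtain rfl : e' = h.coordHom τ u (v', w') := Subtype.ext he'
  let _ := h.fibGroup (Total.cls Λ' τ u)
  change (h.coordHom τ u (v, w) - h.coordHom τ u (v', w')).1 = _
  rw [← map_sub]
  rfl

lemma add_val {b : Total Λ'} (e e' : ↥(h.proj ⁻¹' {b})) {τ : Siegel d} {u v v' : Fin d → ℂ}
    {w w' : ℂ} (he : e.1 = q (τ, u, v, w)) (he' : e'.1 = q (τ, u, v', w')) :
    letI := h.fibGroup b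
    (e + e').1 = q (τ, u, v + v', w + w') := by
  obtain rfl := h.base_eq e he
  obtain rfl : e = h.coordHom τ u (v, w) := Subtype.ext he
  obtain rfl : e' = h.coordHom τ u (v', w') := Subtype.ext he'
  let _ := h.fibGroup (Total.cls Λ' τ u)
  change (h.coordHom τ u (v, w) + h.coordHom τ u (v', w')).1 = _
  rw [← map_add]
  rfl

lemma incHom_val (τ : Siegel d) (u : Fin d → ℂ) (c : ℂ) :
    (h.incHom (Total.cls Λ' τ u) (Additive.ofMul (expU c))).1 = q (τ, u, 0, c) := by
  rw [incHom_expU]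
  obtain ⟨n, hn⟩ := h.exists_rep τ u
  have := h.shift τ (Total.cls Λ' τ u).rep 0 c n
  rw [← hn, dotZ_zero, mul_zero, add_zero] at this
  exact this.symm

lemma inc_add_val {b : Total Λ'} (e : ↥(h.proj ⁻¹' {b})) {τ : Siegel d} {u v : Fin d → ℂ}
    {w : ℂ} (he : e.1 = q (τ, u, v, w)) (c : ℂ) :
    letI := h.fibGroup b
    (h.incHom b (Additive.ofMul (expU c)) + e).1 = q (τ, u, v, c + w) := by
  obtain rfl := h.base_eq e he
  rw [h.add_val _ e (h.incHom_val τ u c) he, zero_add]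

lemma torusHom_val {b : Total Λ'} (e : ↥(h.proj ⁻¹' {b})) {τ : Siegel d} {u v : Fin d → ℂ}
    {w : ℂ} (he : e.1 = q (τ, u, v, w)) : h.torusHom b e = QuotientAddGroup.mk v := by
  obtain rfl := h.base_eq e he
  obtain ⟨n, hn⟩ := h.exists_rep τ u
  have := h.shift τ (Total.cls Λ' τ u).rep v w n
  rw [← hn] at this
  obtain rfl : e = h.fibHom (Total.cls Λ' τ u) (v, w + dualScale κ * dotZ n.2 v) :=
    Subtype.ext (he.trans this)
  exact h.torusHom_fibHom _ _

lemma incHom_injective (b : Total Λ') : Function.Injective (h.incHom b) := by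
  let _ := h.fibGroup b
  rw [injective_iff_map_eq_zero]
  intro z hz
  obtain ⟨c, hc⟩ := expU_surjective z.toMul
  obtain rfl : z = Additive.ofMul (expU c) := by rw [hc]; rfl
  rw [incHom_expU, ← map_zero (h.fibHom b)] at hz
  obtain ⟨m, hm, hm'⟩ := (h.fibPt_eq_iff b _ _).1 hz.symm
  simp only [neg_zero, zero_add] at hm hm'
  obtain rfl := eq_zero_of_latPt_eq_zero h.scale_ne hm.symm
  simp only [Prod.snd_zero, dotZ_zero_left, mul_zero, zero_add] at hm'
  rw [hm', ofMul_one]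

lemma exact_incHom_torusHom (b : Total Λ') : Function.Exact (h.incHom b) (h.torusHom b) := by
  let _ := h.fibGroup b
  intro e
  obtain ⟨⟨v, w⟩, rfl⟩ := h.fibPt_surjective b e
  rw [← fibHom_apply, torusHom_fibHom]
  constructor
  · intro hv
    obtain ⟨m, hm⟩ := (h.mem_iff _ _).1 ((QuotientAddGroup.eq_zero_iff _).1 hv)
    -- The relation for `m` moves `v` back to `0` at the price of `κ m₂ · u` in `w`.
    refine ⟨Additive.ofMul (expU (κ * dotZ m.2 b.rep + w)), ?_⟩
    rw [incHom_expU, fibHom_apply, fibHom_apply, fibPt_eq_iff]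
    refine ⟨m, by simpa using hm, ?_⟩
    simp only [Prod.snd_add, Prod.snd_neg]
    rw [show κ * dotZ m.2 b.rep + (-(κ * dotZ m.2 b.rep + w) + w) = 0 by ring, expU_zero]
  · rintro ⟨z, hz⟩
    obtain ⟨c, hc⟩ := expU_surjective z.toMul
    obtain rfl : z = Additive.ofMul (expU c) := by rw [hc]; rfl
    rw [← torusHom_fibHom h b (v, w), ← hz, incHom_expU, torusHom_fibHom]
    rfl

lemma torusHom_surjective (b : Total Λ') : Function.Surjective (h.torusHom b) := by
  intro x
  obtain ⟨v, rfl⟩ := QuotientAddGroup.mk_surjective x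
  exact ⟨h.fibHom b (v, 0), h.torusHom_fibHom _ _⟩

lemma exists_local_coord [IsManifold 𝓘(ℂ, CoordSpace d) ω P] (c : Coord d) :
    ∃ r : P → Coord d, ContMDiffAt 𝓘(ℂ, CoordSpace d) (coordModel d) ω r (q c) ∧ r (q c) = c ∧
      (∀ᶠ x in 𝓝 c, r (q x) = x) ∧ ∀ᶠ p in 𝓝 (q c), q (r p) = p :=
  IsLocalDiffeomorphAt.exists_inverse (h.localDiffeo c)

/-- A local inverse `g` of `(τ, u) ↦ [τ, u]` gives the section `(b, v) ↦ q (g b, v, 0)`. With it the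
trivialisation is `q` composed with a local logarithm on `ℂˣ`. -/
lemma locallyTrivial [IsManifold 𝓘(ℂ, SymMat d × (Fin d → ℂ)) ω (Total Λ')]
    [IsManifold 𝓘(ℂ, CoordSpace d) ω P] (b₀ : Total Λ') (v₀ : Fin d → ℂ) :
    letI := h.fibGroup
    ∃ (N : Set (Total Λ' × (Fin d → ℂ)))
      (s : ∀ p : Total Λ' × (Fin d → ℂ), ↥(h.proj ⁻¹' {p.1})),
      IsOpen N ∧ (b₀, v₀) ∈ N ∧
      (∀ p ∈ N, h.torusHom p.1 (s p) = QuotientAddGroup.mk p.2) ∧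
      IsLocalDiffeomorphOn ((𝓘(ℂ, SymMat d × (Fin d → ℂ)).prod 𝓘(ℂ, Fin d → ℂ)).prod 𝓘(ℂ, ℂ))
        𝓘(ℂ, CoordSpace d) ω
        (fun x : (Total Λ' × (Fin d → ℂ)) × ℂˣ =>
          (h.incHom x.1.1 (Additive.ofMul x.2) + s x.1 : ↥(h.proj ⁻¹' {x.1.1})).1)
        (N ×ˢ Set.univ) := by
  let _ := h.fibGroup
  set g := (h.cls_localDiffeo (b₀.base, b₀.rep)).localInverse with hg
  have hb₀ : b₀ ∈ g.source := by
    have := (h.cls_localDiffeo (b₀.base, b₀.rep)).localInverse_mem_source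
    simpa only [Total.cls_rep] using this
  have hgr : ∀ b ∈ g.source, Total.cls Λ' (g b).1 (g b).2 = b := fun b hb =>
    (h.cls_localDiffeo (b₀.base, b₀.rep)).localInverse_right_inv hb
  have hgl : ∀ x ∈ g.target, g (Total.cls Λ' x.1 x.2) = x := fun x hx =>
    (h.cls_localDiffeo (b₀.base, b₀.rep)).localInverse_left_inv hx
  have hs : ∀ p : Total Λ' × (Fin d → ℂ), ∃ e : ↥(h.proj ⁻¹' {p.1}), p.1 ∈ g.source →
      e.1 = q ((g p.1).1, (g p.1).2, p.2, 0) := by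
    intro p
    by_cases hp : p.1 ∈ g.source
    · exact ⟨⟨q ((g p.1).1, (g p.1).2, p.2, 0), (h.proj_apply _).trans (hgr _ hp)⟩, fun _ => rfl⟩
    · exact ⟨0, fun h' => absurd h' hp⟩
  choose s hs using hs
  refine ⟨g.source ×ˢ Set.univ, s, g.open_source.prod isOpen_univ, ⟨hb₀, trivial⟩,
    fun p hp => h.torusHom_val _ (hs p hp.1), ?_⟩
  rintro ⟨⟨⟨b₁, v₁⟩, z₁⟩, ⟨⟨hb₁, -⟩, -⟩⟩
  set Φ := fun x : (Total Λ' × (Fin d → ℂ)) × ℂˣ =>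
    (h.incHom x.1.1 (Additive.ofMul x.2) + s x.1 : ↥(h.proj ⁻¹' {x.1.1})).1 with hΦ
  have hΦq : ∀ (b : Total Λ') (v : Fin d → ℂ) (c : ℂ), b ∈ g.source →
      Φ ((b, v), expU c) = q ((g b).1, (g b).2, v, c) := by
    intro b v c hb
    have := h.inc_add_val (s (b, v)) (hs (b, v) hb) c
    rw [add_zero] at this
    exact this
  obtain ⟨c₁, rfl⟩ := expU_surjective z₁
  simp only
  have hgc : ContMDiffAt 𝓘(ℂ, SymMat d × (Fin d → ℂ)) (famModel d) ω g b₁ :=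
    (g.contMDiffOn_toFun b₁ hb₁).contMDiffAt (g.open_source.mem_nhds hb₁)
  set x₁ : (Total Λ' × (Fin d → ℂ)) × ℂˣ := ((b₁, v₁), expU c₁) with hx₁
  have hid : ContMDiffAt ((𝓘(ℂ, SymMat d × (Fin d → ℂ)).prod 𝓘(ℂ, Fin d → ℂ)).prod 𝓘(ℂ, ℂ))
      𝓘(ℂ, ℂ) ω (fun x : (Total Λ' × (Fin d → ℂ)) × ℂˣ => x.2) x₁ := contMDiffAt_snd
  obtain ⟨l, hl, hl1, hlexp⟩ := exists_local_log (f := fun x => x.2) (w := c₁) (x := x₁) rfl hid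
  set F : (Total Λ' × (Fin d → ℂ)) × ℂˣ → Coord d :=
    fun x => ((g x.1.1).1, (g x.1.1).2, x.1.2, l x) with hF
  have hF1 : F x₁ = ((g b₁).1, (g b₁).2, v₁, c₁) := by
    change ((g b₁).1, (g b₁).2, v₁, l x₁) = _
    rw [hl1]
  have hgx : ContMDiffAt ((𝓘(ℂ, SymMat d × (Fin d → ℂ)).prod 𝓘(ℂ, Fin d → ℂ)).prod 𝓘(ℂ, ℂ))
      (famModel d) ω (fun x : (Total Λ' × (Fin d → ℂ)) × ℂˣ => g x.1.1) x₁ :=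
    ContMDiffAt.comp (f := fun x : (Total Λ' × (Fin d → ℂ)) × ℂˣ => x.1.1) x₁ hgc
      (contMDiffAt_fst.comp x₁ contMDiffAt_fst)
  have hFc : ContMDiffAt ((𝓘(ℂ, SymMat d × (Fin d → ℂ)).prod 𝓘(ℂ, Fin d → ℂ)).prod 𝓘(ℂ, ℂ))
      (coordModel d) ω F x₁ :=
    (contMDiffAt_fst.comp x₁ hgx).prodMk ((contMDiffAt_snd.comp x₁ hgx).prodMk
      ((contMDiffAt_snd.comp x₁ contMDiffAt_fst).prodMk hl))
  have hnear : ∀ᶠ x : (Total Λ' × (Fin d → ℂ)) × ℂˣ in 𝓝 x₁, x.1.1 ∈ g.source := by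
    have : Continuous fun x : (Total Λ' × (Fin d → ℂ)) × ℂˣ => x.1.1 := by fun_prop
    exact this.continuousAt.eventually (g.open_source.mem_nhds hb₁)
  have hΦF : ∀ᶠ x in 𝓝 x₁, Φ x = q (F x) := by
    filter_upwards [hnear, hlexp] with x hx hx'
    have := hΦq x.1.1 x.1.2 (l x) hx
    rw [show expU (l x) = x.2 from Units.ext hx'] at this
    exact this
  obtain ⟨r, hr, hr1, hrq, hqr⟩ := h.exists_local_coord (F x₁)
  have hclsr : ContMDiffAt (coordModel d) 𝓘(ℂ, SymMat d × (Fin d → ℂ)) ω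
      (fun c : Coord d => Total.cls Λ' c.1 c.2.1) (F x₁) :=
    ContMDiffAt.comp (g := fun x : Siegel d × (Fin d → ℂ) => Total.cls Λ' x.1 x.2)
      (f := fun c : Coord d => (c.1, c.2.1)) (F x₁) (h.cls_localDiffeo _).contMDiffAt
      (contMDiffAt_fst.prodMk (contMDiffAt_fst.comp _ contMDiffAt_snd))
  have hexpr : ContMDiffAt (coordModel d) 𝓘(ℂ, ℂ) ω (fun c : Coord d => expU c.2.2.2) (F x₁) :=
    contMDiffAt_units_of_coe (ContMDiffAt.comp (g := Complex.exp) (F x₁)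
      Complex.contDiff_exp.contMDiff.contMDiffAt
      (contMDiffAt_snd.comp _ (contMDiffAt_snd.comp _ contMDiffAt_snd)))
  -- The inverse takes coordinates by a local inverse `r` of `q` and exponentiates the last one.
  refine isLocalDiffeomorphAt_of_inverse (y := q (F x₁))
    (g := fun p => ((Total.cls Λ' (r p).1 (r p).2.1, (r p).2.2.1), expU (r p).2.2.2))
    hΦF.self_of_nhds ?_ ?_ ?_ ?_
  · exact (ContMDiffAt.comp x₁ (h.localDiffeo (F x₁)).contMDiffAt hFc).congr_of_eventuallyEq hΦF
  · rw [← hr1] at hclsr hexpr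
    have hv : ContMDiffAt 𝓘(ℂ, CoordSpace d) 𝓘(ℂ, Fin d → ℂ) ω (fun p => (r p).2.2.1) (q (F x₁)) :=
      contMDiffAt_fst.comp _ (contMDiffAt_snd.comp _ (contMDiffAt_snd.comp _ hr))
    exact ((hclsr.comp _ hr).prodMk hv).prodMk (hexpr.comp _ hr)
  · filter_upwards [hΦF, hnear, hlexp, hFc.continuousAt.eventually hrq] with x h1 h2 h3 h4
    rw [h1, h4]
    simp only [hF, hgr _ h2]
    rw [show expU (l x) = x.2 from Units.ext h3]
  · have htar : ∀ᶠ p in 𝓝 (q (F x₁)), ((r p).1, (r p).2.1) ∈ g.target := by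
      have h1 : ContinuousAt (fun p => ((r p).1, (r p).2.1)) (q (F x₁)) :=
        (continuousAt_fst.comp hr.continuousAt).prodMk
          (continuousAt_fst.comp (continuousAt_snd.comp hr.continuousAt))
      refine h1.eventually (g.open_target.mem_nhds ?_)
      simp only
      rw [hr1, hF1]
      exact g.map_source hb₁
    have hsrc : ∀ᶠ p in 𝓝 (q (F x₁)), Total.cls Λ' (r p).1 (r p).2.1 ∈ g.source := by
      rw [← hr1] at hclsr
      have h2 : ContinuousAt (fun p => Total.cls Λ' (r p).1 (r p).2.1) (q (F x₁)) :=
        ContinuousAt.comp hclsr.continuousAt hr.continuousAt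
      refine h2.eventually (g.open_source.mem_nhds ?_)
      simp only
      rw [hr1, hF1, hgr _ hb₁]
      exact hb₁
    filter_upwards [htar, hqr, hsrc] with p h1 h2 h3
    rw [hΦq _ _ _ h3, hgl _ h1]
    exact h2

lemma exists_local_cls [IsManifold 𝓘(ℂ, SymMat d × (Fin d → ℂ)) ω (Total Λ')]
    (x : Siegel d × (Fin d → ℂ)) : ∀ᶠ p in 𝓝 (x, x),
      Total.cls Λ' p.1.1 p.1.2 = Total.cls Λ' p.2.1 p.2.2 → p.1 = p.2 := by
  obtain ⟨g, -, -, hg, -⟩ := IsLocalDiffeomorphAt.exists_inverse (h.cls_localDiffeo x)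
  filter_upwards [(continuous_fst.tendsto (x, x)).eventually hg,
    (continuous_snd.tendsto (x, x)).eventually hg] with p h1 h2 h3
  rw [← h1, h3, h2]

/-- The two maps lift locally to coordinates with the same `(τ, u)`, and there subtraction is that
of `(v, w)`. -/
lemma holomorphic_sub [IsManifold 𝓘(ℂ, SymMat d × (Fin d → ℂ)) ω (Total Λ')]
    [IsManifold 𝓘(ℂ, CoordSpace d) ω P] (n : ℕ) (U : Set (Fin n → ℂ)) (a b : (Fin n → ℂ) → P)
    (hU : IsOpen U) (ha : ContMDiffOn 𝓘(ℂ, Fin n → ℂ) 𝓘(ℂ, CoordSpace d) ω a U)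
    (hb : ContMDiffOn 𝓘(ℂ, Fin n → ℂ) 𝓘(ℂ, CoordSpace d) ω b U)
    (hab : ∀ x ∈ U, h.proj (b x) = h.proj (a x)) :
    letI := h.fibGroup
    ContMDiffOn 𝓘(ℂ, Fin n → ℂ) 𝓘(ℂ, CoordSpace d) ω (fun x => fibSub h.proj (a x) (b x)) U := by
  let _ := h.fibGroup
  intro x₀ hx₀
  have ha := (ha x₀ hx₀).contMDiffAt (hU.mem_nhds hx₀)
  have hb := (hb x₀ hx₀).contMDiffAt (hU.mem_nhds hx₀)
  apply ContMDiffAt.contMDiffWithinAt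
  obtain ⟨⟨τ, u, v, w⟩, hc⟩ := h.surjective (a x₀)
  obtain ⟨⟨τ', u', v', w'⟩, hc'⟩ := h.surjective (b x₀)
  have h0 := hab x₀ hx₀
  rw [← hc, ← hc', h.proj_apply, h.proj_apply] at h0
  obtain ⟨rfl, h1⟩ := cls_eq_cls_iff.1 h0
  obtain ⟨m, hm⟩ := (h.mem_dual_iff _ _).1 h1
  simp only at hm h1 h0
  -- The representative of `b x₀` is changed so that its `u` is that of `a x₀`.
  obtain rfl : u' = u + latPt (dualScale κ) τ' (-m) := by rw [latPt_neg, ← hm]; abel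
  rw [h.shift] at hc'
  obtain ⟨r, hr, hr1, -, hqr⟩ := h.exists_local_coord (τ', u, v, w)
  obtain ⟨r', hr', hr1', -, hqr'⟩ := h.exists_local_coord
    (τ', u, v', w' + dualScale κ * dotZ (-m).2 v')
  rw [hc] at hr hr1 hqr
  rw [hc'] at hr' hr1' hqr'
  have hA := hr.comp x₀ ha
  have hB := hr'.comp x₀ hb
  -- Both lifts stay near `(τ', u)`, where points are determined by their classes, so they continue
  -- to share `(τ, u)`.
  have hcls : ∀ᶠ x in 𝓝 x₀, Total.cls Λ' (r (a x)).1 (r (a x)).2.1 =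
      Total.cls Λ' (r' (b x)).1 (r' (b x)).2.1 →
      ((r (a x)).1, (r (a x)).2.1) = ((r' (b x)).1, (r' (b x)).2.1) := by
    have e := h.exists_local_cls (τ', u)
    have h2 : ContinuousAt (fun x => (((r (a x)).1, (r (a x)).2.1),
        ((r' (b x)).1, (r' (b x)).2.1))) x₀ :=
      ((continuousAt_fst.comp hA.continuousAt).prodMk
        (continuousAt_fst.comp (continuousAt_snd.comp hA.continuousAt))).prodMk
        ((continuousAt_fst.comp hB.continuousAt).prodMk
        (continuousAt_fst.comp (continuousAt_snd.comp hB.continuousAt)))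
    have h3 := h2.tendsto
    simp only [hr1, hr1'] at h3
    exact h3.eventually e
  have hv := (contMDiffAt_fst.comp x₀ (contMDiffAt_snd.comp x₀ (contMDiffAt_snd.comp x₀ hA))).sub
    (contMDiffAt_fst.comp x₀ (contMDiffAt_snd.comp x₀ (contMDiffAt_snd.comp x₀ hB)))
  have hw := (contMDiffAt_snd.comp x₀ (contMDiffAt_snd.comp x₀ (contMDiffAt_snd.comp x₀ hA))).sub
    (contMDiffAt_snd.comp x₀ (contMDiffAt_snd.comp x₀ (contMDiffAt_snd.comp x₀ hB)))
  have hres := (contMDiffAt_fst.comp x₀ hA).prodMk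
    ((contMDiffAt_fst.comp x₀ (contMDiffAt_snd.comp x₀ hA)).prodMk (hv.prodMk hw))
  refine (ContMDiffAt.comp x₀ (h.localDiffeo _).contMDiffAt hres).congr_of_eventuallyEq ?_
  filter_upwards [hcls, ha.continuousAt.eventually hqr, hb.continuousAt.eventually hqr',
    hU.mem_nhds hx₀] with x h2 h3 h4 h5
  have h6 := hab x h5
  have h7 : Total.cls Λ' (r (a x)).1 (r (a x)).2.1 =
      Total.cls Λ' (r' (b x)).1 (r' (b x)).2.1 := by
    rw [← h.proj_apply, ← h.proj_apply, h3, h4, h6]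
  have h8 := h2 h7
  rw [Prod.mk.injEq] at h8
  have h9 := fibSub_val h.proj (t := h.proj (a x)) ⟨a x, rfl⟩ ⟨b x, h6⟩
  refine h9.trans (h.sub_val _ _ (τ := (r (a x)).1) (u := (r (a x)).2.1) (v := (r (a x)).2.2.1)
    (w := (r (a x)).2.2.2) (v' := (r' (b x)).2.2.1) (w' := (r' (b x)).2.2.2) h3.symm ?_)
  rw [h8.1, h8.2]
  exact h4.symm

/-- The extension over the dual family defined by the coordinates. -/
def extension (h : PoincareChart κ Λ Λ' q)
    [IsManifold 𝓘(ℂ, SymMat d × (Fin d → ℂ)) ω (Total Λ')] [IsManifold 𝓘(ℂ, CoordSpace d) ω P] :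
    TorusExtension (SymMat d × (Fin d → ℂ)) (Total Λ') (CoordSpace d) P (fun b => Λ b.base) where
  π := h.proj
  grp := h.fibGroup
  inc := h.incHom
  proj := h.torusHom
  inc_injective := h.incHom_injective
  exact := h.exact_incHom_torusHom
  proj_surjective := h.torusHom_surjective
  locallyTrivial := h.locallyTrivial
  holomorphic_sub := h.holomorphic_sub

end PoincareChart

end ExtensionOfChart
end PoincareTorsor
end

noncomputable section
namespace PoincareTorsor
open Filter Topology

/-! ### The universal property -/

section Universality

set_option linter.unusedSectionVars false

variable {d : ℕ} {κ : ℂ} {Λ Λ' : Siegel d → AddSubgroup (Fin d → ℂ)}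
  [TopologicalSpace (Total Λ')] [ChartedSpace (SymMat d × (Fin d → ℂ)) (Total Λ')]
  {P : Type*} [TopologicalSpace P] [ChartedSpace (CoordSpace d) P]
  [IsManifold 𝓘(ℂ, SymMat d × (Fin d → ℂ)) ω (Total Λ')] [IsManifold 𝓘(ℂ, CoordSpace d) ω P]

namespace PoincareChart

variable {q : Coord d → P} (h : PoincareChart κ Λ Λ' q)

include h in
lemma continuous_base : Continuous (Total.base : Total Λ' → Siegel d) := by
  rw [continuous_iff_continuousAt]
  intro b
  obtain ⟨g, hg, -, -, hr⟩ :=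
    IsLocalDiffeomorphAt.exists_inverse (h.cls_localDiffeo (b.base, b.rep))
  simp only [Total.cls_rep] at hg hr
  refine (continuousAt_fst.comp hg.continuousAt).congr ?_
  filter_upwards [hr] with b' hb'
  conv_rhs => rw [← hb']
  rfl

/-- The splitting is `v ↦ q (τ, u, v, 0)`; the relations in the fibre say that its character on the
lattice is the one attached to `u`. -/
lemma exists_adapted {τ : Siegel d} {u : Fin d → ℂ} {b : Total Λ'} (hb : Total.cls Λ' τ u = b) :
    ∃ ψ : (Fin d → ℂ) →+ ↥(h.extension.π ⁻¹' {b}),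
      IsAdapted κ Total.base h.extension u ψ ∧
        ∀ a, (splitHom h.extension ψ a).1 = q (τ, u, a.1, a.2) := by
  subst hb
  let ψ : (Fin d → ℂ) →+ ↥(h.extension.π ⁻¹' {Total.cls Λ' τ u}) :=
    AddMonoidHom.comp (h.coordHom τ u) (AddMonoidHom.inl (Fin d → ℂ) ℂ)
  have hψ : ∀ v, (ψ v).1 = q (τ, u, v, 0) := fun _ => rfl
  refine ⟨ψ, ⟨⟨fun v => h.torusHom_val _ (hψ v), fun v x => ?_⟩, fun m => ?_⟩, fun a => ?_⟩
  · refine ContMDiffAt.comp (g := q) (f := fun x : ℂ => (τ, u, x • v, (0 : ℂ))) x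
      (h.localDiffeo _).contMDiffAt ?_
    exact contMDiffAt_const.prodMk (contMDiffAt_const.prodMk
      ((contMDiffAt_id.smul contMDiffAt_const).prodMk contMDiffAt_const))
  · apply Subtype.ext
    refine Eq.trans ?_ (h.incHom_val τ u _).symm
    rw [hψ, h.eq_iff]
    refine ⟨-m, by simp [latPt_neg, Total.cls], ?_⟩
    rw [Prod.snd_neg, dotZ_neg_left, show κ * -dotZ m.2 u + (κ * dotZ m.2 u - 0) = 0 by ring,
      expU_zero]
  · have := h.inc_add_val (ψ a.1) (hψ a.1) a.2
    rw [add_zero] at this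
    rw [splitHom_apply, add_comm]
    exact this

section Family

variable {ET : Type*} [NormedAddCommGroup ET] [NormedSpace ℂ ET]
  {T : Type*} [TopologicalSpace T] [ChartedSpace ET T]
  {EE : Type*} [NormedAddCommGroup EE] [NormedSpace ℂ EE]
  {E : Type*} [TopologicalSpace E] [ChartedSpace EE E] [IsManifold 𝓘(ℂ, EE) ω E]
  {f : T → Siegel d} {Y : TorusExtension ET T EE E (fun t => Λ (f t))}

include h in
/-- The point with coordinates `(τ, u, v, w)` depends only on the point `φ v + exp w` with `φ` a
splitting adapted to `u`. -/
lemma eq_of_splitHom_eq (hf : Continuous f) {t : T} {u u' : Fin d → ℂ}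
    {φ φ' : (Fin d → ℂ) →+ ↥(Y.π ⁻¹' {t})} (hφ : IsAdapted κ f Y u φ)
    (hφ' : IsAdapted κ f Y u' φ') {a a' : (Fin d → ℂ) × ℂ}
    (haa : splitHom Y φ a = splitHom Y φ' a') :
    q (f t, u, a.1, a.2) = q (f t, u', a'.1, a'.2) := by
  obtain ⟨n, rfl, hn⟩ := IsAdapted.exists_eq h.scale_ne hf h.mem_iff hφ hφ'
  have h1 : splitHom Y φ' a' = splitHom Y φ (a'.1, a'.2 + dualScale κ * dotZ n.2 a'.1) := by
    rw [splitHom_apply, splitHom_apply, hn, expU_add, ofMul_mul, map_add]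
    abel
  have h2 : splitHom Y φ ((a'.1, a'.2 + dualScale κ * dotZ n.2 a'.1) - a) = 0 := by
    rw [map_sub, ← h1, haa, sub_self]
  obtain ⟨m, hm, hm'⟩ := (hφ.splitHom_eq_zero_iff h.mem_iff _).1 h2
  rw [h.shift, h.eq_iff]
  exact ⟨m, hm, hm'⟩

/-- An isomorphism of extensions commutes with `inc` and with the projections, so it carries the
lattice character along unchanged. -/
lemma isAdapted_comp {t : T} {u : Fin d → ℂ} {φ : (Fin d → ℂ) →+ ↥(Y.π ⁻¹' {t})}
    (hφ : IsAdapted κ f Y u φ) {g : T → Total Λ'} (hg : (g t).base = f t)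
    (Ψ : PullbackIso Y h.extension g) :
    IsAdapted κ Total.base h.extension u ((Ψ.iso t : _ →+ ↥(h.extension.π ⁻¹' {g t})).comp φ) := by
  refine ⟨⟨fun v => Ψ.iso_proj t _ v (hφ.proj v), fun v => ?_⟩, fun m => ?_⟩
  · have : ∀ e : ↥(Y.π ⁻¹' {t}), (Ψ.iso (Y.π e.1) ⟨e.1, rfl⟩).1 = (Ψ.iso t e).1 := by
      rintro ⟨e, rfl⟩
      rfl
    refine (Ψ.holomorphic.comp (hφ.holomorphic v)).congr fun x => ?_
    exact (this _).symm
  · rw [hg]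
    change Ψ.iso t (φ _) = _
    rw [hφ.lattice, Ψ.iso_inc]

/-- The image of `φ` and the standard splitting are adapted splittings of the same fibre, so `u`
differs from the representative of `g t` by the dual lattice. -/
lemma eq_cls_of_pullbackIso {t : T} {u : Fin d → ℂ} {φ : (Fin d → ℂ) →+ ↥(Y.π ⁻¹' {t})}
    (hφ : IsAdapted κ f Y u φ) {g : T → Total Λ'} (hg : (g t).base = f t)
    (Ψ : PullbackIso Y h.extension g) : g t = Total.cls Λ' (f t) u := by
  obtain ⟨ψ, hψ, -⟩ := h.exists_adapted (Total.cls_rep (g t))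
  obtain ⟨n, rfl, -⟩ := IsAdapted.exists_eq h.scale_ne h.continuous_base h.mem_iff hψ
    (h.isAdapted_comp hφ hg Ψ)
  rw [← hg]
  conv_lhs => rw [← Total.cls_rep (g t)]
  exact cls_eq_iff.2 ((h.mem_dual_iff _ _).2 ⟨n, by abel⟩)

/-- Two isomorphisms carry `φ t` to splittings adapted to the same `u t`. Such a splitting is
unique, and together with `inc` it determines the isomorphism. -/
lemma subsingleton_pullbackIso {φ : ∀ t, (Fin d → ℂ) →+ ↥(Y.π ⁻¹' {t})} {u : T → Fin d → ℂ}
    (hφ : ∀ t, IsAdapted κ f Y (u t) (φ t)) {g : T → Total Λ'} (hg : ∀ t, (g t).base = f t) :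
    Subsingleton (PullbackIso Y h.extension g) := by
  refine ⟨fun Ψ Ψ' => ?_⟩
  have key : Ψ.iso = Ψ'.iso := by
    funext t
    ext e
    obtain ⟨a, rfl⟩ := splitHom_surjective (hφ t).toIsSplitting e
    obtain ⟨n, h1, h2⟩ := IsAdapted.exists_eq h.scale_ne h.continuous_base h.mem_iff
      (h.isAdapted_comp (hφ t) (hg t) Ψ) (h.isAdapted_comp (hφ t) (hg t) Ψ')
    obtain rfl := eq_zero_of_latPt_eq_zero h.dualScale_ne (left_eq_add.1 h1)
    have h3 := h2 a.1
    simp only [Prod.snd_zero, dotZ_zero_left, mul_zero, expU_zero, ofMul_one, map_zero,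
      add_zero] at h3
    rw [splitHom_apply, map_add, map_add, Ψ.iso_inc, Ψ'.iso_inc]
    exact congrArg (fun x => (x + _ : ↥(h.extension.π ⁻¹' {g t})).1) h3.symm
  cases Ψ
  cases Ψ'
  simp only at key
  subst key
  rfl

variable [FiniteDimensional ℂ ET] [IsManifold 𝓘(ℂ, ET) ω T] [FiniteDimensional ℂ EE]

-- The function `u` is chosen pointwise and need not be continuous, but its class agrees locally
-- with that of a holomorphic choice.
include h in
lemma contMDiff_cls_of_adapted (hf : ContMDiff 𝓘(ℂ, ET) 𝓘(ℂ, SymMat d) ω f)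
    {φ : ∀ t, (Fin d → ℂ) →+ ↥(Y.π ⁻¹' {t})} {u : T → Fin d → ℂ}
    (hφ : ∀ t, IsAdapted κ f Y (u t) (φ t)) :
    ContMDiff 𝓘(ℂ, ET) 𝓘(ℂ, SymMat d × (Fin d → ℂ)) ω fun t => Total.cls Λ' (f t) (u t) := by
  intro t₀
  obtain ⟨u', φ', hu', -, h'⟩ := exists_local_adapted h.scale_ne hf h.mem_iff Y t₀
  refine (ContMDiffAt.comp (g := fun x : Siegel d × (Fin d → ℂ) => Total.cls Λ' x.1 x.2)
    (f := fun t => (f t, u' t)) t₀ (h.cls_localDiffeo _).contMDiffAt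
    (hf.contMDiffAt.prodMk hu')).congr_of_eventuallyEq ?_
  filter_upwards [h'] with t ht
  obtain ⟨n, hn, -⟩ := IsAdapted.exists_eq h.scale_ne hf.continuous h.mem_iff (hφ t) ht
  exact cls_eq_iff.2 ((h.mem_dual_iff _ _).2 ⟨n, sub_eq_of_eq_add' hn⟩)

/-- Fibres with splittings adapted to the same `u` are isomorphic. Holomorphy is checked near a
point with a holomorphic family of adapted splittings in place of the given one; `eq_of_splitHom_eq`
allows the change. -/
lemma exists_pullbackIso (hf : ContMDiff 𝓘(ℂ, ET) 𝓘(ℂ, SymMat d) ω f)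
    {φ : ∀ t, (Fin d → ℂ) →+ ↥(Y.π ⁻¹' {t})} {u : T → Fin d → ℂ}
    (hφ : ∀ t, IsAdapted κ f Y (u t) (φ t)) :
    Nonempty (PullbackIso Y h.extension fun t => Total.cls Λ' (f t) (u t)) := by
  choose ψ hψ hψq using fun t => h.exists_adapted (τ := f t) (u := u t) rfl
  choose iso hiso using fun t => exists_equiv_of_adapted (Y := Y) (Y' := h.extension)
    h.mem_iff (t := t) rfl (hφ t) (hψ t)
  have hval : ∀ t (u' : Fin d → ℂ) (φ' : (Fin d → ℂ) →+ ↥(Y.π ⁻¹' {t})), IsAdapted κ f Y u' φ' →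
      ∀ a, (iso t (splitHom Y φ' a)).1 = q (f t, u', a.1, a.2) := by
    intro t u' φ' h' a
    obtain ⟨a', ha'⟩ := splitHom_surjective (hφ t).toIsSplitting (splitHom Y φ' a)
    rw [← ha', hiso, hψq]
    exact h.eq_of_splitHom_eq hf.continuous (hφ t) h' ha'
  have hdisc : ∀ t₀, ∀ᶠ p in 𝓝 (t₀, (0 : Fin d → ℂ)), p.2 ∈ Λ (f p.1) → p.2 = 0 := by
    intro t₀
    have hc : Continuous fun p : T × (Fin d → ℂ) => (f p.1, p.2) := by
      have := hf.continuous
      fun_prop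
    filter_upwards [(hc.tendsto (t₀, 0)).eventually (eventually_latPt_eq_zero h.scale_ne (f t₀))]
      with p hp hm
    exact hp ((h.mem_iff _ _).1 hm)
  refine ⟨⟨iso, fun t z => ?_, fun t e v hv => ?_, fun e₀ => ?_⟩⟩
  · obtain ⟨c, hc⟩ := expU_surjective z.toMul
    obtain rfl : z = Additive.ofMul (expU c) := by rw [hc]; rfl
    have := hiso t (0, c)
    simpa only [splitHom_apply, map_zero, zero_add] using this
  · obtain ⟨a, rfl⟩ := splitHom_surjective (hφ t).toIsSplitting e
    rw [splitHom_apply, map_add, (hφ t).proj, TorusExtension.proj_inc, add_zero] at hv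
    rw [hiso, splitHom_apply, map_add, TorusExtension.proj_inc, add_zero]
    exact ((hψ t).proj _).trans hv
  have hval' : ∀ {t} (x : ↥(Y.π ⁻¹' {t})), (iso (Y.π x.1) ⟨x.1, rfl⟩).1 = (iso t x).1 := by
    rintro t ⟨e, rfl⟩
    rfl
  obtain ⟨v₀, hv₀⟩ := QuotientAddGroup.mk_surjective (Y.proj (Y.π e₀) ⟨e₀, rfl⟩)
  obtain ⟨u', φ', hu', hφ', h'⟩ := exists_local_adapted h.scale_ne hf h.mem_iff Y (Y.π e₀)
  obtain ⟨s, -, -, hs⟩ := Y.exists_chart (Y.π e₀) v₀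
  obtain ⟨g, hg, hg0, hge⟩ := hs ⟨e₀, rfl⟩ hv₀.symm
  simp only at hg hg0 hge
  have ht : ContMDiffAt 𝓘(ℂ, EE) 𝓘(ℂ, ET) ω (fun e => (g e).1.1) e₀ :=
    contMDiffAt_fst.comp e₀ (contMDiffAt_fst.comp e₀ hg)
  have hv : ContMDiffAt 𝓘(ℂ, EE) 𝓘(ℂ, Fin d → ℂ) ω (fun e => (g e).1.2) e₀ :=
    contMDiffAt_snd.comp e₀ (contMDiffAt_fst.comp e₀ hg)
  have ht0 : (g e₀).1.1 = Y.π e₀ := by rw [hg0]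
  let a : ∀ e, ↥(Y.π ⁻¹' {(g e).1.1}) := fun e =>
    Y.inc (g e).1.1 (Additive.ofMul (g e).2) + s (g e).1
  -- The coordinate of `e` in `ℂˣ` relative to the splitting `φ'`; its logarithm will be the
  -- coordinate `w`.
  have hδ : ∀ e, ∃ z : ℂˣ, Y.proj (g e).1.1 (a e) = QuotientAddGroup.mk (g e).1.2 →
      IsAdapted κ f Y (u' (g e).1.1) (φ' (g e).1.1) →
      Y.inc (g e).1.1 (Additive.ofMul z) = a e - φ' (g e).1.1 (g e).1.2 := by
    intro e
    by_cases h1 : Y.proj (g e).1.1 (a e) = QuotientAddGroup.mk (g e).1.2 ∧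
      IsAdapted κ f Y (u' (g e).1.1) (φ' (g e).1.1)
    · obtain ⟨z, hz⟩ := TorusExtension.exists_inc_eq (Y := Y)
        (e := a e - φ' (g e).1.1 (g e).1.2) (by rw [map_sub, h1.1, h1.2.proj, sub_self])
      exact ⟨z, fun _ _ => hz⟩
    · exact ⟨1, fun h2 h3 => absurd ⟨h2, h3⟩ h1⟩
  choose δ hδ using hδ
  have hproj : ∀ᶠ e in 𝓝 e₀, Y.proj (g e).1.1 (a e) = QuotientAddGroup.mk (g e).1.2 := by
    filter_upwards [hge] with e he
    rw [map_add, TorusExtension.proj_inc, zero_add, he.2]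
  have hadp : ∀ᶠ e in 𝓝 e₀, IsAdapted κ f Y (u' (g e).1.1) (φ' (g e).1.1) := by
    have := ht.continuousAt.tendsto
    rw [ht0] at this
    exact this.eventually h'
  have hφe : ContMDiffAt 𝓘(ℂ, EE) 𝓘(ℂ, EE) ω (fun e => (φ' (g e).1.1 (g e).1.2).1) e₀ := by
    have h1 := hφ' v₀
    rw [show (Y.π e₀, v₀) = (g e₀).1 from hg0.symm] at h1
    exact ContMDiffAt.comp (g := fun p : T × (Fin d → ℂ) => (φ' p.1 p.2).1)
      (f := fun e => (g e).1) e₀ h1 (contMDiffAt_fst.comp e₀ hg)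
  -- Near `e₀` the point `a e` is `e` itself, regarded in the fibre over `(g e).1.1`.
  have hae : ContMDiffAt 𝓘(ℂ, EE) 𝓘(ℂ, EE) ω (fun e => (a e).1) e₀ := by
    refine contMDiffAt_id.congr_of_eventuallyEq ?_
    filter_upwards [hge] with e he
    exact he.1.symm
  have hδc : ContMDiffAt 𝓘(ℂ, EE) 𝓘(ℂ, ℂ) ω δ e₀ := by
    refine TorusExtension.contMDiffAt_of_inc (Y := Y) (t := fun e => (g e).1.1) hdisc
      ((Y.contMDiffAt_sub hae hφe).congr_of_eventuallyEq ?_)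
    filter_upwards [hproj, hadp] with e h1 h2
    rw [hδ e h1 h2]
  obtain ⟨l, hl, -, hlδ⟩ := exists_local_log (Complex.exp_log (δ e₀).ne_zero) hδc
  have hue : ContMDiffAt 𝓘(ℂ, EE) 𝓘(ℂ, Fin d → ℂ) ω (fun e => u' (g e).1.1) e₀ := by
    rw [← ht0] at hu'
    exact ContMDiffAt.comp (f := fun e => (g e).1.1) e₀ hu' ht
  have hfe : ContMDiffAt 𝓘(ℂ, EE) 𝓘(ℂ, SymMat d) ω (fun e => f (g e).1.1) e₀ :=
    ContMDiffAt.comp (f := fun e => (g e).1.1) e₀ hf.contMDiffAt ht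
  refine (ContMDiffAt.comp (g := q)
    (f := fun e => (f (g e).1.1, u' (g e).1.1, (g e).1.2, l e)) e₀ (h.localDiffeo _).contMDiffAt
    (hfe.prodMk (hue.prodMk (hv.prodMk hl)))).congr_of_eventuallyEq ?_
  filter_upwards [hge, hproj, hadp, hlδ] with e h1 h2 h3 h4
  have h5 : a e = splitHom Y (φ' (g e).1.1) ((g e).1.2, l e) := by
    rw [splitHom_apply, show expU (l e) = δ e from Units.ext h4, hδ e h2 h3]
    abel
  have h6 : ∀ x, e = x → (iso (Y.π e) ⟨e, rfl⟩).1 = (iso (Y.π x) ⟨x, rfl⟩).1 := by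
    rintro x rfl
    rfl
  rw [h6 (a e).1 h1.1, hval' (a e), h5]
  exact hval _ _ _ h3 _

end Family

theorem isUniversalExtension :
    IsUniversalExtension.{u} (Λ := Λ) (SymMat d) Total.base h.extension := by
  intro ET T EE E _ _ _ _ _ _ _ _ _ _ _ _ f hf Y
  have hex : ∀ t, ∃ (u : Fin d → ℂ) (φ : (Fin d → ℂ) →+ ↥(Y.π ⁻¹' {t})), IsAdapted κ f Y u φ := by
    intro t
    obtain ⟨u, φ, -, -, h'⟩ := exists_local_adapted h.scale_ne hf h.mem_iff Y t
    exact ⟨u t, φ t, h'.self_of_nhds⟩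
  choose u φ hφ using hex
  refine ⟨⟨fun t => Total.cls Λ' (f t) (u t), ⟨h.contMDiff_cls_of_adapted hf hφ, fun _ => rfl,
    h.exists_pullbackIso hf hφ⟩, ?_⟩, fun g hg => h.subsingleton_pullbackIso hφ hg⟩
  rintro g ⟨-, hg, ⟨Ψ⟩⟩
  funext t
  exact h.eq_cls_of_pullbackIso (hφ t) (hg t) Ψ

end PoincareChart

end Universality
end PoincareTorsor
end

noncomputable section
namespace PoincareTorsor
open Filter Topology

/-! ### Quotients by properly discontinuous actions -/

section QuotientManifold

set_option linter.unusedSectionVars false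

variable {EX : Type*} [NormedAddCommGroup EX] [NormedSpace ℂ EX] {HX : Type*} [TopologicalSpace HX]
  {I : ModelWithCorners ℂ EX HX} {X : Type*} [TopologicalSpace X] [ChartedSpace HX X]
  [IsManifold I ω X] {Y : Type*}

/-- The charts of the quotient of an open submanifold of a vector space. -/
lemma exists_openPartialHomeomorph_of_injOn [TopologicalSpace Y] [Nonempty X] {q : X → Y}
    (hq : Continuous q) (hqo : IsOpenMap q) {j : X → EX} (hj : IsOpenEmbedding j) {U : Set X}
    (hU : IsOpen U) (hinj : Set.InjOn q U) :
    ∃ e : OpenPartialHomeomorph Y EX, e.source = q '' U ∧ ∀ x ∈ U, e (q x) = j x := by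
  let p : OpenPartialHomeomorph X Y :=
    OpenPartialHomeomorph.ofContinuousOpen (hinj.toPartialEquiv q U) hq.continuousOn hqo hU
  refine ⟨p.symm.trans (hj.toOpenPartialHomeomorph j), ?_, fun x hx => ?_⟩
  · rw [OpenPartialHomeomorph.trans_source]
    simp only [IsOpenEmbedding.toOpenPartialHomeomorph_source, Set.preimage_univ, Set.inter_univ]
    rfl
  · have : p.symm (p x) = x := p.left_inv hx
    exact congrArg j this

/-- The quotient of an open submanifold of a vector space by a free and properly discontinuous
group action is a complex manifold. -/
theorem exists_isComplexQuotient [T2Space X] [SecondCountableTopology X] {q : X → Y} {G : Type*}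
    {act : G → X → X} (hq : Function.Surjective q) (hact : ∀ g, ContMDiff I I ω (act g))
    (hrel : ∀ x y, q x = q y ↔ ∃ g, y = act g x)
    (hfree : ∀ g x, act g x = x → ∀ y, act g y = y)
    (hprop : ∀ x y, ∃ S : Set G, S.Finite ∧ ∀ᶠ p in 𝓝 (x, y), ∀ g, p.2 = act g p.1 → g ∈ S)
    {j : X → EX} (hj : IsOpenEmbedding j) (hjc : ContMDiff I 𝓘(ℂ, EX) ω j) {ρ : EX → X}
    (hρj : ∀ x, ρ (j x) = x) (hρ : ∀ x, ContMDiffAt 𝓘(ℂ, EX) I ω ρ (j x)) :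
    ∃ (_ : TopologicalSpace Y) (_ : ChartedSpace EX Y), IsComplexQuotient (EY := EX) I q := by
  -- For the Hausdorff property: near two points of different orbits only finitely many elements
  -- could match, and each of them is excluded on a neighbourhood.
  have hpd : ∀ x y, (∀ g, act g x ≠ y) → ∀ᶠ p in 𝓝 (x, y), ∀ g, p.2 ≠ act g p.1 := by
    intro x y hxy
    obtain ⟨S, hS, h⟩ := hprop x y
    have h1 : ∀ᶠ p in 𝓝 (x, y), ∀ g ∈ S, p.2 ≠ act g p.1 := by
      refine (eventually_all_finite hS).2 fun g _ => ?_
      have hc : ContinuousAt (fun p : X × X => (p.2, act g p.1)) (x, y) := by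
        have := (hact g).continuous
        fun_prop
      exact hc.eventually (isClosed_diagonal.isOpen_compl.mem_nhds (hxy g).symm)
    filter_upwards [h, h1] with p h2 h3 g hg
    exact h3 g (h2 g hg) hg
  -- Of the finitely many candidates near `(x, x)`, those fixing `x` act trivially by `hfree`, and
  -- the others move `x` away from itself.
  have hnhd : ∀ x, ∃ U, IsOpen U ∧ x ∈ U ∧ Set.InjOn q U := by
    intro x
    obtain ⟨S, hS, h⟩ := hprop x x
    have h1 : ∀ᶠ p in 𝓝 (x, x), ∀ g ∈ S, p.2 = act g p.1 → p.1 = p.2 := by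
      refine (eventually_all_finite hS).2 fun g _ => ?_
      by_cases hg : act g x = x
      · exact Eventually.of_forall fun p hp => by rw [hp, hfree g x hg]
      · have hc : ContinuousAt (fun p : X × X => (p.2, act g p.1)) (x, x) := by
          have := (hact g).continuous
          fun_prop
        filter_upwards [hc.eventually (isClosed_diagonal.isOpen_compl.mem_nhds (Ne.symm hg))]
          with p hp hp'
        exact absurd hp' hp
    obtain ⟨U, V, hU, hxU, hV, hxV, hUV⟩ := mem_nhds_prod_iff'.1 (h.and h1)
    refine ⟨U ∩ V, hU.inter hV, ⟨hxU, hxV⟩, fun a ha b hb hab => ?_⟩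
    obtain ⟨g, hg⟩ := (hrel a b).1 hab
    obtain ⟨h2, h3⟩ := hUV (Set.mk_mem_prod ha.1 hb.2)
    exact h3 g (h2 g hg) hg
  let _ : TopologicalSpace Y := TopologicalSpace.coinduced q inferInstance
  have hqm : IsQuotientMap q := ⟨⟨rfl⟩, hq⟩
  have hqc : Continuous q := hqm.continuous
  have hqo : IsOpenMap q := by
    intro U hU
    rw [← hqm.isOpen_preimage]
    -- By `hrel` the saturation of an open set is a union of open preimages.
    have : q ⁻¹' (q '' U) = ⋃ g, act g ⁻¹' U := by
      ext x
      simp only [Set.mem_preimage, Set.mem_image, Set.mem_iUnion]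
      constructor
      · rintro ⟨x', hx', h⟩
        obtain ⟨g, rfl⟩ := (hrel x x').1 h.symm
        exact ⟨g, hx'⟩
      · rintro ⟨g, hg⟩
        exact ⟨_, hg, ((hrel _ _).2 ⟨g, rfl⟩).symm⟩
    rw [this]
    exact isOpen_iUnion fun g => hU.preimage (hact g).continuous
  have hchart : ∀ x, ∃ (e : OpenPartialHomeomorph Y EX) (U : Set X), IsOpen U ∧
      e.source = q '' U ∧ (∀ x ∈ U, e (q x) = j x) ∧ x ∈ U := by
    intro x
    obtain ⟨U, hU, hxU, hUi⟩ := hnhd x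
    have : Nonempty X := ⟨x⟩
    obtain ⟨e, he, he'⟩ := exists_openPartialHomeomorph_of_injOn hqc hqo hj hU hUi
    exact ⟨e, U, hU, he, he', hxU⟩
  choose c U hU hsrc hcq hmem using hchart
  have hsymm : ∀ y, ∀ x ∈ U y, (c y).symm (j x) = q x := by
    intro y x hx
    rw [← hcq y x hx]
    exact (c y).left_inv (by rw [hsrc]; exact ⟨x, hx, rfl⟩)
  have htar : ∀ y, (c y).target = j '' U y := by
    intro y
    rw [← (c y).image_source_eq_target, hsrc, Set.image_image]
    exact Set.image_congr fun x hx => hcq y x hx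
  let _ : ChartedSpace EX Y :=
    { atlas := Set.range c
      chartAt := fun y => c (hq y).choose
      mem_chart_source := fun y => by
        rw [hsrc]
        exact ⟨_, hmem _, (hq y).choose_spec⟩
      chart_mem_atlas := fun y => ⟨_, rfl⟩ }
  have hman : IsManifold 𝓘(ℂ, EX) ω Y := by
    refine isManifold_of_contDiffOn _ _ _ ?_
    rintro _ _ ⟨y, rfl⟩ ⟨y', rfl⟩
    simp only [modelWithCornersSelf_coe, modelWithCornersSelf_coe_symm, Function.id_comp,
      Function.comp_id, Set.preimage_id, Set.range_id, Set.inter_univ]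
    rintro b hb
    rw [OpenPartialHomeomorph.trans_source, OpenPartialHomeomorph.symm_source, htar] at hb
    obtain ⟨⟨x, hx, rfl⟩, hb⟩ := hb
    rw [Set.mem_preimage, hsymm y x hx, hsrc] at hb
    obtain ⟨x', hx', hxx'⟩ := hb
    obtain ⟨g, rfl⟩ := (hrel x x').1 hxx'.symm
    apply ContDiffAt.contDiffWithinAt
    rw [← contMDiffAt_iff_contDiffAt]
    -- A change of charts is locally the action of a single element, read through `j` and `ρ`.
    have h1 : ContMDiffAt 𝓘(ℂ, EX) 𝓘(ℂ, EX) ω (fun b => j (act g (ρ b))) (j x) :=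
      ContMDiffAt.comp (g := fun x => j (act g x)) (j x) (hjc.comp (hact g)).contMDiffAt (hρ x)
    refine h1.congr_of_eventuallyEq ?_
    have hUx : U y ∩ act g ⁻¹' U y' ∈ 𝓝 x :=
      ((hU y).inter ((hU y').preimage (hact g).continuous)).mem_nhds ⟨hx, hx'⟩
    filter_upwards [hj.isOpenMap.image_mem_nhds hUx] with b hb
    obtain ⟨x₁, ⟨h2, h3⟩, rfl⟩ := hb
    rw [hρj]
    change c y' ((c y).symm (j x₁)) = _
    rw [hsymm y x₁ h2, (hrel x₁ _).2 ⟨g, rfl⟩, hcq y' _ h3]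
  refine ⟨inferInstance, inferInstance, hman, ?_, hqm.secondCountableTopology hqo, hq, fun x => ?_⟩
  · refine ⟨fun y y' hyy' => ?_⟩
    obtain ⟨x, rfl⟩ := hq y
    obtain ⟨x', rfl⟩ := hq y'
    obtain ⟨V, V', hV, hxV, hV', hxV', hVV⟩ := mem_nhds_prod_iff'.1
      (hpd x x' fun g hg => hyy' ((hrel x x').2 ⟨g, hg.symm⟩))
    refine ⟨q '' V, q '' V', hqo V hV, hqo V' hV', ⟨x, hxV, rfl⟩, ⟨x', hxV', rfl⟩, ?_⟩
    rw [Set.disjoint_left]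
    rintro _ ⟨a, ha, rfl⟩ ⟨b, hb, hab⟩
    obtain ⟨g, hg⟩ := (hrel a b).1 hab.symm
    exact hVV (Set.mk_mem_prod ha hb) g hg
  · have hmax : c x ∈ IsManifold.maximalAtlas 𝓘(ℂ, EX) ω Y := IsManifold.subset_maximalAtlas ⟨x, rfl⟩
    have hqx : q x ∈ (c x).source := by rw [hsrc]; exact ⟨x, hmem x, rfl⟩
    have hnear : ∀ᶠ a in 𝓝 x, a ∈ U x := (hU x).mem_nhds (hmem x)
    have hcx : ContMDiffAt 𝓘(ℂ, EX) 𝓘(ℂ, EX) ω (c x) (q x) :=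
      contMDiffAt_of_mem_maximalAtlas hmax hqx
    have hcs : ContMDiffAt 𝓘(ℂ, EX) 𝓘(ℂ, EX) ω (c x).symm (j x) :=
      contMDiffAt_symm_of_mem_maximalAtlas hmax (by rw [htar]; exact ⟨x, hmem x, rfl⟩)
    refine isLocalDiffeomorphAt_of_inverse (g := fun y => ρ (c x y)) rfl ?_ ?_ ?_ ?_
    · refine (ContMDiffAt.comp x hcs hjc.contMDiffAt).congr_of_eventuallyEq ?_
      filter_upwards [hnear] with a ha
      exact (hsymm x a ha).symm
    · have h1 := hρ x
      rw [← hcq x x (hmem x)] at h1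
      exact ContMDiffAt.comp (q x) h1 hcx
    · filter_upwards [hnear] with a ha
      rw [hcq x a ha, hρj]
    · filter_upwards [(c x).open_source.mem_nhds hqx] with y hy
      rw [hsrc] at hy
      obtain ⟨a, ha, rfl⟩ := hy
      rw [hcq x a ha, hρj]

end QuotientManifold

/-! ### Complex structures on the families of tori and on the Heisenberg quotient -/

section Families

variable {d : ℕ}

lemma posDef_siegelOne : (Matrix.of fun i j : Fin d =>
    ((if i = j then Complex.I else 0 : ℂ)).im).PosDef := by
  have : (Matrix.of fun i j : Fin d => ((if i = j then Complex.I else 0 : ℂ)).im) = 1 := by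
    ext i j
    rcases eq_or_ne i j with rfl | h
    · simp
    · simp [h]
  rw [this]
  exact Matrix.PosDef.one

open Classical in
/-- A retraction of the symmetric matrices to the Siegel space. -/
def siegelRetract (τ : SymMat d) : Siegel d :=
  if h : τ ∈ Siegel d then ⟨τ, h⟩ else
    ⟨⟨fun i j => if i = j then Complex.I else 0, fun i j => by simp [eq_comm]⟩, posDef_siegelOne⟩

lemma siegelRetract_coe (τ : Siegel d) : siegelRetract τ.1 = τ := dif_pos τ.2

lemma contMDiffAt_siegelRetract (τ : Siegel d) :
    ContMDiffAt 𝓘(ℂ, SymMat d) 𝓘(ℂ, SymMat d) ω (siegelRetract : SymMat d → Siegel d) τ.1 := by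
  have h : ∀ᶠ a in 𝓝 τ.1, (siegelRetract a).1 = a := by
    filter_upwards [(Siegel d).isOpen.mem_nhds τ.2] with a ha
    exact congrArg Subtype.val (siegelRetract_coe ⟨a, ha⟩)
  rw [contMDiffAt_iff_target]
  refine ⟨?_, contMDiffAt_id.congr_of_eventuallyEq h⟩
  rw [IsInducing.subtypeVal.continuousAt_iff]
  exact continuousAt_id.congr (h.mono fun _ => Eq.symm)

lemma isOpenEmbedding_siegel_coe : IsOpenEmbedding (fun τ : Siegel d => τ.1) :=
  (Siegel d).isOpen.isOpenEmbedding_subtypeVal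

/-- The lower bound for lattice points, uniform for nearby `τ`, bounds `m` in terms of `v`. -/
lemma eventually_latPt_eq_finite {κ : ℂ} (hκ : κ ≠ 0) {M : Type*} [TopologicalSpace M]
    {τ : M → Siegel d} {v : M → Fin d → ℂ} {x : M} (hτ : ContinuousAt τ x)
    (hv : ContinuousAt v x) : ∃ S : Set ((Fin d → ℤ) × (Fin d → ℤ)), S.Finite ∧
      ∀ᶠ p in 𝓝 x, ∀ m, v p = latPt κ (τ p) m → m ∈ S := by
  obtain ⟨c, hc, h⟩ := exists_le_norm_latPt hκ (τ x)
  refine ⟨Metric.closedBall 0 ((‖v x‖ + 1) / c), (isCompact_closedBall _ _).finite_of_discrete, ?_⟩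
  filter_upwards [hτ.eventually h, hv.norm.eventually (gt_mem_nhds (lt_add_one ‖v x‖))]
    with p h1 h2 m hm
  rw [mem_closedBall_zero_iff, le_div_iff₀ hc, mul_comm]
  exact (h1 m).trans (by rw [← hm]; exact h2.le)

lemma eventually_int_eq_finite {M : Type*} [TopologicalSpace M] {a : M → ℂ} {x : M}
    (ha : ContinuousAt a x) : ∃ S : Set ℤ, S.Finite ∧ ∀ᶠ p in 𝓝 x, ∀ z : ℤ, a p = z → z ∈ S := by
  refine ⟨Metric.closedBall 0 (‖a x‖ + 1), (isCompact_closedBall _ _).finite_of_discrete, ?_⟩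
  filter_upwards [ha.norm.eventually (gt_mem_nhds (lt_add_one ‖a x‖))] with p h2 z hz
  rw [mem_closedBall_zero_iff, ← Int.norm_cast_real, ← Complex.norm_real, Complex.ofReal_intCast,
    ← hz]
  exact h2.le

/-- The families of complex tori over the Siegel space are complex manifolds. -/
theorem exists_isComplexQuotient_cls {κ : ℂ} (hκ : κ ≠ 0) {Λ : Siegel d → AddSubgroup (Fin d → ℂ)}
    (hΛ : ∀ τ v, v ∈ Λ τ ↔ ∃ m, v = latPt κ τ m) :
    ∃ (_ : TopologicalSpace (Total Λ)) (_ : ChartedSpace (SymMat d × (Fin d → ℂ)) (Total Λ)),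
      IsComplexQuotient (EY := SymMat d × (Fin d → ℂ)) (famModel d)
        (fun x : Siegel d × (Fin d → ℂ) => Total.cls Λ x.1 x.2) := by
  refine exists_isComplexQuotient
    (act := fun (m : (Fin d → ℤ) × (Fin d → ℤ)) (x : Siegel d × (Fin d → ℂ)) =>
      (x.1, x.2 + latPt κ x.1 m))
    (j := fun x => (x.1.1, x.2)) (ρ := fun x => (siegelRetract x.1, x.2)) ?_ ?_ ?_ ?_ ?_ ?_ ?_ ?_ ?_
  · intro b
    exact ⟨(b.base, b.rep), b.cls_rep⟩
  · intro m x
    exact contMDiffAt_fst.prodMk (contMDiffAt_snd.add (contMDiffAt_latPt κ m contMDiffAt_fst))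
  · rintro ⟨τ, v⟩ ⟨τ', v'⟩
    rw [cls_eq_cls_iff, hΛ]
    simp only [Prod.mk.injEq, exists_and_left, sub_eq_iff_eq_add']
    exact and_congr_left fun _ => eq_comm
  · rintro m ⟨τ, v⟩ h
    obtain rfl := eq_zero_of_latPt_eq_zero hκ (add_eq_left.1 (Prod.mk.inj h).2)
    intro y
    rw [latPt_zero, add_zero]
  · intro x y
    obtain ⟨S, hS, h⟩ := eventually_latPt_eq_finite hκ (x := (x, y))
      (τ := fun p : (Siegel d × (Fin d → ℂ)) × (Siegel d × (Fin d → ℂ)) => p.1.1)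
      (v := fun p => p.2.2 - p.1.2) (by fun_prop) (by fun_prop)
    refine ⟨S, hS, ?_⟩
    filter_upwards [h] with p hp m hm
    exact hp m (by rw [hm]; simp)
  · exact isOpenEmbedding_siegel_coe.prodMap .id
  · rw [modelWithCornersSelf_prod, ← chartedSpaceSelf_prod]
    exact (contMDiff_siegel_coe.comp contMDiff_fst).prodMk contMDiff_snd
  · exact fun x => Prod.ext (siegelRetract_coe _) rfl
  · intro x
    rw [modelWithCornersSelf_prod, ← chartedSpaceSelf_prod]
    exact (ContMDiffAt.comp (f := Prod.fst) (x.1.1, x.2) (contMDiffAt_siegelRetract x.1)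
      contMDiffAt_fst).prodMk contMDiffAt_snd

lemma contMDiff_moveCoord (κ : ℂ) (g : ((Fin d → ℤ) × (Fin d → ℤ)) × ((Fin d → ℤ) × (Fin d → ℤ)) × ℤ) :
    ContMDiff (coordModel d) (coordModel d) ω (moveCoord κ g) := by
  intro x
  have hτ : ContMDiffAt (coordModel d) 𝓘(ℂ, SymMat d) ω (fun x : Coord d => x.1) x :=
    contMDiffAt_fst
  have hu : ContMDiffAt (coordModel d) 𝓘(ℂ, Fin d → ℂ) ω (fun x : Coord d => x.2.1) x :=
    contMDiffAt_fst.comp x contMDiffAt_snd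
  have hv : ContMDiffAt (coordModel d) 𝓘(ℂ, Fin d → ℂ) ω (fun x : Coord d => x.2.2.1) x :=
    contMDiffAt_fst.comp x (contMDiffAt_snd.comp x contMDiffAt_snd)
  have hw : ContMDiffAt (coordModel d) 𝓘(ℂ, ℂ) ω (fun x : Coord d => x.2.2.2) x :=
    contMDiffAt_snd.comp x (contMDiffAt_snd.comp x contMDiffAt_snd)
  have hu' := hu.add (contMDiffAt_latPt (dualScale κ) g.2.1 hτ)
  exact hτ.prodMk (hu'.prodMk ((hv.add (contMDiffAt_latPt κ g.1 hτ)).prodMk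
    (((hw.sub (contMDiffAt_const.mul (contMDiffAt_dotZ _ hv))).sub
      (contMDiffAt_const.mul (contMDiffAt_dotZ _ hu'))).add contMDiffAt_const)))

lemma eq_zero_of_moveCoord_eq {κ : ℂ} (hκ : κ ≠ 0)
    {g : ((Fin d → ℤ) × (Fin d → ℤ)) × ((Fin d → ℤ) × (Fin d → ℤ)) × ℤ} {x : Coord d}
    (h : moveCoord κ g x = x) : g = 0 := by
  obtain ⟨m, n, z⟩ := g
  obtain ⟨τ, u, v, w⟩ := x
  simp only [moveCoord, Prod.mk.injEq, true_and] at h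
  obtain ⟨h1, h2, h3⟩ := h
  obtain rfl := eq_zero_of_latPt_eq_zero (div_ne_zero Complex.two_pi_I_ne_zero hκ)
    (add_eq_left.1 h1)
  obtain rfl := eq_zero_of_latPt_eq_zero hκ (add_eq_left.1 h2)
  have : (z : ℂ) * (2 * Real.pi * Complex.I) = 0 := by simpa [dotZ_zero_left] using h3
  have hz : z = 0 := by simpa [Complex.two_pi_I_ne_zero] using this
  rw [hz]
  rfl

lemma moveCoord_zero (κ : ℂ) (x : Coord d) : moveCoord κ 0 x = x := by
  simp [moveCoord, latPt_zero, dotZ_zero_left]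

/-- The differences of the `v` and of the `u` bound the two lattice components. For each of the
finitely many pairs left, `z` is the value of a continuous function of the two points, hence locally
bounded. -/
lemma eventually_moveCoord_eq_finite {κ : ℂ} (hκ : κ ≠ 0) (x y : Coord d) :
    ∃ S : Set (((Fin d → ℤ) × (Fin d → ℤ)) × ((Fin d → ℤ) × (Fin d → ℤ)) × ℤ), S.Finite ∧
      ∀ᶠ p in 𝓝 (x, y), ∀ g, p.2 = moveCoord κ g p.1 → g ∈ S := by
  obtain ⟨S₁, hS₁, h₁⟩ := eventually_latPt_eq_finite hκ (x := (x, y))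
    (τ := fun p : Coord d × Coord d => p.1.1)
    (v := fun p => p.2.2.2.1 - p.1.2.2.1) (by fun_prop) (by fun_prop)
  obtain ⟨S₂, hS₂, h₂⟩ := eventually_latPt_eq_finite (div_ne_zero Complex.two_pi_I_ne_zero hκ)
    (x := (x, y)) (τ := fun p : Coord d × Coord d => p.1.1)
    (v := fun p => p.2.2.1 - p.1.2.1) (by fun_prop) (by fun_prop)
  have h₃ : ∀ mn : ((Fin d → ℤ) × (Fin d → ℤ)) × ((Fin d → ℤ) × (Fin d → ℤ)),
      ∃ S : Set ℤ, S.Finite ∧ ∀ᶠ p : Coord d × Coord d in 𝓝 (x, y), ∀ z : ℤ,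
        p.2 = moveCoord κ (mn.1, mn.2, z) p.1 → z ∈ S := by
    intro mn
    have hc : Continuous fun p : Coord d × Coord d =>
        (p.2.2.2.2 - (moveCoord κ (mn.1, mn.2, 0) p.1).2.2.2) / (2 * Real.pi * Complex.I) := by
      have h1 : Continuous fun x : Coord d => x.2.2.2 :=
        continuous_snd.comp (continuous_snd.comp continuous_snd)
      exact ((h1.comp continuous_snd).sub (h1.comp ((contMDiff_moveCoord κ
        (mn.1, mn.2, 0)).continuous.comp continuous_fst))).div_const _
    obtain ⟨S, hS, h⟩ := eventually_int_eq_finite hc.continuousAt (x := (x, y))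
    refine ⟨S, hS, ?_⟩
    filter_upwards [h] with p hp z hz
    refine hp z ?_
    rw [hz, div_eq_iff Complex.two_pi_I_ne_zero]
    simp only [moveCoord]
    push_cast
    ring
  choose S hS h₃ using h₃
  refine ⟨(fun a : (((Fin d → ℤ) × (Fin d → ℤ)) × ((Fin d → ℤ) × (Fin d → ℤ))) × ℤ =>
    (a.1.1, a.1.2, a.2)) '' ⋃ mn ∈ S₁ ×ˢ S₂, {mn} ×ˢ S mn,
    ((hS₁.prod hS₂).biUnion fun mn _ => (Set.finite_singleton mn).prod (hS mn)).image _, ?_⟩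
  filter_upwards [h₁, h₂, (eventually_all_finite (hS₁.prod hS₂)).2 fun mn _ => h₃ mn]
    with p h1 h2 h3
  rintro ⟨m, n, z⟩ hg
  have hm : m ∈ S₁ := h1 m (by rw [hg]; simp [moveCoord])
  have hn : n ∈ S₂ := h2 n (by rw [hg]; simp [moveCoord])
  refine ⟨((m, n), z), Set.mem_biUnion (Set.mk_mem_prod hm hn) ⟨rfl, ?_⟩, rfl⟩
  exact h3 (m, n) (Set.mk_mem_prod hm hn) z hg

/-- The quotient of `ℍ_d × M_{1,d}(ℂ) × M_{d,1}(ℂ) × ℂ` by the Heisenberg group is a complex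
manifold. -/
theorem exists_isComplexQuotient_moveCoord {κ : ℂ} (hκ : κ ≠ 0) {P : Type*} {q : Coord d → P}
    (hq : Function.Surjective q) (hrel : ∀ x y, q x = q y ↔ ∃ g, y = moveCoord κ g x) :
    ∃ (_ : TopologicalSpace P) (_ : ChartedSpace (CoordSpace d) P),
      IsComplexQuotient (EY := CoordSpace d) (coordModel d) q := by
  refine exists_isComplexQuotient (act := moveCoord κ) (j := fun x => (x.1.1, x.2))
    (ρ := fun x => (siegelRetract x.1, x.2)) hq (contMDiff_moveCoord κ) hrel
    (fun g x h y => by rw [eq_zero_of_moveCoord_eq hκ h, moveCoord_zero])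
    (eventually_moveCoord_eq_finite hκ) ?_ ?_ ?_ ?_
  · exact isOpenEmbedding_siegel_coe.prodMap .id
  · exact (contMDiff_siegel_coe.comp contMDiff_fst).prodMk_space
      ((contMDiff_fst.comp contMDiff_snd).prodMk_space
        ((contMDiff_fst.comp (contMDiff_snd.comp contMDiff_snd)).prodMk_space
          (contMDiff_snd.comp (contMDiff_snd.comp contMDiff_snd))))
  · exact fun x => Prod.ext (siegelRetract_coe _) rfl
  · intro x
    refine (ContMDiffAt.comp (f := Prod.fst) (x.1.1, x.2) (contMDiffAt_siegelRetract x.1)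
      contDiff_fst.contMDiff.contMDiffAt).prodMk ?_
    exact (contDiff_fst.comp contDiff_snd).contMDiff.contMDiffAt.prodMk
      ((contDiff_fst.comp (contDiff_snd.comp contDiff_snd)).contMDiff.contMDiffAt.prodMk
        (contDiff_snd.comp (contDiff_snd.comp contDiff_snd)).contMDiff.contMDiffAt)

end Families
end PoincareTorsor
end

noncomputable section
namespace PoincareTorsor
open Filter Topology

/-! ### Linear coordinates on the complexified lattice -/

section Coordinates

variable {d : ℕ}

/-- The coordinates `(a, b, b', c)` of a vector of `M_ℂ`. -/
abbrev VecCoord (d : ℕ) : Type := ℂ × (Fin d → ℂ) × (Fin d → ℂ) × ℂ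

/-- The coordinates of a lattice point. -/
def latCoord : Lat d →ₗ[ℤ] VecCoord d :=
  (AddMonoidHom.mk' (fun m : Lat d => (((m.1 : ℂ), fun j => (m.2.1 (Sum.inl j) : ℂ),
    fun j => (m.2.1 (Sum.inr j) : ℂ), (m.2.2 : ℂ)) : VecCoord d)) fun m m' => by
      ext <;> simp).toIntLinearMap

lemma latCoord_apply (m : Lat d) : latCoord m = ((m.1 : ℂ), fun j => (m.2.1 (Sum.inl j) : ℂ),
    fun j => (m.2.1 (Sum.inr j) : ℂ), (m.2.2 : ℂ)) := rfl

/-- The coordinates of a vector of `M_ℂ`. -/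
def coordL : Cplx (Lat d) →ₗ[ℂ] VecCoord d := LinearMap.liftBaseChange ℂ latCoord

lemma coordL_tmul (z : ℂ) (m : Lat d) : coordL (z ⊗ₜ m) = z • latCoord m :=
  LinearMap.liftBaseChange_tmul ..

lemma coe_tateGen : ((tateGen : Tate 1) : ℂ) = 2 * Real.pi * Complex.I := rfl

lemma exists_zsmul_tateGen (t : Tate 1) : ∃ k : ℤ, t = k • tateGen := by
  obtain ⟨t, k, hk⟩ := t
  refine ⟨k, Subtype.ext ?_⟩
  simpa [tateGen] using hk.symm

lemma coordL_vec (a : ℂ) (b b' : Fin d → ℂ) (c : ℂ) : coordL (vec d a b b' c) = (a, b, b', c) := by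
  simp only [vec, map_add, map_sum, coordL_tmul, latCoord_apply, coe_tateGen]
  ext i
  · simp only [Prod.fst_add, Prod.smul_fst, Prod.fst_sum, smul_eq_mul]
    rw [mul_assoc, inv_mul_cancel₀ Complex.two_pi_I_ne_zero]
    simp
  · simp [Prod.snd_sum, Prod.fst_sum, Pi.single_apply]
  · simp [Prod.snd_sum, Prod.fst_sum, Pi.single_apply]
  · simp [Prod.snd_sum]

lemma vec_add (a a' : ℂ) (b b' e e' : Fin d → ℂ) (c c' : ℂ) :
    vec d (a + a') (b + e) (b' + e') (c + c') = vec d a b b' c + vec d a' e e' c' := by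
  simp only [vec, add_mul, TensorProduct.add_tmul, Pi.add_apply, Finset.sum_add_distrib]
  abel

lemma vec_smul (z a : ℂ) (b b' : Fin d → ℂ) (c : ℂ) :
    vec d (z * a) (z • b) (z • b') (z * c) = z • vec d a b b' c := by
  simp only [vec, smul_add, TensorProduct.smul_tmul', Finset.smul_sum, smul_eq_mul, Pi.smul_apply,
    mul_assoc]

/-- The vector with given coordinates. -/
def vecL : VecCoord d →ₗ[ℂ] Cplx (Lat d) where
  toFun x := vec d x.1 x.2.1 x.2.2.1 x.2.2.2
  map_add' _ _ := vec_add ..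
  map_smul' _ _ := vec_smul ..

/-- Integers pass through the tensor product, and a point of `ℤ(1)` is an integral multiple of
`2πi`, which cancels the factor in `e₀`. -/
lemma vec_latCoord (m : Lat d) : vecL (latCoord m) = (1 : ℂ) ⊗ₜ[ℤ] m := by
  obtain ⟨t, f, c⟩ := m
  obtain ⟨k, rfl⟩ := exists_zsmul_tateGen t
  have hz : ∀ (k : ℤ) (m : Lat d), (k : ℂ) ⊗ₜ[ℤ] m = (1 : ℂ) ⊗ₜ[ℤ] (k • m) := by
    intro k m
    rw [← TensorProduct.smul_tmul, zsmul_eq_mul, mul_one]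
  change vec d _ _ _ _ = _
  simp only [latCoord_apply, vec]
  have h1 : (((k • tateGen : Tate 1) : ℂ)) * (2 * (Real.pi : ℂ) * Complex.I)⁻¹ = k := by
    rw [AddSubgroupClass.coe_zsmul, coe_tateGen, zsmul_eq_mul, mul_assoc,
      mul_inv_cancel₀ Complex.two_pi_I_ne_zero, mul_one]
  simp only [h1, hz, ← TensorProduct.tmul_sum, ← TensorProduct.tmul_add]
  congr 1
  have h2 : ∑ j, f (Sum.inl j) • ((0, Pi.single (Sum.inl j) 1, 0) : Lat d) +
      ∑ j, f (Sum.inr j) • ((0, Pi.single (Sum.inr j) 1, 0) : Lat d) = (0, f, 0) := by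
    rw [← Fintype.sum_sum_type fun i => f i • ((0, Pi.single i 1, 0) : Lat d)]
    refine Prod.ext ?_ (Prod.ext ?_ ?_)
    · simp [Prod.fst_sum]
    · ext i
      rcases i with i | i <;> simp [Prod.fst_sum, Prod.snd_sum, Pi.single_apply]
    · simp [Prod.snd_sum]
  rw [add_assoc (k • _), h2]
  simp

lemma vecL_coordL (x : Cplx (Lat d)) : vecL (coordL x) = x := by
  induction x using TensorProduct.induction_on with
  | zero => simp
  | tmul z m => rw [coordL_tmul, map_smul, vec_latCoord, TensorProduct.smul_tmul', smul_eq_mul, mul_one]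
  | add x y hx hy => rw [map_add, map_add, hx, hy]

/-- The coordinates on `M_ℂ`. -/
def coordEquiv (d : ℕ) : Cplx (Lat d) ≃ₗ[ℂ] VecCoord d :=
  LinearEquiv.ofLinearMap coordL vecL (LinearMap.ext fun _ => coordL_vec ..)
    (LinearMap.ext vecL_coordL)

lemma coordEquiv_vec (a : ℂ) (b b' : Fin d → ℂ) (c : ℂ) :
    coordEquiv d (vec d a b b' c) = (a, b, b', c) := coordL_vec ..

lemma coordEquiv_tmul (z : ℂ) (m : Lat d) : coordEquiv d (z ⊗ₜ m) = z • latCoord m :=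
  coordL_tmul ..

lemma vec_coordEquiv (x : Cplx (Lat d)) : vec d (coordEquiv d x).1 (coordEquiv d x).2.1
    (coordEquiv d x).2.2.1 (coordEquiv d x).2.2.2 = x := vecL_coordL x

lemma vec_inj {a a' : ℂ} {b b' e e' : Fin d → ℂ} {c c' : ℂ}
    (h : vec d a b e c = vec d a' b' e' c') : a = a' ∧ b = b' ∧ e = e' ∧ c = c' := by
  have := congrArg (coordEquiv d) h
  simpa only [coordEquiv_vec, Prod.mk.injEq] using this

lemma exists_vec (x : Cplx (Lat d)) : ∃ a b b' c, x = vec d a b b' c :=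
  ⟨_, _, _, _, (vec_coordEquiv x).symm⟩

/-- Complex conjugation in coordinates. -/
lemma coordEquiv_cconj (x : Cplx (Lat d)) : coordEquiv d (cconj (Lat d) x) =
    (-star (coordEquiv d x).1, star (coordEquiv d x).2.1, star (coordEquiv d x).2.2.1,
      star (coordEquiv d x).2.2.2) := by
  induction x using TensorProduct.induction_on with
  | zero => simp only [map_zero, Prod.fst_zero, Prod.snd_zero, star_zero, neg_zero]; rfl
  | tmul z m =>
    have : cconj (Lat d) (z ⊗ₜ m) = (star z) ⊗ₜ m := rfl
    rw [this, coordEquiv_tmul, coordEquiv_tmul, latCoord_apply]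
    obtain ⟨k, hk⟩ := exists_zsmul_tateGen m.1
    -- Points of `ℤ(1)` are imaginary numbers, while conjugation on `M_ℂ` fixes them as lattice
    -- points; hence the sign in the first coordinate.
    have h1 : star ((m.1 : ℂ)) = -(m.1 : ℂ) := by
      rw [hk, AddSubgroupClass.coe_zsmul, coe_tateGen, zsmul_eq_mul]
      simp
    ext i
    · simp only [Prod.smul_fst, smul_eq_mul, star_mul', h1]
      ring
    all_goals simp
  | add x y hx hy =>
    rw [map_add, map_add, hx, hy, map_add]
    simp only [Prod.mk_add_mk, Prod.fst_add, Prod.snd_add, star_add, neg_add]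

lemma cconj_baseChange {H H' : Type} [AddCommGroup H] [AddCommGroup H'] (f : H →ₗ[ℤ] H')
    (x : Cplx H) : cconj H' (f.baseChange ℂ x) = f.baseChange ℂ (cconj H x) := by
  induction x using TensorProduct.induction_on with
  | zero => simp
  | tmul z m => rfl
  | add x y hx hy => simp only [map_add, hx, hy]

lemma cconj_cconj {H : Type} [AddCommGroup H] (x : Cplx H) : cconj H (cconj H x) = x := by
  induction x using TensorProduct.induction_on with
  | zero => simp
  | tmul z m =>
    change (star (star z)) ⊗ₜ m = _
    rw [star_star]
  | add x y hx hy => simp only [map_add, hx, hy]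

end Coordinates

/-! ### The weight-graded pieces in coordinates -/

section Graded

variable {d : ℕ}

/-- The endomorphism of `M` acting by scalars on the three summands. -/
def diagHom (d : ℕ) (e₁ e₂ e₃ : ℤ) : Lat d →ₗ[ℤ] Lat d :=
  LinearMap.prodMap (e₁ • LinearMap.id) (LinearMap.prodMap (e₂ • LinearMap.id) (e₃ • LinearMap.id))

lemma diagHom_apply (e₁ e₂ e₃ : ℤ) (m : Lat d) :
    diagHom d e₁ e₂ e₃ m = (e₁ • m.1, e₂ • m.2.1, e₃ • m.2.2) := rfl

lemma coordEquiv_diagHom (e₁ e₂ e₃ : ℤ) (x : Cplx (Lat d)) :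
    coordEquiv d ((diagHom d e₁ e₂ e₃).baseChange ℂ x) = ((e₁ : ℂ) * (coordEquiv d x).1,
      (e₂ : ℂ) • (coordEquiv d x).2.1, (e₂ : ℂ) • (coordEquiv d x).2.2.1,
      (e₃ : ℂ) * (coordEquiv d x).2.2.2) := by
  induction x using TensorProduct.induction_on with
  | zero => simp only [map_zero, Prod.fst_zero, Prod.snd_zero, smul_zero, mul_zero]; rfl
  | tmul z m =>
    rw [LinearMap.baseChange_tmul, coordEquiv_tmul, coordEquiv_tmul, diagHom_apply, latCoord_apply,
      latCoord_apply]
    ext i <;> simp <;> ring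
  | add x y hx hy =>
    rw [map_add, map_add, hx, hy, map_add]
    ext i <;> simp [mul_add]

/-- The projection of `M` to the summand of weight `n`. -/
def weightProj (d : ℕ) (n : ℤ) : Lat d →ₗ[ℤ] Lat d :=
  diagHom d (if n = -2 then 1 else 0) (if n = -1 then 1 else 0) (if n = 0 then 1 else 0)

lemma mem_weight {n : ℤ} {m : Lat d} : m ∈ weight d n ↔
    (n < -2 → m.1 = 0) ∧ (n < -1 → m.2.1 = 0) ∧ (n < 0 → m.2.2 = 0) := Iff.rfl

lemma weightProj_mem (n : ℤ) (m : Lat d) : weightProj d n m ∈ weight d n := by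
  refine ⟨fun h => ?_, fun h => ?_, fun h => ?_⟩ <;>
    simp only [weightProj, diagHom_apply]
  · rw [if_neg (by omega), zero_smul]
  · rw [if_neg (by omega), zero_smul]
  · rw [if_neg (by omega), zero_smul]

/-- The splitting of the weight filtration on the graded pieces. -/
def grLift (d : ℕ) (n : ℤ) : Gr (weight d) n →ₗ[ℤ] Lat d :=
  Submodule.liftQ _ (weightProj d n ∘ₗ (weight d n).subtype) (by
    rintro ⟨m, hm⟩ h
    have h' : m ∈ weight d (n - 1) := h
    rw [mem_weight] at h'
    rw [LinearMap.mem_ker]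
    change weightProj d n m = 0
    simp only [weightProj, diagHom_apply]
    refine Prod.ext ?_ (Prod.ext ?_ ?_) <;> simp only [ite_smul, one_smul, zero_smul] <;>
      split_ifs with hn <;> try rfl
    · exact h'.1 (by omega)
    · exact h'.2.1 (by omega)
    · exact h'.2.2 (by omega))

lemma grLift_mk (n : ℤ) (m : ↥(weight d n)) :
    grLift d n (Submodule.Quotient.mk m) = weightProj d n m.1 := rfl

/-- The projection of `M` to a graded piece. -/
def toGr (d : ℕ) (n : ℤ) : Lat d →ₗ[ℤ] Gr (weight d) n :=
  ((weight d (n - 1)).submoduleOf (weight d n)).mkQ ∘ₗ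
    (weightProj d n).codRestrict (weight d n) (weightProj_mem n)

lemma toGr_grLift (n : ℤ) (x : Gr (weight d) n) : toGr d n (grLift d n x) = x := by
  obtain ⟨m, rfl⟩ := Submodule.Quotient.mk_surjective _ x
  obtain ⟨m, hm⟩ := m
  rw [mem_weight] at hm
  rw [grLift_mk]
  refine (Submodule.Quotient.eq _).2 ?_
  change weightProj d n (weightProj d n m) - m ∈ weight d (n - 1)
  simp only [weightProj, diagHom_apply]
  refine ⟨fun h => ?_, fun h => ?_, fun h => ?_⟩ <;> simp only [Prod.fst_sub, Prod.snd_sub] <;>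
    split_ifs with hn <;> simp only [one_smul, zero_smul, sub_self, zero_sub, neg_eq_zero]
  · exact hm.1 (by omega)
  · exact hm.2.1 (by omega)
  · exact hm.2.2 (by omega)

/-- The coordinates on the complexification of a graded piece. -/
def grCoord (d : ℕ) (n : ℤ) : Cplx (Gr (weight d) n) →ₗ[ℂ] VecCoord d :=
  (coordEquiv d : Cplx (Lat d) →ₗ[ℂ] VecCoord d) ∘ₗ (grLift d n).baseChange ℂ

lemma grCoord_apply (n : ℤ) (x : Cplx (Gr (weight d) n)) :
    grCoord d n x = coordEquiv d ((grLift d n).baseChange ℂ x) := rfl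

lemma toGr_grLift_baseChange (n : ℤ) (x : Cplx (Gr (weight d) n)) :
    (toGr d n).baseChange ℂ ((grLift d n).baseChange ℂ x) = x := by
  rw [← LinearMap.comp_apply, ← LinearMap.baseChange_comp,
    show toGr d n ∘ₗ grLift d n = LinearMap.id from LinearMap.ext (toGr_grLift n),
    LinearMap.baseChange_id]
  rfl

lemma grCoord_injective (n : ℤ) : Function.Injective (grCoord d n) := by
  refine (coordEquiv d).injective.comp ?_
  exact Function.LeftInverse.injective (toGr_grLift_baseChange n)

lemma grLift_toGr (n : ℤ) (m : Lat d) : grLift d n (toGr d n m) = weightProj d n m := by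
  change weightProj d n (weightProj d n m) = _
  simp only [weightProj, diagHom_apply]
  refine Prod.ext ?_ (Prod.ext ?_ ?_) <;> simp only <;> split_ifs <;> simp

lemma exists_grCoord (n : ℤ) (a : ℂ) (b b' : Fin d → ℂ) (c : ℂ) :
    ∃ x, grCoord d n x = (if n = -2 then a else 0, if n = -1 then b else 0,
      if n = -1 then b' else 0, if n = 0 then c else 0) := by
  refine ⟨(toGr d n).baseChange ℂ (vec d a b b' c), ?_⟩
  rw [grCoord_apply, ← LinearMap.comp_apply, ← LinearMap.baseChange_comp,
    show grLift d n ∘ₗ toGr d n = weightProj d n from LinearMap.ext (grLift_toGr n), weightProj,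
    coordEquiv_diagHom, coordEquiv_vec]
  split_ifs <;> simp

lemma grCoord_cconj (n : ℤ) (x : Cplx (Gr (weight d) n)) : grCoord d n (cconj _ x) =
    (-star (grCoord d n x).1, star (grCoord d n x).2.1, star (grCoord d n x).2.2.1,
      star (grCoord d n x).2.2.2) := by
  rw [grCoord_apply, ← cconj_baseChange, coordEquiv_cconj]
  rfl

/-- For the converse, the projection of `M` onto `W_n` with diagonal entries `0` and `1` fixes every
vector that satisfies the conditions. -/
lemma mem_range_weight (n : ℤ) (a : ℂ) (b b' : Fin d → ℂ) (c : ℂ) :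
    vec d a b b' c ∈ LinearMap.range ((weight d n).subtype.baseChange ℂ) ↔
      (n < -2 → a = 0) ∧ (n < -1 → b = 0 ∧ b' = 0) ∧ (n < 0 → c = 0) := by
  constructor
  · rintro ⟨y, hy⟩
    have key : ∀ y : Cplx ↥(weight d n), (n < -2 → (coordEquiv d
        ((weight d n).subtype.baseChange ℂ y)).1 = 0) ∧ (n < -1 →
        (coordEquiv d ((weight d n).subtype.baseChange ℂ y)).2.1 = 0 ∧
        (coordEquiv d ((weight d n).subtype.baseChange ℂ y)).2.2.1 = 0) ∧ (n < 0 →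
        (coordEquiv d ((weight d n).subtype.baseChange ℂ y)).2.2.2 = 0) := by
      intro y
      induction y using TensorProduct.induction_on with
      | zero => simp
      | tmul z m =>
        rw [LinearMap.baseChange_tmul, coordEquiv_tmul, latCoord_apply]
        obtain ⟨⟨t, f, k⟩, h1, h2, h3⟩ := m
        simp only [Submodule.subtype_apply] at h1 h2 h3 ⊢
        refine ⟨fun h => ?_, fun h => ?_, fun h => ?_⟩
        · simp [h1 h]
        · rw [h2 h]
          constructor <;> ext <;> simp
        · simp [h3 h]
      | add x y hx hy =>
        simp only [map_add, Prod.fst_add, Prod.snd_add]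
        refine ⟨fun h => ?_, fun h => ⟨?_, ?_⟩, fun h => ?_⟩
        · rw [hx.1 h, hy.1 h, add_zero]
        · rw [(hx.2.1 h).1, (hy.2.1 h).1, add_zero]
        · rw [(hx.2.1 h).2, (hy.2.1 h).2, add_zero]
        · rw [hx.2.2 h, hy.2.2 h, add_zero]
    have := key y
    rwa [hy, coordEquiv_vec] at this
  · rintro ⟨h1, h2, h3⟩
    let e := diagHom d (if n < -2 then 0 else 1) (if n < -1 then 0 else 1) (if n < 0 then 0 else 1)
    have he : ∀ m, e m ∈ weight d n := by
      intro m
      refine ⟨fun h => ?_, fun h => ?_, fun h => ?_⟩ <;> simp only [e, diagHom_apply] <;>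
        rw [if_pos h, zero_smul]
    refine ⟨(e.codRestrict _ he).baseChange ℂ (vec d a b b' c), ?_⟩
    rw [← LinearMap.comp_apply, ← LinearMap.baseChange_comp,
      show (weight d n).subtype ∘ₗ e.codRestrict _ he = e from rfl]
    apply (coordEquiv d).injective
    simp only [e]
    rw [coordEquiv_diagHom, coordEquiv_vec]
    refine Prod.ext ?_ (Prod.ext ?_ (Prod.ext ?_ ?_)) <;> simp only <;> split_ifs with h <;> simp
    · exact (h1 h).symm
    · exact (h2 h).1.symm
    · exact (h2 h).2.symm
    · exact (h3 h).symm

/-- The filtration on a graded piece in coordinates. -/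
lemma mem_grFiltration (F : ℤ → Submodule ℂ (Cplx (Lat d))) (n p : ℤ)
    (x : Cplx (Gr (weight d) n)) : x ∈ grFiltration (weight d) F n p ↔
      ∃ a b b' c, vec d a b b' c ∈ F p ∧
        ((n < -2 → a = 0) ∧ (n < -1 → b = 0 ∧ b' = 0) ∧ (n < 0 → c = 0)) ∧
        grCoord d n x = (if n = -2 then a else 0, if n = -1 then b else 0,
          if n = -1 then b' else 0, if n = 0 then c else 0) := by
  -- On `W_n`, passing to the graded piece and lifting back is the projection to the summand of
  -- weight `n`.
  have hcomp : ∀ y : Cplx ↥(weight d n),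
      (grLift d n).baseChange ℂ ((((weight d (n - 1)).submoduleOf (weight d n)).mkQ.baseChange ℂ) y) =
        (weightProj d n).baseChange ℂ ((weight d n).subtype.baseChange ℂ y) := by
    intro y
    rw [← LinearMap.comp_apply, ← LinearMap.baseChange_comp, ← LinearMap.comp_apply,
      ← LinearMap.baseChange_comp]
    rfl
  have hw : ∀ a b b' c, coordEquiv d ((weightProj d n).baseChange ℂ (vec d a b b' c)) =
      (if n = -2 then a else 0, if n = -1 then b else 0,
        if n = -1 then b' else 0, if n = 0 then c else 0) := by
    intro a b b' c
    rw [weightProj, coordEquiv_diagHom, coordEquiv_vec]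
    split_ifs <;> simp
  constructor
  · rintro ⟨y, hy, rfl⟩
    obtain ⟨a, b, b', c, h⟩ := exists_vec ((weight d n).subtype.baseChange ℂ y)
    refine ⟨a, b, b', c, ?_, (mem_range_weight n a b b' c).1 ⟨y, h⟩, ?_⟩
    · rw [← h]
      exact hy
    · rw [grCoord_apply, hcomp, h, hw]
  · rintro ⟨a, b, b', c, hF, hW, hx⟩
    obtain ⟨y, hy⟩ := (mem_range_weight n a b b' c).2 hW
    refine ⟨y, ?_, ?_⟩
    · change _ ∈ F p
      rw [hy]
      exact hF
    · apply grCoord_injective n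
      rw [hx, grCoord_apply, hcomp, hy, hw]

end Graded
end PoincareTorsor
end

noncomputable section
namespace PoincareTorsor
open Filter Topology

/-! ### Hodge structures with at most two pieces -/

section HodgeLemmas

variable {H : Type} [AddCommGroup H]

/-- When at most two pieces are nonzero, a direct sum decomposition means that these two are
complementary. For weights with a single Hodge type the second index is one whose piece is zero. -/
lemma isHodgeFiltration_iff_isCompl {n : ℤ} {G : ℤ → Submodule ℂ (Cplx H)} {p₀ p₁ : ℤ}
    (hne : p₀ ≠ p₁) (h : ∀ p, p ≠ p₀ → p ≠ p₁ → hodgePiece G p (n - p) = ⊥) :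
    IsHodgeFiltration n G ↔ IsCompl (hodgePiece G p₀ (n - p₀)) (hodgePiece G p₁ (n - p₁)) := by
  rw [IsHodgeFiltration, DirectSum.isInternal_submodule_iff_iSupIndep_and_iSup_eq_top]
  have hsup : ⨆ p, hodgePiece G p (n - p) =
      hodgePiece G p₀ (n - p₀) ⊔ hodgePiece G p₁ (n - p₁) := by
    refine le_antisymm (iSup_le fun p => ?_) (sup_le (le_iSup (fun p => hodgePiece G p (n - p)) p₀)
      (le_iSup (fun p => hodgePiece G p (n - p)) p₁))
    by_cases h0 : p = p₀
    · rw [h0]; exact le_sup_left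
    by_cases h1 : p = p₁
    · rw [h1]; exact le_sup_right
    rw [h p h0 h1]
    exact bot_le
  rw [hsup, isCompl_iff, codisjoint_iff]
  refine and_congr_left fun _ => ⟨fun hi => hi.pairwiseDisjoint hne, fun hd p => ?_⟩
  have hle : ∀ {p p'}, (∀ r, r ≠ p → r ≠ p' → hodgePiece G r (n - r) = ⊥) →
      ⨆ r, ⨆ _ : r ≠ p, hodgePiece G r (n - r) ≤ hodgePiece G p' (n - p') := by
    intro p p' h'
    refine iSup₂_le fun r hr => ?_
    by_cases h1 : r = p'
    · rw [h1]
    · rw [h' r hr h1]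
      exact bot_le
  by_cases h0 : p = p₀
  · subst h0
    exact hd.mono_right (hle h)
  by_cases h1 : p = p₁
  · subst h1
    exact hd.symm.mono_right (hle fun r h2 h3 => h r h3 h2)
  change Disjoint (hodgePiece G p (n - p)) _
  rw [h p h0 h1]
  exact disjoint_bot_left

lemma hodgePiece_eq_bot_left {G : ℤ → Submodule ℂ (Cplx H)} {p q : ℤ} (h : G p = ⊥) :
    hodgePiece G p q = ⊥ := by
  rw [hodgePiece, h, bot_inf_eq]

lemma comap_cconj_bot : (⊥ : Submodule ℂ (Cplx H)).comap (cconj H) = ⊥ := by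
  rw [eq_bot_iff]
  intro x hx
  have h : cconj H x = 0 := hx
  rw [Submodule.mem_bot, ← cconj_cconj x, h, map_zero]

lemma hodgePiece_eq_bot_right {G : ℤ → Submodule ℂ (Cplx H)} {p q : ℤ} (h : G q = ⊥) :
    hodgePiece G p q = ⊥ := by
  rw [hodgePiece, h, comap_cconj_bot, inf_bot_eq]

lemma mem_hodgePiece {G : ℤ → Submodule ℂ (Cplx H)} {p q : ℤ} {x : Cplx H} :
    x ∈ hodgePiece G p q ↔ x ∈ G p ∧ cconj H x ∈ G q := Iff.rfl

end HodgeLemmas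

/-! ### The induced filtrations and the polarisation in coordinates -/

section GradedCoordinates

variable {d : ℕ}

/-- The splitting takes its values in the summand of weight `n`, so all other coordinates vanish. -/
lemma grCoord_eq (n : ℤ) (x : Cplx (Gr (weight d) n)) : grCoord d n x =
    (if n = -2 then (grCoord d n x).1 else 0, if n = -1 then (grCoord d n x).2.1 else 0,
      if n = -1 then (grCoord d n x).2.2.1 else 0, if n = 0 then (grCoord d n x).2.2.2 else 0) := by
  have h : (weightProj d n).baseChange ℂ ((grLift d n).baseChange ℂ x) =
      (grLift d n).baseChange ℂ x := by
    conv_rhs => rw [← toGr_grLift_baseChange n x]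
    rw [← LinearMap.comp_apply (LinearMap.baseChange ℂ (grLift d n)), ← LinearMap.baseChange_comp,
      show grLift d n ∘ₗ toGr d n = weightProj d n from LinearMap.ext (grLift_toGr n)]
  have h2 := congrArg (coordEquiv d) h
  rw [weightProj, coordEquiv_diagHom, ← grCoord_apply] at h2
  conv_lhs => rw [← h2]
  split_ifs <;> simp

lemma subsingleton_gr {n : ℤ} (h0 : n ≠ 0) (h1 : n ≠ -1) (h2 : n ≠ -2) :
    Subsingleton (Cplx (Gr (weight d) n)) := by
  refine ⟨fun x y => grCoord_injective n ?_⟩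
  rw [grCoord_eq, grCoord_eq n y]
  simp [h0, h1, h2]

lemma gr_neg_one_ext {x y : Cplx (Gr (weight d) (-1))}
    (h : (grCoord d (-1) x).2.1 = (grCoord d (-1) y).2.1)
    (h' : (grCoord d (-1) x).2.2.1 = (grCoord d (-1) y).2.2.1) : x = y := by
  apply grCoord_injective
  rw [grCoord_eq, grCoord_eq (-1) y, h, h']
  simp

lemma gr_neg_two_ext {x y : Cplx (Gr (weight d) (-2))}
    (h : (grCoord d (-2) x).1 = (grCoord d (-2) y).1) : x = y := by
  apply grCoord_injective
  rw [grCoord_eq, grCoord_eq (-2) y, h]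
  simp

lemma mem_gr_zero (F : ℤ → Submodule ℂ (Cplx (Lat d))) (p : ℤ) (x : Cplx (Gr (weight d) 0)) :
    x ∈ grFiltration (weight d) F 0 p ↔ ∃ a b b', vec d a b b' (grCoord d 0 x).2.2.2 ∈ F p := by
  rw [mem_grFiltration]
  constructor
  · rintro ⟨a, b, b', c, hF, -, hx⟩
    refine ⟨a, b, b', ?_⟩
    rw [hx]
    simpa using hF
  · rintro ⟨a, b, b', hF⟩
    refine ⟨a, b, b', _, hF, by simp, ?_⟩
    conv_lhs => rw [grCoord_eq]
    simp

lemma mem_gr_neg_one (F : ℤ → Submodule ℂ (Cplx (Lat d))) (p : ℤ)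
    (x : Cplx (Gr (weight d) (-1))) : x ∈ grFiltration (weight d) F (-1) p ↔
      ∃ a, vec d a (grCoord d (-1) x).2.1 (grCoord d (-1) x).2.2.1 0 ∈ F p := by
  rw [mem_grFiltration]
  constructor
  · rintro ⟨a, b, b', c, hF, hW, hx⟩
    refine ⟨a, ?_⟩
    rw [hx]
    rw [hW.2.2 (by norm_num)] at hF
    simpa using hF
  · rintro ⟨a, hF⟩
    refine ⟨a, _, _, 0, hF, by simp, ?_⟩
    conv_lhs => rw [grCoord_eq]
    simp

lemma mem_gr_neg_two (F : ℤ → Submodule ℂ (Cplx (Lat d))) (p : ℤ)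
    (x : Cplx (Gr (weight d) (-2))) : x ∈ grFiltration (weight d) F (-2) p ↔
      vec d (grCoord d (-2) x).1 0 0 0 ∈ F p := by
  rw [mem_grFiltration]
  constructor
  · rintro ⟨a, b, b', c, hF, hW, hx⟩
    rw [hx]
    rw [hW.2.2 (by norm_num), (hW.2.1 (by norm_num)).1, (hW.2.1 (by norm_num)).2] at hF
    simpa using hF
  · intro hF
    refine ⟨_, 0, 0, 0, hF, by simp, ?_⟩
    conv_lhs => rw [grCoord_eq]
    simp

lemma exists_gr_zero (c : ℂ) : ∃ x, (grCoord d 0 x).2.2.2 = c := by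
  obtain ⟨x, hx⟩ := exists_grCoord (d := d) 0 0 0 0 c
  exact ⟨x, by rw [hx]; simp⟩

lemma exists_gr_neg_one (b b' : Fin d → ℂ) :
    ∃ x, (grCoord d (-1) x).2.1 = b ∧ (grCoord d (-1) x).2.2.1 = b' := by
  obtain ⟨x, hx⟩ := exists_grCoord (-1) 0 b b' 0
  exact ⟨x, by rw [hx]; simp⟩

lemma exists_gr_neg_two (a : ℂ) : ∃ x, (grCoord d (-2) x).1 = a := by
  obtain ⟨x, hx⟩ := exists_grCoord (d := d) (-2) a 0 0 0
  exact ⟨x, by rw [hx]; simp⟩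

lemma grFiltration_mono {W : ℤ → Submodule ℤ (Lat d)} {F : ℤ → Submodule ℂ (Cplx (Lat d))}
    {n p p' : ℤ} (h : F p ≤ F p') : grFiltration W F n p ≤ grFiltration W F n p' :=
  Submodule.map_mono (Submodule.comap_mono h)

lemma grFiltration_eq_top {F : ℤ → Submodule ℂ (Cplx (Lat d))} {p : ℤ} (n : ℤ) (h : F p = ⊤) :
    grFiltration (weight d) F n p = ⊤ := by
  rw [eq_top_iff]
  intro x _
  rw [mem_grFiltration]
  obtain ⟨a, b, b', c, hx⟩ : ∃ a b b' c, grCoord d n x = (a, b, b', c) := ⟨_, _, _, _, rfl⟩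
  have h2 := grCoord_eq n x
  rw [hx] at h2
  refine ⟨a, b, b', c, by rw [h]; trivial, ⟨fun hn => ?_, fun hn => ⟨?_, ?_⟩, fun hn => ?_⟩,
    hx.trans h2⟩
  · simpa [show n ≠ -2 by omega] using congrArg Prod.fst h2
  · simpa [show n ≠ -1 by omega] using congrArg (fun z => z.2.1) h2
  · simpa [show n ≠ -1 by omega] using congrArg (fun z => z.2.2.1) h2
  · simpa [show n ≠ 0 by omega] using congrArg (fun z => z.2.2.2) h2

lemma grFiltration_eq_bot {F : ℤ → Submodule ℂ (Cplx (Lat d))} {p : ℤ} (n : ℤ) (h : F p = ⊥) :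
    grFiltration (weight d) F n p = ⊥ := by
  rw [eq_bot_iff]
  intro x hx
  obtain ⟨a, b, b', c, hF, -, hx⟩ := (mem_grFiltration _ _ _ _).1 hx
  rw [h, Submodule.mem_bot] at hF
  have h2 := congrArg (coordEquiv d) hF
  rw [coordEquiv_vec, map_zero] at h2
  simp only [Prod.ext_iff, Prod.fst_zero, Prod.snd_zero] at h2
  obtain ⟨rfl, rfl, rfl, rfl⟩ := h2
  apply grCoord_injective n
  rw [hx, map_zero]
  simp

/-- The polarisation in coordinates. -/
lemma pairingC_grPairing (x y : Cplx (Gr (weight d) (-1))) :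
    pairingC (grPairing d) x y = 2 * Real.pi * Complex.I *
      ∑ j, ((grCoord d (-1) x).2.2.1 j * (grCoord d (-1) y).2.1 j -
        (grCoord d (-1) x).2.1 j * (grCoord d (-1) y).2.2.1 j) := by
  induction x using TensorProduct.induction_on with
  | zero => simp
  | add x x' hx hx' =>
    rw [map_add, LinearMap.add_apply, hx, hx', map_add, ← mul_add, ← Finset.sum_add_distrib]
    congr 1
    refine Finset.sum_congr rfl fun j _ => ?_
    simp only [Prod.snd_add, Prod.fst_add, Pi.add_apply]
    ring
  | tmul z m =>
    induction y using TensorProduct.induction_on with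
    | zero => simp
    | add x x' hx hx' =>
      rw [map_add, hx, hx', map_add, ← mul_add, ← Finset.sum_add_distrib]
      congr 1
      refine Finset.sum_congr rfl fun j _ => ?_
      simp only [Prod.snd_add, Prod.fst_add, Pi.add_apply]
      ring
    | tmul z' m' =>
      have h1 : pairingC (grPairing d) (z ⊗ₜ m) (z' ⊗ₜ m') = z * (z' * (grPairing d m m' : ℂ)) := by
        simp [pairingC]
      rw [h1]
      obtain ⟨m, rfl⟩ := Submodule.Quotient.mk_surjective _ m
      obtain ⟨m', rfl⟩ := Submodule.Quotient.mk_surjective _ m'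
      have h2 : grPairing d (Submodule.Quotient.mk m) (Submodule.Quotient.mk m') =
        (∑ j, (m.1.2.1 (Sum.inr j) * m'.1.2.1 (Sum.inl j) -
          m.1.2.1 (Sum.inl j) * m'.1.2.1 (Sum.inr j))) • tateGen := rfl
      have h3 : ∀ (z : ℂ) (m : ↥(weight d (-1))),
          grCoord d (-1) (z ⊗ₜ Submodule.Quotient.mk m) = z • latCoord (weightProj d (-1) m.1) := by
        intro z m
        rw [grCoord_apply, LinearMap.baseChange_tmul, coordEquiv_tmul]
        rfl
      have h4 : ∀ m : Lat d, weightProj d (-1) m = (0, m.2.1, 0) := by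
        intro m
        simp [weightProj, diagHom_apply]
      have h5 : ((((∑ j, (m.1.2.1 (Sum.inr j) * m'.1.2.1 (Sum.inl j) -
          m.1.2.1 (Sum.inl j) * m'.1.2.1 (Sum.inr j))) • tateGen : Tate 1)) : ℂ) =
          (∑ j, ((m.1.2.1 (Sum.inr j) : ℂ) * (m'.1.2.1 (Sum.inl j) : ℂ) -
          (m.1.2.1 (Sum.inl j) : ℂ) * (m'.1.2.1 (Sum.inr j) : ℂ))) *
            (2 * Real.pi * Complex.I) := by
        rw [AddSubgroupClass.coe_zsmul, coe_tateGen, zsmul_eq_mul]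
        push_cast
        rfl
      rw [h2]
      refine (congrArg (fun t => z * (z' * t)) h5).trans ?_
      simp only [h3, h4, latCoord_apply, Prod.smul_snd, Prod.smul_fst, Pi.smul_apply, smul_eq_mul]
      rw [Finset.sum_mul, Finset.mul_sum, Finset.mul_sum, Finset.mul_sum]
      refine Finset.sum_congr rfl fun j _ => ?_
      ring

/-- The hermitian form of the polarisation in coordinates. -/
lemma pairingC_cconj (x : Cplx (Gr (weight d) (-1))) :
    pairingC (grPairing d) x (cconj _ x) = (4 * Real.pi *
      (∑ j, (grCoord d (-1) x).2.1 j * star ((grCoord d (-1) x).2.2.1 j)).im : ℝ) := by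
  rw [pairingC_grPairing, grCoord_cconj]
  simp only [Pi.star_apply]
  have h : ∀ z w : ℂ, z * star w - w * star z = -(2 * Complex.I) * ((w * star z).im : ℂ) := by
    intro z w
    apply Complex.ext <;> simp <;> ring
  simp only [h]
  rw [← Finset.mul_sum, ← Complex.ofReal_sum, ← Complex.im_sum]
  push_cast
  linear_combination (-4 * Real.pi *
    ((∑ j, (grCoord d (-1) x).2.1 j * star ((grCoord d (-1) x).2.2.1 j)).im : ℂ)) * Complex.I_sq

/-- The pairing is alternating and `2πi` is imaginary; the two signs cancel. -/
lemma pairingC_hermitian (x y : Cplx (Gr (weight d) (-1))) :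
    pairingC (grPairing d) y (cconj _ x) = star (pairingC (grPairing d) x (cconj _ y)) := by
  rw [pairingC_grPairing, pairingC_grPairing, grCoord_cconj, grCoord_cconj]
  simp only [Pi.star_apply, star_mul', star_sum, star_sub, star_star]
  have h : star (2 * (Real.pi : ℂ) * Complex.I) = -(2 * Real.pi * Complex.I) := by simp
  rw [← star_mul', ← star_mul', h, neg_mul, ← mul_neg, ← Finset.sum_neg_distrib]
  congr 1
  refine Finset.sum_congr rfl fun j _ => ?_
  ring

end GradedCoordinates

/-! ### Positivity of the imaginary part -/

section ImaginaryPart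

variable {d : ℕ}

/-- The imaginary part of the hermitian form of a symmetric matrix. -/
lemma im_sum_mul_star {t : Fin d → Fin d → ℂ} (ht : ∀ i j, t i j = t j i) (b : Fin d → ℂ) :
    (∑ i, (∑ j, t i j * b j) * star (b i)).im =
      ∑ i, ∑ j, (b i).re * (t i j).im * (b j).re + ∑ i, ∑ j, (b i).im * (t i j).im * (b j).im := by
  -- The contributions of the real part of `t` cancel by symmetry.
  have h0 : ∑ i, ∑ j, (t i j).re * ((b j).im * (b i).re) =
      ∑ i, ∑ j, (t i j).re * ((b j).re * (b i).im) := by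
    rw [Finset.sum_comm]
    refine Finset.sum_congr rfl fun i _ => Finset.sum_congr rfl fun j _ => ?_
    rw [ht j i]
    ring
  have h1 : (∑ i, (∑ j, t i j * b j) * star (b i)).im =
      ∑ i, ∑ j, ((b i).re * (t i j).im * (b j).re + (b i).im * (t i j).im * (b j).im) +
      (∑ i, ∑ j, (t i j).re * ((b j).im * (b i).re) -
        ∑ i, ∑ j, (t i j).re * ((b j).re * (b i).im)) := by
    rw [← Finset.sum_sub_distrib, ← Finset.sum_add_distrib, Complex.im_sum]
    refine Finset.sum_congr rfl fun i _ => ?_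
    rw [← Finset.sum_sub_distrib, ← Finset.sum_add_distrib, Finset.sum_mul, Complex.im_sum]
    refine Finset.sum_congr rfl fun j _ => ?_
    simp
    ring
  rw [h1, h0, sub_self, add_zero]
  simp only [Finset.sum_add_distrib]

lemma sum_im_nonneg (τ : Siegel d) (x : Fin d → ℝ) :
    0 ≤ ∑ i, ∑ j, x i * (ent τ i j).im * x j ∧
      (x ≠ 0 → 0 < ∑ i, ∑ j, x i * (ent τ i j).im * x j) := by
  have hq : star x ⬝ᵥ (Matrix.of fun i j => (ent τ i j).im).mulVec x =
      ∑ i, ∑ j, x i * (ent τ i j).im * x j := by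
    simp [dotProduct, Matrix.mulVec, Finset.mul_sum, mul_assoc]
  have h : x ≠ 0 → 0 < ∑ i, ∑ j, x i * (ent τ i j).im * x j := fun hx => by
    rw [← hq]
    exact (Matrix.posDef_iff_dotProduct_mulVec.1 (posDef_im τ)).2 hx
  refine ⟨?_, h⟩
  by_cases hx : x = 0
  · simp [hx]
  · exact (h hx).le

lemma im_form_pos (τ : Siegel d) {b : Fin d → ℂ} (hb : b ≠ 0) :
    0 < (∑ i, (∑ j, ent τ i j * b j) * star (b i)).im := by
  rw [im_sum_mul_star (ent_symm τ)]
  have h1 := sum_im_nonneg τ fun i => (b i).re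
  have h2 := sum_im_nonneg τ fun i => (b i).im
  by_cases hre : (fun i => (b i).re) = 0
  · have him : (fun i => (b i).im) ≠ 0 := by
      intro him
      exact hb (funext fun i => Complex.ext (congrFun hre i) (congrFun him i))
    exact add_pos_of_nonneg_of_pos h1.1 (h2.2 him)
  · exact add_pos_of_pos_of_nonneg (h1.2 hre) h2.1

end ImaginaryPart
end PoincareTorsor
end

noncomputable section
namespace PoincareTorsor
open Filter Topology

/-! ### The filtration of a period matrix lies in the period domain -/

section StandardFiltration

variable {d : ℕ}

/-- The product of a point of the Siegel space and a column. -/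
def tauMul (τ : Siegel d) : (Fin d → ℂ) →ₗ[ℂ] (Fin d → ℂ) :=
  Matrix.mulVecLin (Matrix.of fun i j => ent τ i j)

lemma tauMul_apply (τ : Siegel d) (b : Fin d → ℂ) (i : Fin d) :
    tauMul τ b i = ∑ j, ent τ i j * b j := rfl

lemma tauMul_single (τ : Siegel d) (j : Fin d) :
    tauMul τ (Pi.single j 1) = fun i => ent τ i j := by
  ext i
  simp [tauMul_apply, Pi.single_apply]

lemma dotProduct_tauMul (τ : Siegel d) (b b' : Fin d → ℂ) :
    b ⬝ᵥ tauMul τ b' = tauMul τ b ⬝ᵥ b' := by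
  simp only [dotProduct, tauMul_apply, Finset.mul_sum, Finset.sum_mul]
  rw [Finset.sum_comm]
  refine Finset.sum_congr rfl fun i _ => Finset.sum_congr rfl fun j _ => ?_
  rw [ent_symm]
  ring

/-- The column space of the period matrix, parametrised by its two lower blocks. -/
def colVec (x : Coord d) (b : Fin d → ℂ) (c : ℂ) : Cplx (Lat d) :=
  vec d (x.2.1 ⬝ᵥ b + c * x.2.2.2) (tauMul x.1 b + c • x.2.2.1) b c

/-- The parametrisation of the column space as a linear map. -/
def colL (x : Coord d) : (Fin d → ℂ) × ℂ →ₗ[ℂ] Cplx (Lat d) where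
  toFun a := colVec x a.1 a.2
  map_add' a a' := by
    simp only [colVec, Prod.fst_add, Prod.snd_add]
    rw [← vec_add]
    congr 1
    · rw [dotProduct_add]; ring
    · rw [map_add, add_smul]; abel
  map_smul' z a := by
    simp only [colVec, Prod.smul_fst, Prod.smul_snd, smul_eq_mul, RingHom.id_apply]
    rw [← vec_smul]
    congr 1
    · rw [dotProduct_smul, smul_eq_mul]; ring
    · rw [map_smul, smul_add, smul_smul]

lemma colL_apply (x : Coord d) (b : Fin d → ℂ) (c : ℂ) : colL x (b, c) = colVec x b c := rfl

lemma colVec_single (x : Coord d) (j : Fin d) : colVec x (Pi.single j 1) 0 =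
    vec d (x.2.1 j) (fun i => ent x.1 i j) (Pi.single j 1) 0 := by
  simp [colVec, tauMul_single]

lemma colVec_zero_one (x : Coord d) : colVec x 0 1 = vec d x.2.2.2 x.2.2.1 0 1 := by
  simp [colVec]

lemma colSpace_eq_range (x : Coord d) : colSpace d x = LinearMap.range (colL x) := by
  refine le_antisymm (Submodule.span_le.2 ?_) ?_
  · rintro _ (⟨j, rfl⟩ | h)
    · exact ⟨(Pi.single j 1, 0), colVec_single x j⟩
    · rw [Set.mem_singleton_iff.1 h]
      exact ⟨(0, 1), colVec_zero_one x⟩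
  · rintro _ ⟨⟨b, c⟩, rfl⟩
    have h : (b, c) = ∑ j, b j • ((Pi.single j 1, 0) : (Fin d → ℂ) × ℂ) + c • (0, 1) := by
      refine Prod.ext ?_ ?_
      · ext i
        simp [Prod.fst_sum, Pi.single_apply]
      · simp [Prod.snd_sum]
    rw [h, map_add, map_sum, map_smul, colL_apply, colVec_zero_one]
    refine add_mem (sum_mem fun j _ => ?_) (Submodule.smul_mem _ _ (Submodule.subset_span (.inr rfl)))
    rw [map_smul, colL_apply, colVec_single]
    exact Submodule.smul_mem _ _ (Submodule.subset_span (.inl ⟨j, rfl⟩))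

lemma mem_colSpace (x : Coord d) (a : ℂ) (b b' : Fin d → ℂ) (c : ℂ) :
    vec d a b b' c ∈ colSpace d x ↔
      a = x.2.1 ⬝ᵥ b' + c * x.2.2.2 ∧ b = tauMul x.1 b' + c • x.2.2.1 := by
  rw [colSpace_eq_range]
  constructor
  · rintro ⟨⟨e, z⟩, h⟩
    obtain ⟨rfl, rfl, rfl, rfl⟩ := vec_inj h.symm
    exact ⟨rfl, rfl⟩
  · rintro ⟨rfl, rfl⟩
    exact ⟨(b', c), rfl⟩

/-- The filtration with a given period matrix. -/
def stdFil (x : Coord d) (p : ℤ) : Submodule ℂ (Cplx (Lat d)) :=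
  if p < 0 then ⊤ else if p = 0 then colSpace d x else ⊥

lemma stdFil_neg (x : Coord d) {p : ℤ} (hp : p < 0) : stdFil x p = ⊤ := if_pos hp

lemma stdFil_zero (x : Coord d) : stdFil x 0 = colSpace d x := by simp [stdFil]

lemma stdFil_pos (x : Coord d) {p : ℤ} (hp : 0 < p) : stdFil x p = ⊥ := by
  rw [stdFil, if_neg (by omega), if_neg (by omega)]

lemma gr_zero_stdFil (x : Coord d) : grFiltration (weight d) (stdFil x) 0 0 = ⊤ := by
  rw [eq_top_iff]
  intro y _
  rw [mem_gr_zero, stdFil_zero]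
  exact ⟨_, _, 0, (mem_colSpace ..).2 ⟨rfl, rfl⟩⟩

lemma gr_neg_two_stdFil (x : Coord d) : grFiltration (weight d) (stdFil x) (-2) 0 = ⊥ := by
  rw [eq_bot_iff]
  intro y hy
  rw [mem_gr_neg_two, stdFil_zero, mem_colSpace] at hy
  exact gr_neg_two_ext (by rw [hy.1, map_zero]; simp)

lemma mem_gr_neg_one_stdFil (x : Coord d) (y : Cplx (Gr (weight d) (-1))) :
    y ∈ grFiltration (weight d) (stdFil x) (-1) 0 ↔
      (grCoord d (-1) y).2.1 = tauMul x.1 (grCoord d (-1) y).2.2.1 := by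
  rw [mem_gr_neg_one, stdFil_zero]
  simp only [mem_colSpace, zero_smul, add_zero, exists_and_right, exists_eq, true_and]

/-- A positive index makes the filtration zero. Otherwise an excluded type has weight at most `-2`:
in weight `-2` it has `p = 0` or `q = 0`, where `F^0` vanishes, and in lower weights the graded
piece is zero. -/
lemma hodgePiece_stdFil_eq_bot (x : Coord d) {n p q : ℤ} (hn : p + q = n)
    (h : (p, q) ∉ ({(-1, -1), (-1, 0), (0, -1), (0, 0)} : Set (ℤ × ℤ))) :
    hodgePiece (grFiltration (weight d) (stdFil x) n) p q = ⊥ := by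
  by_cases hp : 0 < p
  · exact hodgePiece_eq_bot_left (grFiltration_eq_bot n (stdFil_pos x hp))
  by_cases hq : 0 < q
  · exact hodgePiece_eq_bot_right (grFiltration_eq_bot n (stdFil_pos x hq))
  simp only [Set.mem_insert_iff, Set.mem_singleton_iff, Prod.mk.injEq, not_or] at h
  by_cases hn2 : n = -2
  · subst hn2
    obtain rfl | rfl : p = 0 ∨ q = 0 := by omega
    · exact hodgePiece_eq_bot_left (gr_neg_two_stdFil x)
    · exact hodgePiece_eq_bot_right (gr_neg_two_stdFil x)
  · have := subsingleton_gr (d := d) (n := n) (by omega) (by omega) hn2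
    exact Subsingleton.elim _ _

/-- The complex conjugate of `τ`, as a linear map. -/
def tauConj (τ : Siegel d) : (Fin d → ℂ) →ₗ[ℂ] (Fin d → ℂ) :=
  Matrix.mulVecLin (Matrix.of fun i j => star (ent τ i j))

lemma tauConj_apply (τ : Siegel d) (b : Fin d → ℂ) : tauConj τ b = star (tauMul τ (star b)) := by
  ext i
  change ∑ j, star (ent τ i j) * b j = star (∑ j, ent τ i j * star (b j))
  simp [star_sum]

lemma dotProduct_tauConj (τ : Siegel d) (b b' : Fin d → ℂ) :
    b ⬝ᵥ tauConj τ b' = tauConj τ b ⬝ᵥ b' := by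
  change ∑ i, b i * ∑ j, star (ent τ i j) * b' j = ∑ i, (∑ j, star (ent τ i j) * b j) * b' i
  simp only [Finset.mul_sum, Finset.sum_mul]
  rw [Finset.sum_comm]
  refine Finset.sum_congr rfl fun i _ => Finset.sum_congr rfl fun j _ => ?_
  rw [ent_symm]
  ring

/-- Since `F^{-1}` is everything, the condition on the conjugate is void. -/
lemma mem_hodgePiece_zero (x : Coord d) (y : Cplx (Gr (weight d) (-1))) :
    y ∈ hodgePiece (grFiltration (weight d) (stdFil x) (-1)) 0 (-1) ↔
      (grCoord d (-1) y).2.1 = tauMul x.1 (grCoord d (-1) y).2.2.1 := by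
  rw [mem_hodgePiece, mem_gr_neg_one_stdFil, grFiltration_eq_top _ (stdFil_neg x (by norm_num))]
  simp

lemma mem_hodgePiece_neg_one (x : Coord d) (y : Cplx (Gr (weight d) (-1))) :
    y ∈ hodgePiece (grFiltration (weight d) (stdFil x) (-1)) (-1) 0 ↔
      (grCoord d (-1) y).2.1 = tauConj x.1 (grCoord d (-1) y).2.2.1 := by
  rw [mem_hodgePiece, mem_gr_neg_one_stdFil, grFiltration_eq_top _ (stdFil_neg x (by norm_num)),
    grCoord_cconj, tauConj_apply]
  simp only [Submodule.mem_top, true_and]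
  exact star_eq_iff_star_eq.trans eq_comm

lemma im_tauMul_pos (τ : Siegel d) {b : Fin d → ℂ} (hb : b ≠ 0) :
    0 < (∑ j, tauMul τ b j * star (b j)).im := im_form_pos τ hb

lemma im_tauConj_neg (τ : Siegel d) {b : Fin d → ℂ} (hb : b ≠ 0) :
    (∑ j, tauConj τ b j * star (b j)).im < 0 := by
  have h := im_tauMul_pos τ (b := star b) (by simpa using hb)
  have h2 : ∑ j, tauConj τ b j * star (b j) = star (∑ j, tauMul τ (star b) j * star (star b j)) := by
    rw [tauConj_apply, star_sum]
    refine Finset.sum_congr rfl fun j _ => ?_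
    simp
  rw [h2]
  change (starRingEnd ℂ _).im < 0
  rw [Complex.conj_im]
  linarith

lemma eq_zero_of_tauMul_eq_tauConj (τ : Siegel d) {b : Fin d → ℂ} (h : tauMul τ b = tauConj τ b) :
    b = 0 := by
  by_contra hb
  have h1 := im_tauMul_pos τ hb
  have h2 := im_tauConj_neg τ hb
  rw [← h] at h2
  exact lt_asymm h1 h2

/-- The two pieces are the graphs of `τ` and of its conjugate, and their difference is injective
because `Im τ` is definite. -/
lemma isCompl_hodgePiece (x : Coord d) :
    IsCompl (hodgePiece (grFiltration (weight d) (stdFil x) (-1)) 0 (-1))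
      (hodgePiece (grFiltration (weight d) (stdFil x) (-1)) (-1) 0) := by
  constructor
  · rw [Submodule.disjoint_def]
    intro y h1 h2
    rw [mem_hodgePiece_zero] at h1
    rw [mem_hodgePiece_neg_one, h1] at h2
    have h3 := eq_zero_of_tauMul_eq_tauConj _ h2
    rw [h3, map_zero] at h1
    refine gr_neg_one_ext ?_ ?_
    · rw [h1, map_zero]; rfl
    · rw [h3, map_zero]; rfl
  · rw [codisjoint_iff, eq_top_iff]
    intro y _
    have hinj : Function.Injective (tauMul x.1 - tauConj x.1) := by
      rw [← LinearMap.ker_eq_bot, LinearMap.ker_eq_bot']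
      intro b hb
      exact eq_zero_of_tauMul_eq_tauConj _ (sub_eq_zero.1 hb)
    -- The lower block `β` of the component in the graph of `τ` is found by comparing upper blocks:
    -- `(τ - τ̄) β` is the upper block of `y` minus `τ̄` applied to the lower one.
    obtain ⟨β, hβ⟩ := LinearMap.injective_iff_surjective.1 hinj
      ((grCoord d (-1) y).2.1 - tauConj x.1 (grCoord d (-1) y).2.2.1)
    obtain ⟨y₁, h1, h1'⟩ := exists_gr_neg_one (tauMul x.1 β) β
    obtain ⟨y₂, h2, h2'⟩ := exists_gr_neg_one
      (tauConj x.1 ((grCoord d (-1) y).2.2.1 - β)) ((grCoord d (-1) y).2.2.1 - β)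
    refine Submodule.mem_sup.2 ⟨y₁, ?_, y₂, ?_, gr_neg_one_ext ?_ ?_⟩
    · rw [mem_hodgePiece_zero, h1, h1']
    · rw [mem_hodgePiece_neg_one, h2, h2']
    · rw [map_add, Prod.snd_add, Prod.fst_add, h1, h2, map_sub]
      rw [LinearMap.sub_apply] at hβ
      rw [add_sub_left_comm, hβ]
      abel
    · rw [map_add, Prod.snd_add, Prod.snd_add, Prod.fst_add, h1', h2']
      abel

instance : Module.Finite ℤ (Tate 1) :=
  Module.Finite.of_surjective (LinearMap.toSpanSingleton ℤ (Tate 1) tateGen) fun t => by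
    obtain ⟨k, rfl⟩ := exists_zsmul_tateGen t
    exact ⟨k, rfl⟩

lemma mem_weight_of_zsmul {n k : ℤ} (hk : k ≠ 0) {m : Lat d} (h : k • m ∈ weight d n) :
    m ∈ weight d n := by
  rw [mem_weight] at h ⊢
  refine ⟨fun hn => ?_, fun hn => ?_, fun hn => ?_⟩
  · exact (smul_eq_zero.1 (h.1 hn)).resolve_left hk
  · exact (smul_eq_zero.1 (h.2.1 hn)).resolve_left hk
  · exact (smul_eq_zero.1 (h.2.2 hn)).resolve_left hk

lemma isMixedHodgeStructure_stdFil (x : Coord d) :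
    IsMixedHodgeStructure (weight d) (stdFil x) where
  finite := inferInstance
  weight_mono := by
    intro n n' hn m hm
    rw [mem_weight] at hm ⊢
    exact ⟨fun h => hm.1 (by omega), fun h => hm.2.1 (by omega), fun h => hm.2.2 (by omega)⟩
  weight_bot := by
    refine ⟨-3, ?_⟩
    ext m
    rw [Submodule.mem_torsion_iff]
    constructor
    · intro h
      have : m = 0 := Prod.ext (h.1 (by norm_num)) (Prod.ext (h.2.1 (by norm_num))
        (h.2.2 (by norm_num)))
      exact ⟨1, by rw [this, smul_zero]⟩
    · rintro ⟨k, hk⟩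
      have hm : m = 0 := (smul_eq_zero.1 (show (k : ℤ) • m = 0 from hk)).resolve_left
        (nonZeroDivisors.ne_zero k.2)
      rw [hm]
      exact zero_mem _
  weight_top := by
    refine ⟨0, ?_⟩
    rw [eq_top_iff]
    exact fun m _ => ⟨fun h => absurd h (by norm_num), fun h => absurd h (by norm_num),
      fun h => absurd h (by norm_num)⟩
  weight_torsionFree := by
    intro n
    rw [Module.isTorsionFree_iff_smul_eq_zero]
    intro k y
    obtain ⟨m, rfl⟩ := Submodule.Quotient.mk_surjective _ y
    rw [← Submodule.Quotient.mk_smul, Submodule.Quotient.mk_eq_zero, Submodule.Quotient.mk_eq_zero]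
    intro h
    by_cases hk : k = 0
    · exact .inl hk
    · exact .inr (mem_weight_of_zsmul hk h)
  hodge_anti := by
    intro p p' hp
    rcases lt_trichotomy p 0 with h | rfl | h
    · rw [stdFil_neg x h]; exact le_top
    · rcases hp.eq_or_lt with rfl | h'
      · exact le_rfl
      · rw [stdFil_pos x h']; exact bot_le
    · rw [stdFil_pos x (h.trans_le hp)]; exact bot_le
  hodge_top := ⟨-1, stdFil_neg x (by norm_num)⟩
  hodge_bot := ⟨1, stdFil_pos x (by norm_num)⟩
  graded := by
    intro n
    by_cases h0 : n = 0
    · subst h0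
      rw [isHodgeFiltration_iff_isCompl (p₀ := 0) (p₁ := 1) (by norm_num) fun p h1 h2 =>
        hodgePiece_stdFil_eq_bot x (by omega) (by simp; omega),
        hodgePiece_stdFil_eq_bot x (p := 1) (by omega) (by simp)]
      have : hodgePiece (grFiltration (weight d) (stdFil x) 0) 0 (0 - 0) = ⊤ := by
        rw [sub_zero, hodgePiece, gr_zero_stdFil]
        simp
      rw [this]
      exact isCompl_top_bot
    by_cases h1 : n = -1
    · subst h1
      rw [isHodgeFiltration_iff_isCompl (p₀ := 0) (p₁ := -1) (by norm_num) fun p h1 h2 =>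
        hodgePiece_stdFil_eq_bot x (by omega) (by simp; omega)]
      exact isCompl_hodgePiece x
    by_cases h2 : n = -2
    · subst h2
      rw [isHodgeFiltration_iff_isCompl (p₀ := -1) (p₁ := 0) (by norm_num) fun p h1 h2 =>
        hodgePiece_stdFil_eq_bot x (by omega) (by simp; omega),
        hodgePiece_stdFil_eq_bot x (p := 0) (by omega) (by simp)]
      have : hodgePiece (grFiltration (weight d) (stdFil x) (-2)) (-1) (-2 - -1) = ⊤ := by
        rw [show (-2 : ℤ) - -1 = -1 by norm_num, hodgePiece,
          grFiltration_eq_top _ (stdFil_neg x (by norm_num))]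
        simp
      rw [this]
      exact isCompl_top_bot
    -- In the remaining weights the graded piece is zero, so `⊥` and `⊤` coincide.
    · have := subsingleton_gr (d := d) h0 h1 h2
      rw [isHodgeFiltration_iff_isCompl (p₀ := 0) (p₁ := 1) (by norm_num) fun p _ _ =>
        Subsingleton.elim _ _]
      rw [Subsingleton.elim (hodgePiece _ 0 _) ⊥, Subsingleton.elim (hodgePiece _ 1 _) ⊤]
      exact isCompl_bot_top

/-- The nonzero pairs to be tested are of equal type, and the graphs of `τ` and of its conjugate are
isotropic by symmetry. Positivity is that of `Im τ`; the sign `(-1)^p` compensates the negative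
imaginary part of the conjugate. -/
lemma isPolarisation_stdFil (x : Coord d) :
    IsPolarisation (-1) (grFiltration (weight d) (stdFil x) (-1)) (grPairing d) := by
  have hvan : ∀ p v, v ∈ hodgePiece (grFiltration (weight d) (stdFil x) (-1)) p (-1 - p) →
      v = 0 ∨ (p = 0 ∧ (grCoord d (-1) v).2.1 = tauMul x.1 (grCoord d (-1) v).2.2.1) ∨
        (p = -1 ∧ (grCoord d (-1) v).2.1 = tauConj x.1 (grCoord d (-1) v).2.2.1) := by
    intro p v hv
    by_cases h0 : p = 0
    · subst h0
      exact .inr (.inl ⟨rfl, (mem_hodgePiece_zero x v).1 hv⟩)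
    by_cases h1 : p = -1
    · subst h1
      exact .inr (.inr ⟨rfl, (mem_hodgePiece_neg_one x v).1 hv⟩)
    rw [hodgePiece_stdFil_eq_bot x (by omega) (by simp; omega)] at hv
    exact .inl hv
  have hsum : ∀ y z, pairingC (grPairing d) y z = 2 * Real.pi * Complex.I *
      ((grCoord d (-1) y).2.2.1 ⬝ᵥ (grCoord d (-1) z).2.1 -
        (grCoord d (-1) y).2.1 ⬝ᵥ (grCoord d (-1) z).2.2.1) := by
    intro y z
    rw [pairingC_grPairing, Finset.sum_sub_distrib]
    rfl
  refine ⟨fun p p' hpp v hv w hw => ?_, fun p v _ w _ => ?_, fun p v hv hv0 => ?_⟩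
  · rcases hvan p v hv with rfl | ⟨rfl, h⟩ | ⟨rfl, h⟩
    · simp
    · rcases hvan p' w hw with rfl | ⟨rfl, h'⟩ | ⟨rfl, h'⟩
      · simp
      · rw [hsum, h, h', dotProduct_tauMul, sub_self, mul_zero]
      · exact absurd rfl hpp
    · rcases hvan p' w hw with rfl | ⟨rfl, h'⟩ | ⟨rfl, h'⟩
      · simp
      · exact absurd rfl hpp
      · rw [hsum, h, h', dotProduct_tauConj, sub_self, mul_zero]
  · rw [pairingC_hermitian, map_mul]
    have : starRingEnd ℂ ((-1 : ℂ) ^ p) = (-1) ^ p := by rw [map_zpow₀]; simp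
    rw [this]
    rfl
  · rw [pairingC_cconj]
    rcases hvan p v hv with rfl | ⟨rfl, h⟩ | ⟨rfl, h⟩
    · exact absurd rfl hv0
    · have hb : (grCoord d (-1) v).2.2.1 ≠ 0 := by
        intro hb
        rw [hb, map_zero] at h
        exact hv0 (gr_neg_one_ext (by rw [h, map_zero]; rfl) (by rw [hb, map_zero]; rfl))
      rw [zpow_zero, one_mul, Complex.ofReal_re, Complex.ofReal_im, h]
      have := im_tauMul_pos x.1 hb
      exact ⟨by positivity, rfl⟩
    · have hb : (grCoord d (-1) v).2.2.1 ≠ 0 := by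
        intro hb
        rw [hb, map_zero] at h
        exact hv0 (gr_neg_one_ext (by rw [h, map_zero]; rfl) (by rw [hb, map_zero]; rfl))
      rw [zpow_neg_one, show ((-1 : ℂ)⁻¹) = ((-1 : ℝ) : ℂ) by norm_num, ← Complex.ofReal_mul,
        Complex.ofReal_re, Complex.ofReal_im, h]
      have := im_tauConj_neg x.1 hb
      refine ⟨?_, rfl⟩
      have h4 : 0 < 4 * Real.pi := by positivity
      nlinarith

lemma inD_stdFil (x : Coord d) : InD d (stdFil x) :=
  ⟨isMixedHodgeStructure_stdFil x, fun _ _ h => hodgePiece_stdFil_eq_bot x rfl h,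
    isPolarisation_stdFil x⟩

end StandardFiltration
end PoincareTorsor
end

noncomputable section
namespace PoincareTorsor
open Filter Topology

/-! ### Every point of the period domain has a period matrix -/

section PeriodDomain

variable {d : ℕ}

lemma InD.hodgePiece_eq_bot {F : ℤ → Submodule ℂ (Cplx (Lat d))} (h : InD d F) {n p q : ℤ}
    (hn : p + q = n) (hpq : (p, q) ∉ ({(-1, -1), (-1, 0), (0, -1), (0, 0)} : Set (ℤ × ℤ))) :
    hodgePiece (grFiltration (weight d) F n) p q = ⊥ := by
  subst hn
  exact h.hasType p q hpq

/-- When the condition on the conjugate is void, the piece of type `(p, q)` is all of `F^p`. -/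
lemma InD.gr_eq_bot {F : ℤ → Submodule ℂ (Cplx (Lat d))} (h : InD d F) {n p q : ℤ}
    (hn : p + q = n) (hpq : (p, q) ∉ ({(-1, -1), (-1, 0), (0, -1), (0, 0)} : Set (ℤ × ℤ)))
    (htop : grFiltration (weight d) F n q = ⊤) : grFiltration (weight d) F n p = ⊥ := by
  have := h.hodgePiece_eq_bot hn hpq
  rwa [hodgePiece, htop, Submodule.comap_top, inf_top_eq] at this

lemma InD.gr_anti {F : ℤ → Submodule ℂ (Cplx (Lat d))} (h : InD d F) (n : ℤ) {p p' : ℤ}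
    (hp : p ≤ p') : grFiltration (weight d) F n p' ≤ grFiltration (weight d) F n p :=
  grFiltration_mono (h.isMHS.hodge_anti hp)

lemma InD.gr_zero_top {F : ℤ → Submodule ℂ (Cplx (Lat d))} (h : InD d F) :
    grFiltration (weight d) F 0 0 = ⊤ := by
  have h1 := h.isMHS.graded 0
  rw [isHodgeFiltration_iff_isCompl (p₀ := 0) (p₁ := 1) (by norm_num) fun p h1 h2 =>
    h.hodgePiece_eq_bot (by omega) (by simp; omega),
    h.hodgePiece_eq_bot (p := 1) (by omega) (by simp)] at h1
  rw [eq_top_iff, ← eq_top_of_isCompl_bot h1]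
  exact inf_le_left

lemma InD.gr_neg_two_top {F : ℤ → Submodule ℂ (Cplx (Lat d))} (h : InD d F) :
    grFiltration (weight d) F (-2) (-1) = ⊤ := by
  have h1 := h.isMHS.graded (-2)
  rw [isHodgeFiltration_iff_isCompl (p₀ := -1) (p₁ := 0) (by norm_num) fun p h1 h2 =>
    h.hodgePiece_eq_bot (by omega) (by simp; omega),
    h.hodgePiece_eq_bot (p := 0) (by omega) (by simp)] at h1
  rw [eq_top_iff, ← eq_top_of_isCompl_bot h1]
  exact inf_le_left

lemma InD.isCompl {F : ℤ → Submodule ℂ (Cplx (Lat d))} (h : InD d F) :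
    IsCompl (hodgePiece (grFiltration (weight d) F (-1)) 0 (-1))
      (hodgePiece (grFiltration (weight d) F (-1)) (-1) 0) := by
  have h1 := h.isMHS.graded (-1)
  rw [isHodgeFiltration_iff_isCompl (p₀ := 0) (p₁ := -1) (by norm_num) fun p h1 h2 =>
    h.hodgePiece_eq_bot (by omega) (by simp; omega)] at h1
  exact h1

lemma InD.gr_neg_one_top {F : ℤ → Submodule ℂ (Cplx (Lat d))} (h : InD d F) :
    grFiltration (weight d) F (-1) (-1) = ⊤ := by
  rw [eq_top_iff, ← h.isCompl.sup_eq_top]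
  exact sup_le (inf_le_left.trans (h.gr_anti _ (by norm_num))) inf_le_left

/-- A vector is assembled from elements of `F^{-1}` with prescribed components in `Gr_0`, `Gr_{-1}`
and `Gr_{-2}` in turn; on each of these `F^{-1}` induces everything. -/
lemma InD.top {F : ℤ → Submodule ℂ (Cplx (Lat d))} (h : InD d F) {p : ℤ} (hp : p < 0) :
    F p = ⊤ := by
  have key : F (-1) = ⊤ := by
    rw [eq_top_iff]
    intro z _
    obtain ⟨a, b, b', c, rfl⟩ := exists_vec z
    obtain ⟨x, hx⟩ := exists_gr_zero (d := d) c
    have h0 : x ∈ grFiltration (weight d) F 0 (-1) :=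
      h.gr_anti _ (show (-1 : ℤ) ≤ 0 by norm_num) (by rw [h.gr_zero_top]; trivial)
    rw [mem_gr_zero, hx] at h0
    obtain ⟨a₀, b₀, b₀', h0⟩ := h0
    obtain ⟨x, hx, hx'⟩ := exists_gr_neg_one (b - b₀) (b' - b₀')
    have h1 : x ∈ grFiltration (weight d) F (-1) (-1) := by rw [h.gr_neg_one_top]; trivial
    rw [mem_gr_neg_one, hx, hx'] at h1
    obtain ⟨a₁, h1⟩ := h1
    obtain ⟨x, hx⟩ := exists_gr_neg_two (d := d) (a - a₀ - a₁)
    have h2 : x ∈ grFiltration (weight d) F (-2) (-1) := by rw [h.gr_neg_two_top]; trivial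
    rw [mem_gr_neg_two, hx] at h2
    have h3 := add_mem (add_mem h0 h1) h2
    rw [← vec_add, ← vec_add] at h3
    convert h3 using 2
    · ring
    · abel
    · abel
    · ring
  rw [eq_top_iff, ← key]
  exact h.isMHS.hodge_anti (by omega)

lemma InD.gr_neg_two_bot {F : ℤ → Submodule ℂ (Cplx (Lat d))} (h : InD d F) :
    grFiltration (weight d) F (-2) 0 = ⊥ :=
  h.gr_eq_bot (q := -2) (by norm_num) (by simp)
    (grFiltration_eq_top _ (h.top (by norm_num)))

/-- Descending the weight filtration, a vector of `F^1` has zero component in each graded piece,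
since no Hodge type is left for it. -/
lemma InD.bot {F : ℤ → Submodule ℂ (Cplx (Lat d))} (h : InD d F) {p : ℤ} (hp : 0 < p) :
    F p = ⊥ := by
  have key : F 1 = ⊥ := by
    rw [eq_bot_iff]
    intro z hz
    obtain ⟨a, b, b', c, rfl⟩ := exists_vec z
    obtain ⟨x, hx⟩ := exists_gr_zero (d := d) c
    have h0 : x ∈ grFiltration (weight d) F 0 1 := by
      rw [mem_gr_zero, hx]
      exact ⟨a, b, b', hz⟩
    rw [h.gr_eq_bot (q := -1) (by norm_num) (by simp)
      (grFiltration_eq_top _ (h.top (by norm_num))), Submodule.mem_bot] at h0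
    obtain rfl : c = 0 := by rw [← hx, h0, map_zero]; rfl
    obtain ⟨x, hx, hx'⟩ := exists_gr_neg_one b b'
    have h1 : x ∈ grFiltration (weight d) F (-1) 1 := by
      rw [mem_gr_neg_one, hx, hx']
      exact ⟨a, hz⟩
    rw [h.gr_eq_bot (q := -2) (by norm_num) (by simp)
      (grFiltration_eq_top _ (h.top (by norm_num))), Submodule.mem_bot] at h1
    obtain rfl : b = 0 := by rw [← hx, h1, map_zero]; rfl
    obtain rfl : b' = 0 := by rw [← hx', h1, map_zero]; rfl
    obtain ⟨x, hx⟩ := exists_gr_neg_two (d := d) a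
    have h2 : x ∈ grFiltration (weight d) F (-2) 0 := by
      refine h.gr_anti _ (show (0 : ℤ) ≤ 1 by norm_num) ?_
      rw [mem_gr_neg_two, hx]
      exact hz
    rw [h.gr_neg_two_bot, Submodule.mem_bot] at h2
    obtain rfl : a = 0 := by rw [← hx, h2, map_zero]; rfl
    have := vec_smul (d := d) 0 0 0 0 0
    simpa using this
  rw [eq_bot_iff, ← key]
  exact h.isMHS.hodge_anti (by omega)

/-- The period matrix of the graded piece of weight `-1`. -/
lemma InD.exists_period {F : ℤ → Submodule ℂ (Cplx (Lat d))} (h : InD d F) :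
    ∃ τ : Siegel d, ∀ x, x ∈ grFiltration (weight d) F (-1) 0 ↔
      (grCoord d (-1) x).2.1 = tauMul τ (grCoord d (-1) x).2.2.1 := by
  set A := grFiltration (weight d) F (-1) with hA
  have hmem0 : ∀ x, x ∈ hodgePiece A 0 (-1) ↔ x ∈ A 0 := by
    intro x
    rw [mem_hodgePiece, hA, h.gr_neg_one_top]
    simp
  have hmem1 : ∀ x, x ∈ hodgePiece A (-1) 0 ↔ cconj _ x ∈ A 0 := by
    intro x
    rw [mem_hodgePiece, hA, h.gr_neg_one_top]
    simp
  have hpos : ∀ x ∈ A 0, x ≠ 0 →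
      0 < (∑ j, (grCoord d (-1) x).2.1 j * star ((grCoord d (-1) x).2.2.1 j)).im := by
    intro x hx hx0
    have h1 := (h.polarised.pos 0 x ((hmem0 x).2 hx) hx0).1
    rw [zpow_zero, one_mul, pairingC_cconj, Complex.ofReal_re] at h1
    exact pos_of_mul_pos_right h1 (by positivity)
  have hiso : ∀ x ∈ A 0, ∀ y ∈ A 0, ∑ j, ((grCoord d (-1) x).2.2.1 j * (grCoord d (-1) y).2.1 j -
        (grCoord d (-1) x).2.1 j * (grCoord d (-1) y).2.2.1 j) = 0 := by
    intro x hx y hy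
    have h1 := h.polarised.morphism 0 0 (by norm_num) x ((hmem0 x).2 hx) y ((hmem0 y).2 hy)
    rw [pairingC_grPairing] at h1
    exact (mul_eq_zero.1 h1).resolve_left Complex.two_pi_I_ne_zero
  let low : Cplx (Gr (weight d) (-1)) →ₗ[ℂ] (Fin d → ℂ) :=
    LinearMap.fst ℂ _ _ ∘ₗ LinearMap.snd ℂ _ _ ∘ₗ LinearMap.snd ℂ _ _ ∘ₗ grCoord d (-1)
  let up : Cplx (Gr (weight d) (-1)) →ₗ[ℂ] (Fin d → ℂ) :=
    LinearMap.fst ℂ _ _ ∘ₗ LinearMap.snd ℂ _ _ ∘ₗ grCoord d (-1)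
  have hlow : ∀ x, low x = (grCoord d (-1) x).2.2.1 := fun _ => rfl
  have hup : ∀ x, up x = (grCoord d (-1) x).2.1 := fun _ => rfl
  have hzero : ∀ x ∈ A 0, low x = 0 → x = 0 := by
    intro x hx hx'
    by_contra hx0
    have := hpos x hx hx0
    rw [hlow] at hx'
    rw [hx'] at this
    simp at this
  let equiv : Cplx (Gr (weight d) (-1)) ≃ₗ[ℂ] (Fin d → ℂ) × (Fin d → ℂ) :=
    LinearEquiv.ofBijective (up.prod low) ⟨fun x y hxy => gr_neg_one_ext (Prod.mk.inj hxy).1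
      (Prod.mk.inj hxy).2, fun y => by
        obtain ⟨x, h1, h2⟩ := exists_gr_neg_one y.1 y.2
        exact ⟨x, Prod.ext h1 h2⟩⟩
  have hfin : Module.Finite ℂ (Cplx (Gr (weight d) (-1))) := Module.Finite.equiv equiv.symm
  have hrank : Module.finrank ℂ (Cplx (Gr (weight d) (-1))) = d + d := by
    rw [equiv.finrank_eq, Module.finrank_prod, Module.finrank_fin_fun]
  -- Positivity makes the lower coordinates injective on `H^{0,-1}`, and conjugation transfers this
  -- to `H^{-1,0}`. Both dimensions are at most `d` and their sum is `2d`, so `F^0` is a graph over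
  -- the lower coordinates.
  have hinj0 : Function.Injective (low ∘ₗ (hodgePiece A 0 (-1)).subtype) := by
    rw [← LinearMap.ker_eq_bot, LinearMap.ker_eq_bot']
    intro x hx
    exact Subtype.ext (hzero x.1 ((hmem0 _).1 x.2) hx)
  have hinj1 : Function.Injective (low ∘ₗ (hodgePiece A (-1) 0).subtype) := by
    rw [← LinearMap.ker_eq_bot, LinearMap.ker_eq_bot']
    intro x hx
    have h1 : low (cconj _ x.1) = 0 := by
      rw [hlow, grCoord_cconj]
      change star (low x.1) = 0
      rw [show low x.1 = 0 from hx, star_zero]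
    have h2 := hzero _ ((hmem1 _).1 x.2) h1
    refine Subtype.ext ?_
    rw [← cconj_cconj x.1, h2, map_zero]
    rfl
  have hle0 := LinearMap.finrank_le_finrank_of_injective hinj0
  have hle1 := LinearMap.finrank_le_finrank_of_injective hinj1
  have hadd := Submodule.finrank_add_eq_of_isCompl h.isCompl
  rw [← hA] at hadd
  rw [Module.finrank_fin_fun] at hle0 hle1
  rw [hrank] at hadd
  have hsurj : Function.Surjective (low ∘ₗ (hodgePiece A 0 (-1)).subtype) :=
    (LinearMap.injective_iff_surjective_of_finrank_eq_finrank
      (by rw [Module.finrank_fin_fun]; omega)).1 hinj0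
  have hsec : ∀ b, ∃ x ∈ A 0, low x = b := by
    intro b
    obtain ⟨x, hx⟩ := hsurj b
    exact ⟨x.1, (hmem0 _).1 x.2, hx⟩
  choose σ hσ hσb using fun j => hsec (Pi.single j 1)
  let t : Fin d → Fin d → ℂ := fun i j => up (σ j) i
  have hgraph : ∀ x ∈ A 0, ∀ i, up x i = ∑ j, t i j * low x j := by
    intro x hx i
    have h1 : x - ∑ j, low x j • σ j = 0 := by
      refine hzero _ (sub_mem hx (sum_mem fun j _ => Submodule.smul_mem _ _ (hσ j))) ?_
      rw [map_sub, map_sum]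
      simp only [map_smul, hσb]
      rw [sub_eq_zero]
      ext i
      simp [Pi.single_apply]
    rw [sub_eq_zero] at h1
    conv_lhs => rw [h1, map_sum]
    simp only [map_smul, Finset.sum_apply, Pi.smul_apply, smul_eq_mul, t]
    exact Finset.sum_congr rfl fun j _ => mul_comm _ _
  -- Isotropy of `F^0`, tested on `σ i` and `σ j`.
  have hsymm : ∀ i j, t i j = t j i := by
    intro i j
    have h1 := hiso (σ i) (hσ i) (σ j) (hσ j)
    simp only [← hlow, ← hup, hσb] at h1
    rw [Finset.sum_sub_distrib] at h1
    simp [Pi.single_apply] at h1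
    exact sub_eq_zero.1 h1
  -- Positivity of the polarisation, tested on vectors with real lower coordinates.
  have hpd : (Matrix.of fun i j => (t i j).im).PosDef := by
    rw [Matrix.posDef_iff_dotProduct_mulVec]
    refine ⟨?_, fun {y} hy => ?_⟩
    · ext i j
      simp [hsymm i j]
    · obtain ⟨x, hx, hxb⟩ := hsec fun i => (y i : ℂ)
      have hx0 : x ≠ 0 := by
        rintro rfl
        apply hy
        ext i
        have := congrFun hxb i
        rw [map_zero] at this
        exact Complex.ofReal_eq_zero.1 this.symm
      have h1 := hpos x hx hx0
      simp only [← hlow, ← hup, hgraph x hx] at h1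
      rw [im_sum_mul_star hsymm, hxb] at h1
      simpa [dotProduct, Matrix.mulVec, Finset.mul_sum, mul_assoc] using h1
  refine ⟨⟨⟨t, hsymm⟩, hpd⟩, fun x => ⟨fun hx => funext (hgraph x hx), fun hx => ?_⟩⟩
  obtain ⟨y, hy, hyb⟩ := hsec (low x)
  have : x = y := by
    refine gr_neg_one_ext ?_ hyb.symm
    rw [hx]
    ext i
    rw [← hup, hgraph y hy, hyb]
    rfl
  rw [this]
  exact hy

/-- Lifting the graph of `τ` and a generator of `Gr_0` to `F^0` gives the columns, the last one
after clearing its lower block. They span because `F^0` induces zero on `Gr_{-2}` and only the graph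
of `τ` on `Gr_{-1}`. -/
lemma InD.exists_eq_stdFil {F : ℤ → Submodule ℂ (Cplx (Lat d))} (h : InD d F) :
    ∃ x : Coord d, F = stdFil x := by
  obtain ⟨τ, hτ⟩ := h.exists_period
  have hu : ∀ j : Fin d, ∃ a, vec d a (fun i => ent τ i j) (Pi.single j 1) 0 ∈ F 0 := by
    intro j
    obtain ⟨x, hx, hx'⟩ := exists_gr_neg_one (fun i => ent τ i j) (Pi.single j 1)
    have h1 := (hτ x).2 (by rw [hx, hx', tauMul_single])
    rw [mem_gr_neg_one, hx, hx'] at h1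
    exact h1
  choose u hu using hu
  obtain ⟨x, hx⟩ := exists_gr_zero (d := d) 1
  have h0 : x ∈ grFiltration (weight d) F 0 0 := by rw [h.gr_zero_top]; trivial
  rw [mem_gr_zero, hx] at h0
  obtain ⟨a, b, b', h0⟩ := h0
  let y₀ : Coord d := (τ, u, 0, 0)
  have hcol0 : ∀ e, colVec y₀ e 0 ∈ F 0 := by
    intro e
    have h1 : (e, (0 : ℂ)) = ∑ j, e j • ((Pi.single j 1, 0) : (Fin d → ℂ) × ℂ) := by
      refine Prod.ext ?_ ?_
      · ext i
        simp [Prod.fst_sum, Pi.single_apply]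
      · simp [Prod.snd_sum]
    rw [← colL_apply, h1, map_sum]
    refine sum_mem fun j _ => ?_
    rw [map_smul, colL_apply, colVec_single]
    exact Submodule.smul_mem _ _ (hu j)
  have h1 := sub_mem h0 (hcol0 b')
  have h2 : vec d (a - u ⬝ᵥ b') (b - tauMul τ b') 0 1 ∈ F 0 := by
    convert h1 using 1
    rw [eq_sub_iff_add_eq, colVec, ← vec_add]
    congr 1 <;> simp [y₀]
  let y : Coord d := (τ, u, b - tauMul τ b', a - u ⬝ᵥ b')
  have hcol : ∀ e c, colVec y e c ∈ F 0 := by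
    intro e c
    have h3 := add_mem (hcol0 e) (Submodule.smul_mem _ c h2)
    rw [← vec_smul, colVec, ← vec_add] at h3
    convert h3 using 1
    rw [colVec]
    congr 1 <;> simp [y, y₀]
  refine ⟨y, funext fun p => ?_⟩
  rcases lt_trichotomy p 0 with hp | rfl | hp
  · rw [h.top hp, stdFil_neg y hp]
  · rw [stdFil_zero]
    refine le_antisymm ?_ ?_
    · intro z hz
      obtain ⟨a, b, b', c, rfl⟩ := exists_vec z
      -- Subtracting the combination of columns with the same lower blocks leaves a vector of the
      -- graph with lower block `0`, hence a vector of `W_{-2}`, where `F^0` is zero.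
      have h3 := sub_mem hz (hcol b' c)
      have h4 : vec d a b b' c - colVec y b' c =
          vec d (a - (y.2.1 ⬝ᵥ b' + c * y.2.2.2)) (b - (tauMul y.1 b' + c • y.2.2.1)) 0 0 := by
        rw [sub_eq_iff_eq_add, colVec, ← vec_add]
        congr 1 <;> simp
      rw [h4] at h3
      obtain ⟨x, hx, hx'⟩ := exists_gr_neg_one (b - (tauMul y.1 b' + c • y.2.2.1)) 0
      have h5 : x ∈ grFiltration (weight d) F (-1) 0 := by
        rw [mem_gr_neg_one, hx, hx']
        exact ⟨_, h3⟩
      rw [hτ, hx, hx', map_zero] at h5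
      rw [h5] at h3
      obtain ⟨x, hx⟩ := exists_gr_neg_two (d := d) (a - (y.2.1 ⬝ᵥ b' + c * y.2.2.2))
      have h6 : x ∈ grFiltration (weight d) F (-2) 0 := by
        rw [mem_gr_neg_two, hx]
        exact h3
      rw [h.gr_neg_two_bot, Submodule.mem_bot] at h6
      have h7 : a - (y.2.1 ⬝ᵥ b' + c * y.2.2.2) = 0 := by rw [← hx, h6, map_zero]; rfl
      rw [mem_colSpace]
      exact ⟨sub_eq_zero.1 h7, sub_eq_zero.1 h5⟩
    · rw [colSpace_eq_range]
      rintro _ ⟨⟨e, c⟩, rfl⟩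
      exact hcol e c
  · rw [h.bot hp, stdFil_pos y hp]

/-- A vector of the column space is determined by its two lower blocks, and those of the columns are
the same for all period matrices. -/
lemma stdFil_injective : Function.Injective (stdFil : Coord d → ℤ → Submodule ℂ (Cplx (Lat d))) := by
  rintro ⟨τ, u, v, w⟩ ⟨τ', u', v', w'⟩ h
  have h0 := congrFun h 0
  rw [stdFil_zero, stdFil_zero] at h0
  have h1 : ∀ j, vec d (u j) (fun i => ent τ i j) (Pi.single j 1) 0 ∈
      colSpace d (τ', u', v', w') := by
    intro j
    rw [← h0]
    exact Submodule.subset_span (.inl ⟨j, rfl⟩)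
  have h2 : vec d w v 0 1 ∈ colSpace d (τ', u', v', w') := by
    rw [← h0]
    exact Submodule.subset_span (.inr rfl)
  simp only [mem_colSpace, tauMul_single, dotProduct_single, mul_one, zero_mul, add_zero,
    zero_smul, dotProduct_zero, one_mul, zero_add, map_zero, one_smul] at h1 h2
  obtain rfl : u = u' := funext fun j => (h1 j).1
  obtain ⟨rfl, rfl⟩ := h2
  obtain rfl : τ = τ' := Subtype.ext (Subtype.ext (funext fun i => funext fun j =>
    congrFun (h1 j).2 i))
  rfl

/-- The parametrisation of the period domain. -/
def periodEquiv (d : ℕ) : Coord d ≃ D d :=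
  Equiv.ofBijective (fun x => ⟨stdFil x, inD_stdFil x⟩)
    ⟨fun _ _ h => stdFil_injective (congrArg Subtype.val h), fun F => by
      obtain ⟨x, hx⟩ := F.2.exists_eq_stdFil
      exact ⟨x, Subtype.ext hx.symm⟩⟩

end PeriodDomain

/-! ### The Heisenberg group acts by `moveCoord` -/

section HeisenbergAction

variable {d : ℕ}

/-- The element of the Heisenberg group with given entries. -/
lemma exists_heisenberg (x y : Mid d) (z : ℤ) : ∃ g ∈ heisenberg d, ∀ m : Lat d,
    g m = (m.1 + (∑ k, x k * m.2.1 k + z * m.2.2) • tateGen, m.2.1 + m.2.2 • y, m.2.2) := by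
  let f : ∀ (_x _y : Mid d) (_z : ℤ), Lat d →ₗ[ℤ] Lat d := fun x y z =>
    (AddMonoidHom.mk' (fun m : Lat d => ((m.1 + (∑ k, x k * m.2.1 k + z * m.2.2) • tateGen,
      m.2.1 + m.2.2 • y, m.2.2) : Lat d)) fun m m' => by
        refine Prod.ext ?_ (Prod.ext ?_ rfl)
        · simp only [Prod.fst_add, Prod.snd_add, Pi.add_apply, mul_add, Finset.sum_add_distrib,
            add_smul]
          abel
        · simp only [Prod.fst_add, Prod.snd_add, add_smul]
          abel).toIntLinearMap
  have hf : ∀ x y z m, f x y z m = (m.1 + (∑ k, x k * m.2.1 k + z * m.2.2) • tateGen,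
    m.2.1 + m.2.2 • y, m.2.2) := fun _ _ _ _ => rfl
  have hff : ∀ x y z m, f (-x) (-y) (-z + ∑ k, x k * y k) (f x y z m) = m := by
    intro x y z m
    rw [hf, hf]
    refine Prod.ext ?_ (Prod.ext ?_ rfl)
    · simp only [add_assoc, ← add_smul]
      rw [add_eq_left]
      convert zero_smul ℤ tateGen using 2
      simp only [Pi.add_apply, Pi.smul_apply, Pi.neg_apply, smul_eq_mul, mul_add, add_mul,
        Finset.sum_add_distrib, Finset.sum_mul, neg_mul, Finset.sum_neg_distrib]
      have : ∑ k, x k * (m.2.2 * y k) = ∑ k, x k * y k * m.2.2 :=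
        Finset.sum_congr rfl fun _ _ => by ring
      rw [this]; ring
    · simp
  have hff' : ∀ x y z m, f x y z (f (-x) (-y) (-z + ∑ k, x k * y k) m) = m := by
    intro x y z m
    have := hff (-x) (-y) (-z + ∑ k, x k * y k) m
    simp only [neg_neg, Pi.neg_apply, neg_mul_neg] at this
    rwa [show -(-z + ∑ k, x k * y k) + ∑ k, x k * y k = z by ring] at this
  refine ⟨LinearEquiv.ofLinearMap (f x y z) (f (-x) (-y) (-z + ∑ k, x k * y k))
    (LinearMap.ext (hff' x y z)) (LinearMap.ext (hff x y z)), ⟨x, y, z, fun m => rfl⟩, fun m => rfl⟩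

lemma coordEquiv_heisenberg {g : Lat d ≃ₗ[ℤ] Lat d} {x y : Mid d} {z : ℤ} (hg : ∀ m : Lat d,
    g m = (m.1 + (∑ k, x k * m.2.1 k + z * m.2.2) • tateGen, m.2.1 + m.2.2 • y, m.2.2))
    (a : ℂ) (b b' : Fin d → ℂ) (c : ℂ) :
    (g : Lat d →ₗ[ℤ] Lat d).baseChange ℂ (vec d a b b' c) =
      vec d (a + 2 * Real.pi * Complex.I * (dotZ (fun j => x (Sum.inl j)) b +
        dotZ (fun j => x (Sum.inr j)) b' + z * c))
        (b + c • fun j => (y (Sum.inl j) : ℂ)) (b' + c • fun j => (y (Sum.inr j) : ℂ)) c := by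
  have key : ∀ v : Cplx (Lat d), coordEquiv d ((g : Lat d →ₗ[ℤ] Lat d).baseChange ℂ v) =
      ((coordEquiv d v).1 + 2 * Real.pi * Complex.I *
        (dotZ (fun j => x (Sum.inl j)) (coordEquiv d v).2.1 +
          dotZ (fun j => x (Sum.inr j)) (coordEquiv d v).2.2.1 + z * (coordEquiv d v).2.2.2),
        (coordEquiv d v).2.1 + (coordEquiv d v).2.2.2 • fun j => (y (Sum.inl j) : ℂ),
        (coordEquiv d v).2.2.1 + (coordEquiv d v).2.2.2 • fun j => (y (Sum.inr j) : ℂ),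
        (coordEquiv d v).2.2.2) := by
    intro v
    induction v using TensorProduct.induction_on with
    | zero =>
      simp only [map_zero, Prod.fst_zero, Prod.snd_zero, dotZ_zero, mul_zero, add_zero, zero_smul]
      rfl
    | tmul s m =>
      rw [LinearMap.baseChange_tmul, coordEquiv_tmul, coordEquiv_tmul]
      change s • latCoord (g m) = _
      rw [hg, latCoord_apply, latCoord_apply]
      refine Prod.ext ?_ (Prod.ext ?_ (Prod.ext ?_ rfl))
      · simp only [Prod.smul_mk, smul_eq_mul, AddSubgroup.coe_add, AddSubgroupClass.coe_zsmul,
          coe_tateGen, zsmul_eq_mul, Fintype.sum_sum_type, dotZ, Pi.smul_apply]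
        push_cast
        have e : ∀ (x m : Fin d → ℤ), ∑ j, (x j : ℂ) * (s * (m j : ℂ)) =
            s * ∑ j, (x j : ℂ) * (m j : ℂ) := fun x m => by
          rw [Finset.mul_sum]
          exact Finset.sum_congr rfl fun j _ => by ring
        rw [e (fun j => x (Sum.inl j)) fun j => m.2.1 (Sum.inl j),
          e (fun j => x (Sum.inr j)) fun j => m.2.1 (Sum.inr j)]
        ring
      · ext j
        simp
        ring
      · ext j
        simp
        ring
    | add v v' hv hv' =>
      rw [map_add, map_add, hv, hv', map_add]
      refine Prod.ext ?_ (Prod.ext ?_ (Prod.ext ?_ rfl))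
      · simp only [Prod.fst_add, Prod.snd_add, dotZ_add]
        ring
      · simp only [Prod.fst_add, Prod.snd_add, add_smul]
        abel
      · simp only [Prod.fst_add, Prod.snd_add, add_smul]
        abel
  apply (coordEquiv d).injective
  rw [key, coordEquiv_vec, coordEquiv_vec]

/-- The coordinates of an element of the Heisenberg group. -/
def heisCoord (x y : Mid d) (z : ℤ) :
    ((Fin d → ℤ) × (Fin d → ℤ)) × ((Fin d → ℤ) × (Fin d → ℤ)) × ℤ :=
  ((fun j => y (Sum.inl j), fun j => y (Sum.inr j)),
    (fun j => x (Sum.inr j), fun j => -x (Sum.inl j)), z)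

/-- The matrix gives the last column the lower block `y₂`. Subtracting the corresponding combination
of the other columns restores the normal form, and produces the term `τ y₂` in `v` and the pairing
with `y₂` in `w`. -/
lemma baseChange_colVec {g : Lat d ≃ₗ[ℤ] Lat d} {x y : Mid d} {z : ℤ} (hg : ∀ m : Lat d,
    g m = (m.1 + (∑ k, x k * m.2.1 k + z * m.2.2) • tateGen, m.2.1 + m.2.2 • y, m.2.2))
    (X : Coord d) (b : Fin d → ℂ) (c : ℂ) :
    (g : Lat d →ₗ[ℤ] Lat d).baseChange ℂ (colVec X b c) =
      colVec (moveCoord 1 (heisCoord x y z) X) (b + c • fun j => (y (Sum.inr j) : ℂ)) c := by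
  obtain ⟨τ, u, v, w⟩ := X
  rw [colVec, coordEquiv_heisenberg hg, colVec]
  have hscale : dualScale 1 = 2 * Real.pi * Complex.I := div_one _
  set y₁ : Fin d → ℂ := fun j => (y (Sum.inl j) : ℂ)
  set y₂ : Fin d → ℂ := fun j => (y (Sum.inr j) : ℂ)
  set x₁ : Fin d → ℂ := fun j => (x (Sum.inl j) : ℂ)
  set x₂ : Fin d → ℂ := fun j => (x (Sum.inr j) : ℂ)
  have hv : latPt 1 τ (heisCoord x y z).1 = y₁ - tauMul τ y₂ := by
    ext i
    simp [latPt, heisCoord, tauMul_apply, y₁, y₂]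
  have hu : latPt (2 * Real.pi * Complex.I) τ (heisCoord x y z).2.1 =
      (2 * Real.pi * Complex.I) • (x₂ + tauMul τ x₁) := by
    ext i
    simp [latPt, heisCoord, tauMul_apply, x₁, x₂]
  have h1 : ∀ e : Fin d → ℂ, dotZ (fun j => x (Sum.inl j)) e = x₁ ⬝ᵥ e := fun _ => rfl
  have h2 : ∀ e : Fin d → ℂ, dotZ (fun j => x (Sum.inr j)) e = x₂ ⬝ᵥ e := fun _ => rfl
  have h3 : ∀ e : Fin d → ℂ, dotZ (heisCoord x y z).2.1.2 e = -(x₁ ⬝ᵥ e) := by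
    intro e
    simp [dotZ, heisCoord, dotProduct, x₁]
  have h4 : ∀ e : Fin d → ℂ, dotZ (heisCoord x y z).1.2 e = e ⬝ᵥ y₂ := by
    intro e
    rw [dotProduct_comm]
    rfl
  simp only [moveCoord, hscale, hv, hu, h1, h2, h3, h4]
  congr 1
  · simp only [heisCoord, dotProduct_add, add_dotProduct, dotProduct_smul, smul_dotProduct,
      smul_eq_mul, dotProduct_tauMul]
    ring
  · rw [map_add, map_smul, smul_add, smul_sub]
    abel

lemma baseChange_surjective (g : Lat d ≃ₗ[ℤ] Lat d) :
    Function.Surjective ((g : Lat d →ₗ[ℤ] Lat d).baseChange ℂ) := by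
  intro v
  refine ⟨(g.symm : Lat d →ₗ[ℤ] Lat d).baseChange ℂ v, ?_⟩
  rw [← LinearMap.comp_apply, ← LinearMap.baseChange_comp, LinearEquiv.comp_symm,
    LinearMap.baseChange_id]
  rfl

lemma moveFiltration_stdFil {g : Lat d ≃ₗ[ℤ] Lat d} {x y : Mid d} {z : ℤ} (hg : ∀ m : Lat d,
    g m = (m.1 + (∑ k, x k * m.2.1 k + z * m.2.2) • tateGen, m.2.1 + m.2.2 • y, m.2.2))
    (X : Coord d) :
    moveFiltration d g (stdFil X) = stdFil (moveCoord 1 (heisCoord x y z) X) := by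
  funext p
  rw [moveFiltration]
  rcases lt_trichotomy p 0 with hp | rfl | hp
  · rw [stdFil_neg X hp, stdFil_neg _ hp, Submodule.map_top,
      LinearMap.range_eq_top.2 (baseChange_surjective g)]
  · rw [stdFil_zero, stdFil_zero, colSpace_eq_range, colSpace_eq_range]
    have key := baseChange_colVec hg X
    generalize moveCoord 1 (heisCoord x y z) X = X' at key ⊢
    generalize (g : Lat d →ₗ[ℤ] Lat d).baseChange ℂ = G at key ⊢
    ext v
    simp only [Submodule.mem_map, LinearMap.mem_range, Prod.exists, colL_apply]
    constructor
    · rintro ⟨_, ⟨b, c, rfl⟩, rfl⟩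
      exact ⟨_, c, (key b c).symm⟩
    · rintro ⟨b, c, rfl⟩
      refine ⟨_, ⟨b - c • fun j => (y (Sum.inr j) : ℂ), c, rfl⟩, ?_⟩
      rw [key, sub_add_cancel]
  · rw [stdFil_pos X hp, stdFil_pos _ hp, Submodule.map_bot]

/-- The Heisenberg group acts on the period domain. -/
lemma InD.moveFiltration {g : Lat d ≃ₗ[ℤ] Lat d} (hg : g ∈ heisenberg d)
    {F : ℤ → Submodule ℂ (Cplx (Lat d))} (h : InD d F) : InD d (moveFiltration d g F) := by
  obtain ⟨X, rfl⟩ := h.exists_eq_stdFil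
  obtain ⟨x, y, z, hg⟩ := hg
  rw [moveFiltration_stdFil hg]
  exact inD_stdFil _

/-- The quotient map in coordinates. -/
def periodQuot (X : Coord d) : QuotD d := toQuotD d (periodEquiv d X)

lemma periodQuot_surjective : Function.Surjective (periodQuot (d := d)) := by
  intro p
  obtain ⟨F, rfl⟩ := Quotient.mk_surjective p
  exact ⟨(periodEquiv d).symm F, congrArg (toQuotD d) ((periodEquiv d).apply_symm_apply F)⟩

lemma periodQuot_eq_iff (X Y : Coord d) :
    periodQuot X = periodQuot Y ↔ ∃ g, Y = moveCoord 1 g X := by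
  have h : periodQuot X = periodQuot Y ↔
      ∃ g ∈ heisenberg d, stdFil Y = PoincareTorsor.moveFiltration d g (stdFil X) :=
    @Quotient.eq _ (orbitSetoid d) _ _
  rw [h]
  constructor
  · rintro ⟨g, ⟨x, y, z, hg⟩, hXY⟩
    rw [moveFiltration_stdFil hg] at hXY
    exact ⟨_, stdFil_injective hXY⟩
  · rintro ⟨⟨m, n, z⟩, rfl⟩
    -- The entries are the preimage of `(m, n, z)` under `heisCoord`.
    obtain ⟨g, hg, hg'⟩ := exists_heisenberg (d := d)
      (Sum.elim (fun j => -n.2 j) n.1) (Sum.elim m.1 m.2) z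
    refine ⟨g, hg, ?_⟩
    rw [moveFiltration_stdFil hg']
    congr 2
    simp [heisCoord]

end HeisenbergAction

/-! ### The lattices of `A` and `B` in a common form -/

section Lattices

variable {d : ℕ}

lemma mem_latticeA (τ : Siegel d) (v : Fin d → ℂ) : v ∈ latticeA d τ ↔ ∃ m, v = latPt 1 τ m := by
  have h : ∀ m : (Fin d → ℤ) × (Fin d → ℤ),
      (fun i => (m.1 i : ℂ) - ∑ j, ent τ i j * (m.2 j : ℂ)) = latPt 1 τ m := by
    intro m
    ext i
    simp [latPt]
  constructor
  · rintro ⟨m, rfl⟩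
    exact ⟨m, h m⟩
  · rintro ⟨m, rfl⟩
    exact ⟨m, h m⟩

/-- By the symmetry of `τ`, the row `2πi (n₁ τ + n₂)` has the form of the other lattice with
parameters `(n₂, -n₁)`. -/
lemma mem_latticeB (τ : Siegel d) (u : Fin d → ℂ) :
    u ∈ latticeB d τ ↔ ∃ n, u = latPt (2 * Real.pi * Complex.I) τ n := by
  have h : ∀ n : (Fin d → ℤ) × (Fin d → ℤ),
      (fun j => 2 * (Real.pi : ℂ) * Complex.I * (∑ i, (n.1 i : ℂ) * ent τ i j + (n.2 j : ℂ))) =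
        latPt (2 * Real.pi * Complex.I) τ (n.2, -n.1) := by
    intro n
    ext j
    simp only [latPt, Pi.neg_apply, Int.cast_neg, mul_neg, Finset.sum_neg_distrib, sub_neg_eq_add]
    rw [add_comm]
    congr 2
    refine Finset.sum_congr rfl fun i _ => ?_
    rw [ent_symm, mul_comm]
  constructor
  · rintro ⟨n, rfl⟩
    exact ⟨_, h n⟩
  · rintro ⟨n, rfl⟩
    refine ⟨(-n.2, n.1), (h _).trans ?_⟩
    simp

end Lattices
end PoincareTorsor
end

noncomputable section
namespace PoincareTorsor
open Filter Topology

/-! ### Exchange of `u` and `v`, and the biextension -/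

section Symmetry

variable {d : ℕ} {κ : ℂ} {Λ Λ' : Siegel d → AddSubgroup (Fin d → ℂ)}

lemma dualScale_dualScale : dualScale (dualScale κ) = κ :=
  div_div_cancel₀ Complex.two_pi_I_ne_zero

/-- The exchange of `u` and `v`. -/
def swapCoord (x : Coord d) : Coord d := (x.1, x.2.2.1, x.2.1, x.2.2.2)

lemma contMDiff_swapCoord : ContMDiff (coordModel d) (coordModel d) ω (swapCoord (d := d)) :=
  contMDiff_fst.prodMk ((contMDiff_fst.comp (contMDiff_snd.comp contMDiff_snd)).prodMk
    ((contMDiff_fst.comp contMDiff_snd).prodMk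
      (contMDiff_snd.comp (contMDiff_snd.comp contMDiff_snd))))

/-- The exchange of `u` and `v` as a diffeomorphism. -/
def swapDiffeo (d : ℕ) : Diffeomorph (coordModel d) (coordModel d) (Coord d) (Coord d) ω where
  toFun := swapCoord
  invFun := swapCoord
  left_inv _ := rfl
  right_inv _ := rfl
  contMDiff_toFun := contMDiff_swapCoord
  contMDiff_invFun := contMDiff_swapCoord

/-- `moveCoord` translates `u` before pairing it, but not `v`, so the exchange leaves a discrepancy.
By the reciprocity `dotZ_latPt_sub` it is an integral multiple of `2πi`, which is absorbed in `z`.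
-/
lemma exists_moveCoord_swapCoord (hκ : κ ≠ 0)
    (g : ((Fin d → ℤ) × (Fin d → ℤ)) × ((Fin d → ℤ) × (Fin d → ℤ)) × ℤ) (x : Coord d) :
    ∃ g', swapCoord (moveCoord κ g (swapCoord x)) = moveCoord (dualScale κ) g' x := by
  obtain ⟨m, n, z⟩ := g
  obtain ⟨τ, a, b, w⟩ := x
  refine ⟨(n, m, z - ∑ i, (m.2 i * n.1 i - n.2 i * m.1 i)), ?_⟩
  have h := dotZ_latPt_sub κ (dualScale κ) τ m n
  have h1 : κ * dualScale κ = 2 * Real.pi * Complex.I := mul_div_cancel₀ _ hκ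
  rw [h1] at h
  simp only [moveCoord, swapCoord, dualScale_dualScale]
  refine Prod.ext rfl (Prod.ext rfl (Prod.ext rfl ?_))
  simp only [dotZ_add]
  rw [Int.cast_sub]
  linear_combination -h

variable [TopologicalSpace (Total Λ')] [ChartedSpace (SymMat d × (Fin d → ℂ)) (Total Λ')]
  {P : Type*} [TopologicalSpace P] [ChartedSpace (CoordSpace d) P] {q : Coord d → P}

namespace PoincareChart

/-- The coordinates with `u` and `v` exchanged. -/
lemma swap (h : PoincareChart κ Λ Λ' q) [TopologicalSpace (Total Λ)]
    [ChartedSpace (SymMat d × (Fin d → ℂ)) (Total Λ)]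
    (hΛ : IsLocalDiffeomorph (famModel d) 𝓘(ℂ, SymMat d × (Fin d → ℂ)) ω
      (fun x : Siegel d × (Fin d → ℂ) => Total.cls Λ x.1 x.2)) :
    PoincareChart (dualScale κ) Λ' Λ (fun x => q (swapCoord x)) where
  scale_ne := h.dualScale_ne
  mem_iff := h.mem_dual_iff
  mem_dual_iff := by
    rw [dualScale_dualScale]
    exact h.mem_iff
  cls_localDiffeo := hΛ
  surjective := h.surjective.comp fun x => ⟨swapCoord x, rfl⟩
  localDiffeo x := ((swapDiffeo d).isLocalDiffeomorph x).comp _ _ (h.localDiffeo (swapCoord x))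
  rel x y := by
    rw [h.rel]
    constructor
    · rintro ⟨g, hg⟩
      obtain ⟨g', hg'⟩ := exists_moveCoord_swapCoord h.scale_ne g x
      exact ⟨g', by rw [← hg', ← hg]; rfl⟩
    · rintro ⟨g, rfl⟩
      obtain ⟨g', hg'⟩ := exists_moveCoord_swapCoord h.dualScale_ne g (swapCoord x)
      rw [dualScale_dualScale] at hg'
      exact ⟨g', hg'⟩

variable (h : PoincareChart κ Λ Λ' q)

include h

lemma exists_eq_of_proj_eq {e : P} {τ : Siegel d} {u : Fin d → ℂ}
    (he : h.proj e = Total.cls Λ' τ u) : ∃ v w, e = q (τ, u, v, w) := by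
  obtain ⟨⟨τ', u', v, w⟩, rfl⟩ := h.surjective e
  rw [h.proj_apply] at he
  obtain ⟨rfl, hu⟩ := cls_eq_cls_iff.1 he
  obtain ⟨n, hn⟩ := (h.mem_dual_iff _ _).1 hu
  refine ⟨v, w - dualScale κ * dotZ n.2 v, ?_⟩
  rw [eq_add_of_sub_eq' hn, h.shift, sub_add_cancel]

lemma exists_eq_of_sub_mem {τ : Siegel d} {u v v' : Fin d → ℂ} (w : ℂ) (hv : v' - v ∈ Λ τ) :
    ∃ w', q (τ, u, v, w) = q (τ, u, v', w') := by
  obtain ⟨m, hm⟩ := (h.mem_iff _ _).1 hv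
  refine ⟨w - κ * dotZ m.2 u, h.eq_iff.2 ⟨m, hm, ?_⟩⟩
  rw [show κ * dotZ m.2 u + (w - κ * dotZ m.2 u - w) = 0 by ring, expU_zero]

lemma fibAdd_proj (τ : Siegel d) (u v v' : Fin d → ℂ) (w w' : ℂ) :
    letI := h.fibGroup
    fibAdd h.proj (q (τ, u, v, w)) (q (τ, u, v', w')) = q (τ, u, v + v', w + w') := by
  let _ := h.fibGroup
  have h1 : ∀ v w, h.proj (q (τ, u, v, w)) = Total.cls Λ' τ u := fun v w => h.proj_apply _
  exact (fibAdd_val h.proj ⟨_, h1 v w⟩ ⟨_, h1 v' w'⟩).trans (h.add_val _ _ rfl rfl)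

variable [IsManifold 𝓘(ℂ, SymMat d × (Fin d → ℂ)) ω (Total Λ')]
  [IsManifold 𝓘(ℂ, CoordSpace d) ω P]

lemma extension_π (x : Coord d) : h.extension.π (q x) = Total.cls Λ' x.1 x.2.1 :=
  h.proj_apply x

lemma extension_act (c : ℂ) (τ : Siegel d) (u v : Fin d → ℂ) (w : ℂ) :
    h.extension.act (expU c) (q (τ, u, v, w)) = q (τ, u, v, w + c) :=
  (h.inc_add_val _ rfl c).trans (by rw [add_comm])

lemma extension_fibAdd (τ : Siegel d) (u v v' : Fin d → ℂ) (w w' : ℂ) :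
    fibAdd h.extension.π (q (τ, u, v, w)) (q (τ, u, v', w')) = q (τ, u, v + v', w + w') :=
  h.fibAdd_proj τ u v v' w w'

lemma extension_torusPoint (x : Coord d) :
    h.extension.torusPoint (Λ := Λ) (β := Total.base) (q x) = Total.cls Λ x.1 x.2.2.1 := by
  have key : ∀ (b : Total Λ') (e : ↥(h.proj ⁻¹' {b})), e.1 = q x →
      (⟨b.base, h.torusHom b e⟩ : Total Λ) = Total.cls Λ x.1 x.2.2.1 := by
    intro b e he
    rw [h.torusHom_val e he]
    obtain rfl := h.base_eq e he
    rfl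
  exact key _ _ rfl

end PoincareChart

variable [TopologicalSpace (Total Λ)] [ChartedSpace (SymMat d × (Fin d → ℂ)) (Total Λ)]
  [IsManifold 𝓘(ℂ, SymMat d × (Fin d → ℂ)) ω (Total Λ)]
  [IsManifold 𝓘(ℂ, SymMat d × (Fin d → ℂ)) ω (Total Λ')]
  [IsManifold 𝓘(ℂ, CoordSpace d) ω P]

/-- The two extensions defined by the coordinates `(τ, u, v, w)` form a Poincaré torsor. -/
theorem PoincareChart.isPoincareTorsor (h : PoincareChart κ Λ Λ' q)
    (h' : PoincareChart (dualScale κ) Λ' Λ (fun x => q (swapCoord x))) :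
    IsPoincareTorsor.{u} (SymMat d) Λ Λ' h.extension h'.extension where
  base e := by
    obtain ⟨x, rfl⟩ := h.surjective e
    exact (h'.extension_π (swapCoord x)).trans (h.extension_torusPoint x).symm
  base' e := by
    obtain ⟨x, rfl⟩ := h.surjective e
    exact (h.extension_π x).trans (h'.extension_torusPoint (swapCoord x)).symm
  act_eq z e := by
    obtain ⟨⟨τ, u, v, w⟩, rfl⟩ := h.surjective e
    obtain ⟨c, rfl⟩ := expU_surjective z
    exact (h.extension_act c τ u v w).trans (h'.extension_act c τ v u w).symm
  interchange p p₁ p₂ p₃ h1 h2 h3 h4 := by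
    obtain ⟨⟨τ, u, v, w⟩, rfl⟩ := h.surjective p
    have hp : ∀ (τ : Siegel d) (u v : Fin d → ℂ) (w : ℂ),
      h'.extension.π (q (τ, u, v, w)) = Total.cls Λ τ v := fun τ u v w =>
        h'.extension_π (τ, v, u, w)
    have hp₁ : ∃ v' w₁, p₁ = q (τ, u, v', w₁) :=
      h.exists_eq_of_proj_eq (h1.symm.trans (h.extension_π _))
    obtain ⟨v', w₁, rfl⟩ := hp₁
    have hp₂ : ∃ u' w₂, p₂ = q (τ, u', v, w₂) :=
      h'.exists_eq_of_proj_eq (h3.symm.trans (hp τ u v w))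
    obtain ⟨u', w₂, rfl⟩ := hp₂
    have hp₃ : ∃ v'' w₃, p₃ = q (τ, u', v'', w₃) :=
      h.exists_eq_of_proj_eq (h2.symm.trans (h.extension_π _))
    obtain ⟨v'', w₃, rfl⟩ := hp₃
    rw [hp, hp] at h4
    -- Only the classes of `v'` and `v''` agree, so the last point is rewritten with `v'`. Both
    -- sides are then computed by adding coordinates.
    obtain ⟨w₄, hw₄⟩ := h.exists_eq_of_sub_mem (u := u') w₃ (cls_eq_iff.1 h4.symm)
    have ha : ∀ (τ : Siegel d) (u u' v : Fin d → ℂ) (w w' : ℂ),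
      fibAdd h'.extension.π (q (τ, u, v, w)) (q (τ, u', v, w')) = q (τ, u + u', v, w + w') :=
        fun τ u u' v w w' => h'.extension_fibAdd τ v u u' w w'
    rw [hw₄, h.extension_fibAdd, h.extension_fibAdd, ha, ha, ha, h.extension_fibAdd,
      add_add_add_comm w w₁]
  universal := h.isUniversalExtension
  universal' := h'.isUniversalExtension

end Symmetry
end PoincareTorsor
end

/-! ### The theorem -/

open PoincareTorsor in
theorem mainTheorem9 (d : ℕ) (hd : 1 ≤ d) :
    -- `P^u(ℤ)` acts on `D`
    (∀ g ∈ heisenberg d, ∀ F, InD d F → InD d (moveFiltration d g F)) ∧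
    -- the parametrisation of `D`, through which `D` is a complex manifold
    ∃ φ : Coord d ≃ D d, (∀ x, (φ x).1 0 = colSpace d x) ∧
    -- the complex structures of `P^u(ℤ) \ D` and of the universal families of `A_τ` and `B_τ`
    ∃ (_ : TopologicalSpace (QuotD d))
      (_ : ChartedSpace (SymMat d × (Fin d → ℂ) × (Fin d → ℂ) × ℂ) (QuotD d))
      (_ : TopologicalSpace (Total (latticeA d)))
      (_ : ChartedSpace (SymMat d × (Fin d → ℂ)) (Total (latticeA d)))
      (_ : TopologicalSpace (Total (latticeB d)))
      (_ : ChartedSpace (SymMat d × (Fin d → ℂ)) (Total (latticeB d))),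
      IsComplexQuotient (EY := SymMat d × (Fin d → ℂ) × (Fin d → ℂ) × ℂ)
        (𝓘(ℂ, SymMat d).prod (𝓘(ℂ, Fin d → ℂ).prod (𝓘(ℂ, Fin d → ℂ).prod 𝓘(ℂ, ℂ))))
        (fun x : Coord d => toQuotD d (φ x)) ∧
      IsComplexQuotient (EY := SymMat d × (Fin d → ℂ)) (𝓘(ℂ, SymMat d).prod 𝓘(ℂ, Fin d → ℂ))
        (fun x : Siegel d × (Fin d → ℂ) => Total.cls (latticeA d) x.1 x.2) ∧
      IsComplexQuotient (EY := SymMat d × (Fin d → ℂ)) (𝓘(ℂ, SymMat d).prod 𝓘(ℂ, Fin d → ℂ))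
        (fun x : Siegel d × (Fin d → ℂ) => Total.cls (latticeB d) x.1 x.2) ∧
      -- `P^u(ℤ) \ D` is the Poincaré torsor of the universal family
      ∃ (X : TorusExtension (SymMat d × (Fin d → ℂ)) (Total (latticeB d))
            (SymMat d × (Fin d → ℂ) × (Fin d → ℂ) × ℂ) (QuotD d) (fun b => latticeA d b.base))
        (X' : TorusExtension (SymMat d × (Fin d → ℂ)) (Total (latticeA d))
            (SymMat d × (Fin d → ℂ) × (Fin d → ℂ) × ℂ) (QuotD d) (fun a => latticeB d a.base)),
        IsPoincareTorsor.{u} (SymMat d) (latticeA d) (latticeB d) X X' ∧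
        -- the structure maps in the coordinates `(τ, u, v, w)`
        ∀ (τ : Siegel d) (u v : Fin d → ℂ) (w : ℂ),
          X.π (toQuotD d (φ (τ, u, v, w))) = Total.cls (latticeB d) τ u ∧
          X'.π (toQuotD d (φ (τ, u, v, w))) = Total.cls (latticeA d) τ v ∧
          (∀ c : ℂ, X.act (Units.mk0 (Complex.exp c) (Complex.exp_ne_zero c))
              (toQuotD d (φ (τ, u, v, w))) = toQuotD d (φ (τ, u, v, w + c))) ∧
          (∀ (v' : Fin d → ℂ) (w' : ℂ),
            fibAdd X.π (toQuotD d (φ (τ, u, v, w))) (toQuotD d (φ (τ, u, v', w'))) =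
              toQuotD d (φ (τ, u, v + v', w + w'))) ∧
          (∀ (u' : Fin d → ℂ) (w' : ℂ),
            fibAdd X'.π (toQuotD d (φ (τ, u, v, w))) (toQuotD d (φ (τ, u', v, w'))) =
              toQuotD d (φ (τ, u + u', v, w + w'))) := by
  refine ⟨fun g hg F hF => hF.moveFiltration hg, periodEquiv d, fun x => stdFil_zero x, ?_⟩
  obtain ⟨tQ, cQ, hQ⟩ := exists_isComplexQuotient_moveCoord one_ne_zero
    (periodQuot_surjective (d := d)) periodQuot_eq_iff
  obtain ⟨tA, cA, hA⟩ := exists_isComplexQuotient_cls one_ne_zero (mem_latticeA (d := d))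
  obtain ⟨tB, cB, hB⟩ := exists_isComplexQuotient_cls Complex.two_pi_I_ne_zero
    (mem_latticeB (d := d))
  refine ⟨tQ, cQ, tA, cA, tB, cB, hQ, hA, hB, ?_⟩
  have := hQ.isManifold
  have := hA.isManifold
  have := hB.isManifold
  -- The scale `1` is that of the lattice of `A`; the dual scale is then `2πi`, that of `B`.
  have h : PoincareChart 1 (latticeA d) (latticeB d) (periodQuot (d := d)) :=
    { scale_ne := one_ne_zero
      mem_iff := mem_latticeA
      mem_dual_iff := by
        rw [dualScale, div_one]
        exact mem_latticeB
      cls_localDiffeo := hB.isLocalDiffeomorph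
      surjective := periodQuot_surjective
      localDiffeo := hQ.isLocalDiffeomorph
      rel := periodQuot_eq_iff }
  have h' := h.swap hA.isLocalDiffeomorph
  exact ⟨h.extension, h'.extension, h.isPoincareTorsor h', fun τ u v w =>
    ⟨h.extension_π (τ, u, v, w), h'.extension_π (τ, v, u, w),
      fun c => h.extension_act c τ u v w, fun v' w' => h.extension_fibAdd τ u v v' w w',
      fun u' w' => h'.extension_fibAdd τ v u u' w w'⟩⟩
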